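/- **Setting.** For $k,d\ge 1$ write $x\in\mathbb R^{kd}$ as $x=(x^{(1)},\dots,x^{(k)})$ with patches $x^{(i)}\in\mathbb R^d$. For a unit vector $w^\star\in\mathbb R^d$ let $\mu_i\in\mathbb R^{kd}$ have $w^\star$ in patch $i$ and zeros elsewhere. For $\sigma>0$, $\mathrm{DSD}$ is the law of $(x,y)$ where $i$ is uniform on $\{1,\dots,k\}$, $y$ is uniform on $\{-1,1\}$, $i$ and $y$ are independent, and $x\mid(y,i)\sim\mathcal N(y\mu_i,\sigma^2 I_{kd})$. The risk of $f:\mathbb R^{kd}\to\mathbb R$ is $R(f,P)=\mathbb E_{(x,y)\sim P}[(f(x)-y)^2]$. The locally connected network (LCN) with parameter $v=[w_1,\dots,w_k,b]\in\mathcal W=\mathbb R^{kd}\times[0,\infty)$ is $$\mathcal M_L[v](x)=\sum_{i=1}^k\phi_b(w_i^Tx^{(i)}),\qquad \phi_b(t)=\mathrm{ReLU}(t-b)-\mathrm{ReLU}(-t-b).$$ An iterative algorithm for a model $\mathcal M$ with parameter set $\mathcal W\subseteq\mathbb R^m$ and inputs in $\mathbb R^p$ draws $v^0$ from an initialization law $W$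 on $\mathcal W$ and, given $n$ samples $S^n$, sets $v^t=F_t(v^{t-1},S^n)$, $1\le t\le T$, returning $\bar\theta_n=\mathcal M[v^T]$. For $\mathcal U\subseteq O(p)$ it is $\mathcal U$-equivariant if there is a set $\mathcal V\subseteq O(m)$ such that $Vv\overset{d}{=}v$ for $v\sim W$ and all $V\in\mathcal V$, and for every $U\in\mathcal U$ there is $V\in\mathcal V$ preserving $\mathcal W$ with $\mathcal M[v](x)=\mathcal M[Vv](Ux)$ and $VF_t(v,\{(x_j,y_j)\}_j)=F_t(Vv,\{(Ux_j,y_j)\}_j)$ for all $x$, all $v\in\mathcal W$, all $t$, and all data sets of any size. The $\delta$-sample complexity $n_\delta(\bar\theta_n,P)$ is the least $n$ such that $\mathbb E[R(\bar\theta_n,P)]\le\delta$, the expectation being over $n$ i.i.d. samples from $P$ and over the initialization. Let $\mathcal U\subseteq O(kd)$ be the group generated by the block-diagonal matrices $\mathrm{Block}(U_1,\dots,U_k)$ with $U_i\in O(d)$ and by the permutation matrices that permute the $k$ patches and keep each patch intact. **Theorem.** For every $B$ there are $\gamma(k,d)>0$, $\eta_1(k,d),\eta_2(k,d)>0$, $b_1(k,d),b_2(k,d)\ge0$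 and a constant $C>0$, such that the following algorithm $\bar\theta_n$ is $\mathcal U$-equivariant for all $k,d$. *Initialization:* $w_i\sim\mathcal N(0,\gamma I_d)$ independently, $b=0$. *Two steps,* $t=1,2$: with $S_1,S_2$ two disjoint batches of $\lfloor n/2\rfloor$ samples and $l(v;S)=\frac1{|S|}\sum_{(x,y)\in S}(y-\mathcal M_L[v](x))^2$, each $w_i$ is replaced by $u_i/\|u_i\|$ where $u_i=w_i-\eta_t\nabla_{w_i}l(v;S_t)$, and the bias is set to $b_t$. Moreover, for every $A$ there is $N_0$ such that for all $k,d\ge N_0$ with $k\le Ae^d$, all $0<\sigma\le B/\sqrt k$ and all unit vectors $w^\star\in\mathbb R^d$, with $\delta=\frac1{400}$ and $$n=\Big\lfloor\max\big(C\,\sigma^2k(k+d)\ln(kd),\;80\,k\ln(kd)\big)\Big\rfloor,$$ one has $\mathbb E[R(\bar\theta_n,\mathrm{DSD})]\le\delta$ with $n$ samples, and hence $n_\delta(\bar\theta_n,\mathrm{DSD})\le n$. -/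

import Mathlib

open MeasureTheory ProbabilityTheory
open scoped NNReal ENNReal

noncomputable section

/-- The action `x ↦ U x` of an orthogonal matrix on column vectors. -/
def orthAct {ι : Type} [Fintype ι] [DecidableEq ι] (U : Matrix.orthogonalGroup ι ℝ)
    (x : EuclideanSpace ℝ ι) : EuclideanSpace ℝ ι :=
  WithLp.toLp 2 (Matrix.mulVec (U : Matrix ι ι ℝ) x.ofLp)

/-- The Gaussian distribution `N(mean, v I)` on `ℝ^ι`. -/
def isoGaussian {ι : Type} [Fintype ι] (mean : EuclideanSpace ℝ ι) (v : ℝ≥0) :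
    Measure (EuclideanSpace ℝ ι) :=
  (Measure.pi fun a => gaussianReal (mean a) v).map (WithLp.toLp 2)

instance {ι : Type} [Fintype ι] (mean : EuclideanSpace ℝ ι) (v : ℝ≥0) :
    IsProbabilityMeasure (isoGaussian mean v) :=
  Measure.isProbabilityMeasure_map (by fun_prop)

/-! Risk, iterative algorithms, sample complexity, equivariance -/

/-- The risk of `f` under the squared loss, with values in `[0, ∞]`. -/
def risk {ι : Type} [Fintype ι] (f : EuclideanSpace ℝ ι → ℝ)
    (P : Measure (EuclideanSpace ℝ ι × ℝ)) : ℝ≥0∞ :=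
  ∫⁻ z, ENNReal.ofReal ((f z.1 - z.2) ^ 2) ∂P

/-- An iterative randomized algorithm for a parametric model: inputs in `ℝ^ι`, labels in `ℝ`,
parameter set `params ⊆ ℝ^κ`. It draws the initial parameter from `init` and applies the update
functions in turn; each update sees the current parameter and the whole data set (of any size
`n`). -/
structure IterativeAlgorithm (ι κ : Type) [Fintype ι] [Fintype κ] where
  params : Set (EuclideanSpace ℝ κ)
  model : EuclideanSpace ℝ κ → EuclideanSpace ℝ ι → ℝ
  init : Measure (EuclideanSpace ℝ κ)
  steps : ℕ
  update : ∀ {n : ℕ}, Fin steps → EuclideanSpace ℝ κ → (Fin n → EuclideanSpace ℝ ι × ℝ) →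
    EuclideanSpace ℝ κ
  init_prob : IsProbabilityMeasure init
  init_mem : ∀ᵐ w ∂init, w ∈ params
  update_mem : ∀ {n : ℕ} (t : Fin steps) (w : EuclideanSpace ℝ κ)
    (S : Fin n → EuclideanSpace ℝ ι × ℝ), w ∈ params → update t w S ∈ params

namespace IterativeAlgorithm

variable {ι κ : Type} [Fintype ι] [Fintype κ]

/-- The parameter after all the updates, started at `w`. -/
def output (a : IterativeAlgorithm ι κ) {n : ℕ} (S : Fin n → EuclideanSpace ℝ ι × ℝ)
    (w : EuclideanSpace ℝ κ) : EuclideanSpace ℝ κ :=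
  Fin.foldl a.steps (fun v t => a.update t v S) w

/-- The risk of the trained model, in expectation over `n` i.i.d. training samples from `P` and
over the initialization. -/
def expectedRisk (a : IterativeAlgorithm ι κ) (P : Measure (EuclideanSpace ℝ ι × ℝ))
    (n : ℕ) : ℝ≥0∞ :=
  ∫⁻ S, ∫⁻ w, risk (a.model (a.output S w)) P ∂a.init ∂(Measure.pi fun _ : Fin n => P)

/-- The smallest number of samples with which the expected risk is at most `δ` (`⊤` if there is
none). -/
def sampleComplexity (a : IterativeAlgorithm ι κ) (P : Measure (EuclideanSpace ℝ ι × ℝ))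
    (δ : ℝ≥0∞) : ℕ∞ :=
  ⨅ n ∈ {n : ℕ | a.expectedRisk P n ≤ δ}, (n : ℕ∞)

/-- Equivariance of an algorithm under a set `𝒰` of orthogonal transformations of the inputs. -/
def IsEquivariant [DecidableEq ι] [DecidableEq κ] (a : IterativeAlgorithm ι κ)
    (𝒰 : Set (Matrix.orthogonalGroup ι ℝ)) : Prop :=
  ∃ 𝒱 : Set (Matrix.orthogonalGroup κ ℝ),
    (∀ U ∈ 𝒰, ∃ V ∈ 𝒱,
      (∀ w ∈ a.params, orthAct V w ∈ a.params) ∧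
      (∀ x, ∀ w ∈ a.params, a.model w x = a.model (orthAct V w) (orthAct U x)) ∧
      (∀ (n : ℕ) (S : Fin n → EuclideanSpace ℝ ι × ℝ) (t : Fin a.steps), ∀ w ∈ a.params,
        orthAct V (a.update t w S) =
          a.update t (orthAct V w) (fun j => (orthAct U (S j).1, (S j).2)))) ∧
    ∀ V ∈ 𝒱, a.init.map (orthAct V) = a.init

end IterativeAlgorithm

/-! Patches. Inputs live in `ℝ^(k d)`, coordinate `(i, j)` being the `j`-th entry of patch `i`. -/

/-- The `i`-th patch of an input. -/
def patch {k d : ℕ} (x : EuclideanSpace ℝ (Fin k × Fin d)) (i : Fin k) :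
    EuclideanSpace ℝ (Fin d) :=
  WithLp.toLp 2 fun j => x (i, j)

/-- Block-diagonal matrices with orthogonal `d × d` blocks. -/
def blockOrthogonal (k d : ℕ) : Set (Matrix.orthogonalGroup (Fin k × Fin d) ℝ) :=
  {U | ∃ Q : Fin k → Matrix.orthogonalGroup (Fin d) ℝ, ∀ i j i' j',
    (U : Matrix (Fin k × Fin d) (Fin k × Fin d) ℝ) (i, j) (i', j') =
      if i = i' then (Q i : Matrix (Fin d) (Fin d) ℝ) j j' else 0}

/-- Permutation matrices which permute the patches and keep each of them intact. -/
def patchPermutations (k d : ℕ) : Set (Matrix.orthogonalGroup (Fin k × Fin d) ℝ) :=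
  {U | ∃ π : Equiv.Perm (Fin k), ∀ i j i' j',
    (U : Matrix (Fin k × Fin d) (Fin k × Fin d) ℝ) (i, j) (i', j') =
      if i = π i' ∧ j = j' then 1 else 0}

/-- The group generated by the two. -/
def patchGroup (k d : ℕ) : Subgroup (Matrix.orthogonalGroup (Fin k × Fin d) ℝ) :=
  Subgroup.closure (blockOrthogonal k d ∪ patchPermutations k d)

/-! Dynamic Signal Distribution -/

/-- The mean vector with the signal `w` in patch `i` and zeros elsewhere. -/
def signalMean {k d : ℕ} (w : EuclideanSpace ℝ (Fin d)) (i : Fin k) :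
    EuclideanSpace ℝ (Fin k × Fin d) :=
  WithLp.toLp 2 fun a => if a.1 = i then w a.2 else 0

/-- The distribution DSD of `(x, y)`: `i` uniform on the `k` patches, `y` uniform on `{1, -1}`, and
`x ∼ N(y μ_i, σ² I)` given `(i, y)`. -/
def DSD (k d : ℕ) (w : EuclideanSpace ℝ (Fin d)) (σ : ℝ) :
    Measure (EuclideanSpace ℝ (Fin k × Fin d) × ℝ) :=
  (2 * (k : ℝ≥0∞))⁻¹ • ∑ i : Fin k, ∑ y ∈ ({1, -1} : Finset ℝ),
    (isoGaussian (y • signalMean w i) (Real.toNNReal (σ ^ 2))).prod (Measure.dirac y)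

/-! Locally connected networks and their training -/

/-- The soft-thresholding activation `ReLU(t - b) - ReLU(-t - b)`. -/
def lsa (b t : ℝ) : ℝ := max (t - b) 0 - max (-t - b) 0

/-- Parameter vectors of the LCN: the entries of the `k` weight vectors, and the bias. -/
abbrev LCNParam (k d : ℕ) := EuclideanSpace ℝ ((Fin k × Fin d) ⊕ Unit)

/-- The parameter vector `[w_1, …, w_k, b]`. -/
def mkParam {k d : ℕ} (w : Fin k → EuclideanSpace ℝ (Fin d)) (b : ℝ) : LCNParam k d :=
  WithLp.toLp 2 (Sum.elim (fun a => w a.1 a.2) (fun _ => b))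

def weight {k d : ℕ} (v : LCNParam k d) (i : Fin k) : EuclideanSpace ℝ (Fin d) :=
  WithLp.toLp 2 fun j => v (Sum.inl (i, j))

def bias {k d : ℕ} (v : LCNParam k d) : ℝ := v (Sum.inr ())

/-- The function computed by the LCN. -/
def lcn {k d : ℕ} (v : LCNParam k d) (x : EuclideanSpace ℝ (Fin k × Fin d)) : ℝ :=
  ∑ i, lsa (bias v) (inner ℝ (weight v i) (patch x i))

/-- The empirical squared loss. -/
def empLoss {k d N : ℕ} (v : LCNParam k d)
    (S : Fin N → EuclideanSpace ℝ (Fin k × Fin d) × ℝ) : ℝ :=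
  1 / (N : ℝ) * ∑ j, ((S j).2 - lcn v (S j).1) ^ 2

/-- The gradient of the empirical loss with respect to the weight vector `w_i`. -/
def gradWeight {k d N : ℕ} (v : LCNParam k d)
    (S : Fin N → EuclideanSpace ℝ (Fin k × Fin d) × ℝ) (i : Fin k) : EuclideanSpace ℝ (Fin d) :=
  gradient (fun u => empLoss (mkParam (Function.update (weight v) i u) (bias v)) S) (weight v i)

/-- The `t`-th of two disjoint batches of `n / 2` samples each. -/
def halfBatch {α : Type} {n : ℕ} (S : Fin n → α) (t : Fin 2) : Fin (n / 2) → α :=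
  fun j => S ⟨t.val * (n / 2) + j.val, by
    have h1 := t.isLt
    have h2 := j.isLt
    have h3 : t.val * (n / 2) ≤ 1 * (n / 2) := Nat.mul_le_mul_right _ (by omega)
    omega⟩

/-- One step: gradient descent with step size `η` on a batch, then normalization of each weight
vector to unit length; the bias is set to `b`. -/
def projGradStep {k d N : ℕ} (η b : ℝ) (v : LCNParam k d)
    (S : Fin N → EuclideanSpace ℝ (Fin k × Fin d) × ℝ) : LCNParam k d :=
  mkParam (fun i => ‖weight v i - η • gradWeight v S i‖⁻¹ • (weight v i - η • gradWeight v S i)) b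

theorem measurable_mkParam_patch (k d : ℕ) :
    Measurable fun w : EuclideanSpace ℝ (Fin k × Fin d) => mkParam (patch w) 0 := by
  unfold mkParam patch
  refine (PiLp.continuous_toLp 2 _).measurable.comp (measurable_pi_lambda _ fun a => ?_)
  rcases a with a | a <;> simp only [Sum.elim_inl, Sum.elim_inr] <;> fun_prop

/-- The training algorithm for the LCN: weights `w_i ∼ N(0, γ I)` independent, bias `0`; then two
normalized gradient steps with step sizes `η 0, η 1`, on disjoint halves of the data, after which
the bias is `b 0`, respectively `b 1`. -/
def lcnAlgorithm (k d : ℕ) (γ : ℝ≥0) (η : Fin 2 → ℝ) (b : Fin 2 → ℝ≥0) :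
    IterativeAlgorithm (Fin k × Fin d) ((Fin k × Fin d) ⊕ Unit) where
  params := {v | 0 ≤ bias v}
  model := lcn
  init := (isoGaussian (0 : EuclideanSpace ℝ (Fin k × Fin d)) γ).map
    fun w => mkParam (patch w) 0
  steps := 2
  update := fun t v S => projGradStep (η t) (b t) v (halfBatch S t)
  init_prob := Measure.isProbabilityMeasure_map (measurable_mkParam_patch k d).aemeasurable
  init_mem := by
    refine (ae_map_iff (measurable_mkParam_patch k d).aemeasurable ?_).2 ?_
    · have h : Measurable (bias : LCNParam k d → ℝ) := by unfold bias; fun_prop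
      exact measurableSet_le measurable_const h
    · exact Filter.Eventually.of_forall fun w => by simp [bias, mkParam]
  update_mem := by
    intro n t w S _
    simp [projGradStep, bias, mkParam]

end

/-! Empirical means of i.i.d. samples -/

/-! The activation is odd, so the network is odd and its loss and training steps do not change when
a sample `(x, y)` becomes `(y x, 1)` (`sq_sign_sub_lcn`, `projGradStep_sign`). All labels may thus
be taken to be 1, with inputs `μ_i + σ ξ`, where `i` is uniform and `ξ` standard Gaussian.
`risk_lcn_le` then reduces the risk to the mean squared distance of the trained weights to `w`: the
final bias, of order `√(log k / k)`, is small as a perturbation of the signal, yet large enough to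
remove the noise in the other patches, whose size is at most of order `1 / √k`.

With bias 0 the network is linear, and the initialization is polynomially small. So the first
gradient step with step size `1/2` replaces each weight by nearly the empirical mean of its patch,
which has expectation `w / k`. The squared error relative to this signal is about `k / N + σ² k² d /
N`. Write `L = log (k d)`.

If `k` is at most of order `L`, this error is already small (`norm_firstWeight_sub_le`). The second
step then only has to do no harm, which a polynomially small step size ensures
(`norm_gradWeight_le`).

If `k` is larger, the error along `w` alone is still small, because only one coordinate of the noise
enters. After normalization the weight has inner product at least `2 b` with `w`
(`le_inner_firstWeight`), where `b` is of order `√(L / k)`. This weak correlation suffices: by a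
union bound over the fresh second batch, all projected noise is below `b / 4`, so the threshold `b`
turns off every patch without signal and keeps the signal patch active (`gradWeight_second_eq`). The
second gradient for patch `i` therefore only sees the samples with signal in that patch. Its mean is
nearly parallel to `w`, and its relative squared error is only of order `k / N + σ² k d / N`
(`lintegral_normSq_mean_signalGrad_le`), a factor `k` better in the noise term. A large step size
makes the old weight negligible, and normalization yields a vector close to `w`
(`norm_second_weight_sub_le`).

Failure events are handled by a pointwise form of Markov's inequality: the squared distance is at
most its good value plus four times a sum of nonnegative error terms, since it never exceeds 4 and
every good event holds when the sum is below 1 (`le_add_four_mul`). Only expectations of these terms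
remain (`lintegral_triple_le`).

Equivariance holds for all hyperparameters: the inputs and the weights carry the same action, inner
products are preserved, and both the gradient and the normalization commute with isometries
(`lcnAlgorithm_isEquivariant`). -/

theorem lintegral_sq_empirical_mean_sub_le {Ω : Type*} [MeasurableSpace Ω] (Q : Measure Ω)
    [IsProbabilityMeasure Q] {g : Ω → ℝ} (hg : MemLp g 2 Q) {N : ℕ} (hN : 0 < N) :
    ∫⁻ S : Fin N → Ω, ENNReal.ofReal ((1 / (N : ℝ) * ∑ j, g (S j) - ∫ ω, g ω ∂Q) ^ 2)
      ∂(Measure.pi fun _ => Q) ≤ ENNReal.ofReal ((∫ ω, g ω ^ 2 ∂Q) / N) := by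
  have hN' : (N : ℝ) ≠ 0 := by positivity
  have hm : ∀ j : Fin N, MemLp (fun S : Fin N → Ω => g (S j)) 2 (Measure.pi fun _ => Q) :=
    fun j => hg.comp_measurePreserving (measurePreserving_eval (fun _ : Fin N => Q) j)
  have hsum : MemLp (∑ j : Fin N, fun S : Fin N → Ω => g (S j)) 2 (Measure.pi fun _ => Q) :=
    memLp_finsetSum' _ fun j _ => hm j
  have hX : MemLp (fun S : Fin N → Ω => 1 / (N : ℝ) * ∑ j, g (S j)) 2
      (Measure.pi fun _ => Q) := by
    have := hsum.const_mul (1 / (N : ℝ))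
    simpa [Finset.sum_apply] using this
  have hint : ∀ j : Fin N, ∫ S : Fin N → Ω, g (S j) ∂(Measure.pi fun _ => Q) = ∫ ω, g ω ∂Q := by
    intro j
    exact integral_comp_eval (μ := fun _ : Fin N => Q) hg.aestronglyMeasurable
  have hE : ∫ S : Fin N → Ω, 1 / (N : ℝ) * ∑ j, g (S j) ∂(Measure.pi fun _ => Q)
      = ∫ ω, g ω ∂Q := by
    rw [integral_const_mul, integral_finsetSum _ fun j _ => (hm j).integrable (by norm_num)]
    simp only [hint, Finset.sum_const, Finset.card_univ, Fintype.card_fin, nsmul_eq_mul]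
    field_simp
  have hV : Var[fun S : Fin N → Ω => 1 / (N : ℝ) * ∑ j, g (S j); Measure.pi fun _ => Q]
      = Var[g; Q] / N := by
    rw [variance_const_mul]
    have := variance_sum_pi (μ := fun _ : Fin N => Q) (X := fun _ => g) fun _ => hg
    have h2 : (∑ j : Fin N, fun S : Fin N → Ω => g (S j))
        = fun S : Fin N → Ω => ∑ j, g (S j) := by ext S; simp
    rw [h2] at this
    rw [this]
    simp only [Finset.sum_const, Finset.card_univ, Fintype.card_fin, nsmul_eq_mul]
    field_simp
  calc _ = eVar[fun S : Fin N → Ω => 1 / (N : ℝ) * ∑ j, g (S j); Measure.pi fun _ => Q] := by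
        rw [evariance_eq_lintegral_ofReal, hE]
    _ = ENNReal.ofReal (Var[g; Q] / N) := by rw [← hX.ofReal_variance_eq, hV]
    _ ≤ _ := by
        apply ENNReal.ofReal_le_ofReal
        gcongr
        exact variance_le_expectation_sq hg.aestronglyMeasurable

theorem lintegral_normSq_empirical_mean_sub_le {Ω ι : Type*} [Fintype ι] [MeasurableSpace Ω]
    (Q : Measure Ω) [IsProbabilityMeasure Q] {h : Ω → EuclideanSpace ℝ ι} (hh : Measurable h)
    {m : EuclideanSpace ℝ ι}
    (hg : ∀ a, MemLp (fun ω => h ω a) 2 Q) (hm : ∀ a, ∫ ω, h ω a ∂Q = m a) {V : ℝ}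
    (hV : ∑ a, ∫ ω, (h ω a) ^ 2 ∂Q ≤ V) {N : ℕ} (hN : 0 < N) :
    ∫⁻ S : Fin N → Ω, ENNReal.ofReal (‖(1 / (N : ℝ)) • ∑ j, h (S j) - m‖ ^ 2)
      ∂(Measure.pi fun _ => Q) ≤ ENNReal.ofReal (V / N) := by
  have h1 : ∀ S : Fin N → Ω, ENNReal.ofReal (‖(1 / (N : ℝ)) • ∑ j, h (S j) - m‖ ^ 2)
      = ∑ a, ENNReal.ofReal ((1 / (N : ℝ) * ∑ j, h (S j) a - ∫ ω, h ω a ∂Q) ^ 2) := by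
    intro S
    rw [EuclideanSpace.real_norm_sq_eq, ENNReal.ofReal_sum_of_nonneg fun a _ => sq_nonneg _]
    refine Finset.sum_congr rfl fun a _ => ?_
    simp [hm]
  simp_rw [h1]
  rw [lintegral_finsetSum _ fun a _ => by fun_prop]
  calc _ ≤ ∑ a, ENNReal.ofReal ((∫ ω, h ω a ^ 2 ∂Q) / N) :=
        Finset.sum_le_sum fun a _ => lintegral_sq_empirical_mean_sub_le Q (hg a) hN
    _ = ENNReal.ofReal ((∑ a, ∫ ω, (h ω a) ^ 2 ∂Q) / N) := by
        rw [Finset.sum_div, ENNReal.ofReal_sum_of_nonneg fun a _ =>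
          div_nonneg (integral_nonneg fun _ => sq_nonneg _) (by positivity)]
    _ ≤ _ := by gcongr

/-- Independent coordinates with a common law, selected injectively. -/
theorem map_pi_comp_injective {ι ι' Ω : Type*} [Fintype ι] [Fintype ι'] [MeasurableSpace Ω]
    (Q : Measure Ω) [IsProbabilityMeasure Q] {e : ι' → ι} (he : Function.Injective e) :
    (Measure.pi fun _ : ι => Q).map (fun S => S ∘ e) = Measure.pi fun _ : ι' => Q := by
  classical
  refine (Measure.pi_eq fun s hs => ?_).symm
  rw [Measure.map_apply (by fun_prop) (MeasurableSet.univ_pi hs)]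
  have : (fun S : ι → Ω => S ∘ e) ⁻¹' Set.univ.pi s
      = Set.univ.pi fun i => ⋂ j ∈ {j | e j = i}, s j := by
    ext S
    simp only [Set.mem_preimage, Set.mem_pi, Set.mem_univ, forall_const, Function.comp,
      Set.mem_iInter, Set.mem_ofPred_eq]
    exact ⟨fun h i j hj => hj ▸ h j, fun h j => h _ j rfl⟩
  rw [this, Measure.pi_pi]
  rw [← Finset.prod_subset (Finset.subset_univ (Finset.univ.image e))]
  · rw [Finset.prod_image fun x _ y _ h => he h]
    refine Finset.prod_congr rfl fun j _ => ?_
    congr 1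
    ext x
    simp [he.eq_iff]
  · intro i _ hi
    have : (⋂ j ∈ {j | e j = i}, s j) = Set.univ := by
      ext x
      simp only [Set.mem_iInter, Set.mem_ofPred_eq, Set.mem_univ, iff_true]
      intro j hj
      exact absurd (Finset.mem_image.2 ⟨j, Finset.mem_univ _, hj⟩) hi
    rw [this, measure_univ]

/-- The two batches use disjoint coordinates, so they are independent. For odd `n` the last sample
belongs to neither, which is why the selection is only injective. -/
theorem map_halfBatch {Ω : Type} [MeasurableSpace Ω] (Q : Measure Ω) [IsProbabilityMeasure Q]
    (n : ℕ) :
    (Measure.pi fun _ : Fin n => Q).map (fun S => (halfBatch S 0, halfBatch S 1))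
      = (Measure.pi fun _ : Fin (n / 2) => Q).prod (Measure.pi fun _ : Fin (n / 2) => Q) := by
  let e : Fin (n / 2) ⊕ Fin (n / 2) → Fin n := Sum.elim (fun j => ⟨j, by omega⟩)
    (fun j => ⟨n / 2 + j, by omega⟩)
  have he : Function.Injective e := by
    rintro (a | a) (b | b) h <;> simp [e, Fin.ext_iff] at h ⊢ <;> omega
  have h1 := map_pi_comp_injective Q he
  have h2 := (measurePreserving_sumPiEquivProdPi
    (fun _ : Fin (n / 2) ⊕ Fin (n / 2) => Q)).map_eq
  rw [← h1, Measure.map_map (MeasurableEquiv.measurable _) (by fun_prop)] at h2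
  rw [← h2]
  congr 1
  ext S j
  · simp [halfBatch, e, MeasurableEquiv.coe_sumPiEquivProdPi]
  · simp [halfBatch, e, MeasurableEquiv.coe_sumPiEquivProdPi]

/-! Moments of the standard Gaussian -/

section Gaussian
variable {E : Type*} [NormedAddCommGroup E] [InnerProductSpace ℝ E] [FiniteDimensional ℝ E]
  [MeasurableSpace E] [BorelSpace E]

theorem map_inner_stdGaussian (u : E) :
    (stdGaussian E).map (fun ξ => inner ℝ u ξ) = gaussianReal 0 (‖u‖₊ ^ 2) := by
  apply Measure.ext_of_charFun
  ext t
  have h1 : charFun ((stdGaussian E).map (fun ξ => inner ℝ u ξ)) t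
      = charFun (stdGaussian E) (t • u) := by
    rw [charFun_apply, charFun_apply, integral_map (by fun_prop) (by fun_prop)]
    congr 1
    ext ξ
    simp [real_inner_smul_right, real_inner_comm, mul_comm]
  rw [h1, charFun_stdGaussian, charFun_gaussianReal]
  simp [norm_smul, mul_pow, ← Complex.ofReal_pow]
  ring_nf

theorem memLp_inner_stdGaussian (u : E) {p : ℝ≥0∞} (hp : p ≠ ∞) :
    MemLp (fun ξ => inner ℝ u ξ) p (stdGaussian E) := by
  have := memLp_id_gaussianReal' (μ := 0) (v := ‖u‖₊ ^ 2) p hp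
  rw [← map_inner_stdGaussian u] at this
  exact this.comp_of_map (by fun_prop)

theorem integral_inner_stdGaussian (u : E) : ∫ ξ, inner ℝ u ξ ∂(stdGaussian E) = 0 := by
  have := integral_id_gaussianReal (μ := 0) (v := ‖u‖₊ ^ 2)
  rwa [← map_inner_stdGaussian u, integral_map (by fun_prop) (by fun_prop)] at this

theorem integrable_inner_mul_inner_stdGaussian (u v : E) :
    Integrable (fun ξ => inner ℝ u ξ * inner ℝ v ξ) (stdGaussian E) :=
  (memLp_inner_stdGaussian u (p := 2) ENNReal.ofNat_ne_top).integrable_mul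
    (memLp_inner_stdGaussian v (p := 2) ENNReal.ofNat_ne_top)

theorem integral_inner_sq_stdGaussian (u : E) :
    ∫ ξ, inner ℝ u ξ ^ 2 ∂(stdGaussian E) = ‖u‖ ^ 2 := by
  have h := variance_id_gaussianReal (μ := 0) (v := ‖u‖₊ ^ 2)
  rw [← map_inner_stdGaussian u, variance_map (by fun_prop) (by fun_prop)] at h
  rw [variance_of_integral_eq_zero (by fun_prop)
    (by simpa [Function.comp_def] using integral_inner_stdGaussian u)] at h
  simpa using h

theorem integral_inner_mul_inner_stdGaussian (u v : E) :
    ∫ ξ, inner ℝ u ξ * inner ℝ v ξ ∂(stdGaussian E) = inner ℝ u v := by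
  have h := integral_inner_sq_stdGaussian (u + v)
  have e : ∀ ξ : E, inner ℝ (u + v) ξ ^ 2
      = (inner ℝ u ξ ^ 2 + inner ℝ v ξ ^ 2) + 2 * (inner ℝ u ξ * inner ℝ v ξ) := by
    intro ξ; rw [inner_add_left]; ring
  have i1 := (memLp_inner_stdGaussian u (p := 2) ENNReal.ofNat_ne_top).integrable_sq
  have i2 := (memLp_inner_stdGaussian v (p := 2) ENNReal.ofNat_ne_top).integrable_sq
  simp_rw [e] at h
  rw [integral_add (f := fun ξ => inner ℝ u ξ ^ 2 + inner ℝ v ξ ^ 2) (i1.add i2) ((integrable_inner_mul_inner_stdGaussian u v).const_mul 2),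
    integral_add i1 i2, integral_const_mul, integral_inner_sq_stdGaussian,
    integral_inner_sq_stdGaussian, norm_add_sq_real] at h
  linarith

theorem integrable_exp_inner_stdGaussian (u : E) :
    Integrable (fun ξ => Real.exp (inner ℝ u ξ)) (stdGaussian E) := by
  have h := integrable_exp_mul_gaussianReal (μ := 0) (v := ‖u‖₊ ^ 2) 1
  rw [← map_inner_stdGaussian u] at h
  simpa [Function.comp_def] using (integrable_map_measure (by fun_prop) (by fun_prop)).1 h

theorem integral_exp_inner_stdGaussian (u : E) :
    ∫ ξ, Real.exp (inner ℝ u ξ) ∂(stdGaussian E) = Real.exp (‖u‖ ^ 2 / 2) := by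
  have h := mgf_gaussianReal (map_inner_stdGaussian u) 1
  simpa [mgf] using h

theorem integrable_inner_pow_four_stdGaussian (u : E) :
    Integrable (fun ξ => inner ℝ u ξ ^ 4) (stdGaussian E) :=
  (memLp_inner_stdGaussian u (p := 4) ENNReal.ofNat_ne_top).integrable_norm_pow (by norm_num) |>.congr
    (Filter.Eventually.of_forall fun ξ => by
      simp only [Real.norm_eq_abs]; exact Even.pow_abs (by decide) _)

theorem pow_four_le_exp_add_exp_neg (x : ℝ) : x ^ 4 ≤ 24 * (Real.exp x + Real.exp (-x)) := by
  have key : ∀ y : ℝ, 0 ≤ y → y ^ 4 ≤ 24 * Real.exp y := by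
    intro y hy
    have := Real.pow_div_factorial_le_exp y hy 4
    norm_num [Nat.factorial] at this
    linarith
  have h1 := Real.exp_pos x
  have h2 := Real.exp_pos (-x)
  rcases le_total 0 x with h | h
  · linarith [key x h]
  · have := key (-x) (by linarith)
    have e : (-x) ^ 4 = x ^ 4 := by ring
    linarith

/-- The constant is not sharp; domination by the exponential moment avoids computing the fourth
moment. -/
theorem integral_inner_pow_four_stdGaussian_le {u : E} (hu : ‖u‖ ≤ 1) :
    ∫ ξ, inner ℝ u ξ ^ 4 ∂(stdGaussian E) ≤ 96 := by
  have i1 := integrable_exp_inner_stdGaussian u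
  have i2 := integrable_exp_inner_stdGaussian (-u)
  calc ∫ ξ, inner ℝ u ξ ^ 4 ∂(stdGaussian E)
      ≤ ∫ ξ, 24 * (Real.exp (inner ℝ u ξ) + Real.exp (inner ℝ (-u) ξ)) ∂(stdGaussian E) := by
        refine integral_mono (integrable_inner_pow_four_stdGaussian u)
          ((i1.add i2).const_mul 24) fun ξ => ?_
        simpa [inner_neg_left] using pow_four_le_exp_add_exp_neg (inner ℝ u ξ)
    _ = 48 * Real.exp (‖u‖ ^ 2 / 2) := by
        rw [integral_const_mul, integral_add i1 i2, integral_exp_inner_stdGaussian,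
          integral_exp_inner_stdGaussian, norm_neg]
        ring
    _ ≤ 48 * Real.exp (1 / 2) := by
        gcongr
        nlinarith [norm_nonneg u]
    _ ≤ 96 := by
        have : Real.exp (1 / 2) ≤ 2 := by
          have h := Real.exp_one_lt_d9
          have : Real.exp (1 / 2) ^ 2 = Real.exp 1 := by
            rw [← Real.exp_nat_mul]; norm_num
          nlinarith [Real.exp_pos (1 / 2)]
        linarith

end Gaussian

/-! A noise representation of the data distribution -/

theorem isoGaussian_eq_map_stdGaussian {ι : Type} [Fintype ι] (m : EuclideanSpace ℝ ι) (s : ℝ) :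
    isoGaussian m (Real.toNNReal (s ^ 2))
      = (stdGaussian (EuclideanSpace ℝ ι)).map (fun ξ => m + s • ξ) := by
  have h1 : ∀ a, (gaussianReal 0 1).map (fun x => m a + s * x)
      = gaussianReal (m a) (Real.toNNReal (s ^ 2)) := by
    intro a
    have h2 : (fun x => m a + s * x) = (fun x => m a + x) ∘ (fun x => s * x) := rfl
    rw [h2, ← Measure.map_map (by fun_prop) (by fun_prop), gaussianReal_map_const_mul,
      gaussianReal_map_const_add]
    congr 1
    · simp
    · ext; simp [sq_nonneg]
  have h3 : (Measure.pi fun _ : ι => gaussianReal 0 1).map (fun x a => m a + s * x a)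
      = Measure.pi fun a => gaussianReal (m a) (Real.toNNReal (s ^ 2)) := by
    have : ∀ a, SigmaFinite ((gaussianReal 0 1).map (fun x => m a + s * x)) := by
      intro a; rw [h1 a]; infer_instance
    rw [Measure.pi_map_pi (f := fun a x => m a + s * x) fun a => by fun_prop]
    simp_rw [h1]
  rw [isoGaussian, ← h3, ← map_pi_eq_stdGaussian, Measure.map_map (by fun_prop) (by fun_prop),
    Measure.map_map (by fun_prop) (by fun_prop)]
  congr 1

/-- The position of the signal, uniform on the patches, and an independent standard Gaussian
noise vector. -/
noncomputable def signalNoise (k d : ℕ) : Measure (Fin k × EuclideanSpace ℝ (Fin k × Fin d)) :=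
  ((k : ℝ≥0∞)⁻¹ • Measure.count).prod (stdGaussian _)

instance (k d : ℕ) [NeZero k] : IsProbabilityMeasure (signalNoise k d) := by
  have : IsProbabilityMeasure ((k : ℝ≥0∞)⁻¹ • (Measure.count : Measure (Fin k))) :=
    ⟨by simp [Measure.count_univ, ENNReal.inv_mul_cancel, NeZero.ne k]⟩
  unfold signalNoise
  infer_instance

theorem lintegral_signalNoise (k d : ℕ) {f : Fin k × EuclideanSpace ℝ (Fin k × Fin d) → ℝ≥0∞}
    (hf : Measurable f) :
    ∫⁻ ω, f ω ∂(signalNoise k d)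
      = (k : ℝ≥0∞)⁻¹ * ∑ i, ∫⁻ ξ, f (i, ξ) ∂(stdGaussian _) := by
  rw [signalNoise, lintegral_prod _ hf.aemeasurable, lintegral_smul_measure, lintegral_count,
    tsum_fintype, smul_eq_mul]

/-- The input with the given signal position and noise, and with positive label. -/
noncomputable def noisySignal {k d : ℕ} (w : EuclideanSpace ℝ (Fin d)) (σ : ℝ)
    (ω : Fin k × EuclideanSpace ℝ (Fin k × Fin d)) : EuclideanSpace ℝ (Fin k × Fin d) :=
  signalMean w ω.1 + σ • ω.2

theorem measurable_signalMean {k d : ℕ} (w : EuclideanSpace ℝ (Fin d)) :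
    Measurable fun i : Fin k => signalMean w i := measurable_of_finite _

@[fun_prop]
theorem measurable_noisySignal {k d : ℕ} (w : EuclideanSpace ℝ (Fin d)) (σ : ℝ) :
    Measurable (noisySignal (k := k) w σ) := by
  unfold noisySignal
  exact ((measurable_signalMean w).comp measurable_fst).add (measurable_snd.const_smul σ)

/-- The uniform distribution on `{1, -1}`. -/
noncomputable def fairSign : Measure ℝ := (2 : ℝ≥0∞)⁻¹ • (Measure.dirac 1 + Measure.dirac (-1))

instance : IsProbabilityMeasure fairSign :=
  ⟨by simp [fairSign, ENNReal.inv_two_add_inv_two]⟩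

theorem ae_fairSign : ∀ᵐ y ∂fairSign, y = 1 ∨ y = -1 := by
  have hs : MeasurableSet {y : ℝ | y = 1 ∨ y = -1} :=
    (measurableSet_singleton (1 : ℝ)).union (measurableSet_singleton (-1 : ℝ))
  rw [fairSign]
  refine Measure.ae_smul_measure ?_ _
  rw [ae_add_measure_iff, ae_dirac_iff hs, ae_dirac_iff hs]
  simp

theorem lintegral_fairSign (f : ℝ → ℝ≥0∞) :
    ∫⁻ y, f y ∂fairSign = 2⁻¹ * (f 1 + f (-1)) := by
  rw [fairSign, lintegral_smul_measure, lintegral_add_measure, lintegral_dirac, lintegral_dirac,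
    smul_eq_mul]

/-- The centred Gaussian is symmetric, so the label may multiply the noise as well as the signal.
This makes the input the label times a vector independent of it. -/
theorem DSD_eq_map (k d : ℕ) (w : EuclideanSpace ℝ (Fin d)) (σ : ℝ) :
    DSD k d w σ = ((signalNoise k d).prod fairSign).map
      (fun p => (p.2 • noisySignal w σ p.1, p.2)) := by
  refine Measure.ext_of_lintegral _ fun f hf => ?_
  have hm : Measurable fun p : (Fin k × EuclideanSpace ℝ (Fin k × Fin d)) × ℝ =>
      (p.2 • noisySignal w σ p.1, p.2) := by fun_prop
  have hy : ∀ (i : Fin k) (y : ℝ), (y = 1 ∨ y = -1) →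
      ∫⁻ z, f z ∂((isoGaussian (y • signalMean w i) (Real.toNNReal (σ ^ 2))).prod
        (Measure.dirac y)) = ∫⁻ ξ, f (y • noisySignal w σ (i, ξ), y) ∂(stdGaussian _) := by
    intro i y hy
    have h2 : σ ^ 2 = (y * σ) ^ 2 := by rcases hy with rfl | rfl <;> ring
    rw [lintegral_prod _ hf.aemeasurable]
    simp_rw [lintegral_dirac]
    rw [h2, isoGaussian_eq_map_stdGaussian, lintegral_map (by fun_prop) (by fun_prop)]
    simp [noisySignal, smul_smul]
  rw [lintegral_map hf hm, lintegral_prod _ (by fun_prop)]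
  simp_rw [lintegral_fairSign]
  rw [lintegral_signalNoise _ _ (by fun_prop), DSD, lintegral_smul_measure,
    lintegral_finsetSum_measure]
  simp_rw [lintegral_finsetSum_measure]
  rw [ENNReal.mul_inv (by simp) (by simp), smul_eq_mul, mul_comm (2 : ℝ≥0∞)⁻¹, mul_assoc]
  congr 1
  rw [Finset.mul_sum]
  refine Finset.sum_congr rfl fun i _ => ?_
  rw [Finset.sum_pair (by norm_num), hy i 1 (by simp), hy i (-1) (by simp),
    lintegral_const_mul _ (by fun_prop), lintegral_add_left (by fun_prop)]

/-! Symmetry of the network in the sign of the input -/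

theorem lsa_neg (b t : ℝ) : lsa b (-t) = -lsa b t := by simp [lsa]

theorem patch_smul {k d : ℕ} (c : ℝ) (x : EuclideanSpace ℝ (Fin k × Fin d)) (i : Fin k) :
    patch (c • x) i = c • patch x i := by ext; simp [patch]

theorem patch_add {k d : ℕ} (x y : EuclideanSpace ℝ (Fin k × Fin d)) (i : Fin k) :
    patch (x + y) i = patch x i + patch y i := by ext; simp [patch]

theorem lcn_neg {k d : ℕ} (v : LCNParam k d) (x : EuclideanSpace ℝ (Fin k × Fin d)) :
    lcn v (-x) = -lcn v x := by
  have : ∀ i, patch (-x) i = -patch x i := fun i => by ext; simp [patch]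
  simp [lcn, this, inner_neg_right, lsa_neg]

theorem sq_sign_sub_lcn {k d : ℕ} (v : LCNParam k d) (x : EuclideanSpace ℝ (Fin k × Fin d))
    {y : ℝ} (hy : y = 1 ∨ y = -1) : (y - lcn v (y • x)) ^ 2 = (1 - lcn v x) ^ 2 := by
  rcases hy with rfl | rfl
  · simp
  · rw [neg_one_smul, lcn_neg]; ring

/-- The hidden signal positions and noise vectors of `N` samples. -/
abbrev NoiseBatch (k d N : ℕ) := Fin N → Fin k × EuclideanSpace ℝ (Fin k × Fin d)

/-- A labelled sample in which all labels are `1`. -/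
noncomputable def positiveSample {k d N : ℕ} (w : EuclideanSpace ℝ (Fin d)) (σ : ℝ)
    (S : NoiseBatch k d N) :
    Fin N → EuclideanSpace ℝ (Fin k × Fin d) × ℝ :=
  fun j => (noisySignal w σ (S j), 1)

theorem projGradStep_sign {k d N : ℕ} (η b : ℝ) (v : LCNParam k d)
    (X : Fin N → EuclideanSpace ℝ (Fin k × Fin d)) {y : Fin N → ℝ}
    (hy : ∀ j, y j = 1 ∨ y j = -1) :
    projGradStep η b v (fun j => (y j • X j, y j)) = projGradStep η b v (fun j => (X j, 1)) := by
  simp only [projGradStep, gradWeight, empLoss, sq_sign_sub_lcn _ _ (hy _)]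

theorem risk_lcn_DSD {k d : ℕ} (w : EuclideanSpace ℝ (Fin d)) (σ : ℝ) (v : LCNParam k d) :
    risk (lcn v) (DSD k d w σ)
      ≤ ∫⁻ ω, ENNReal.ofReal ((1 - lcn v (noisySignal w σ ω)) ^ 2) ∂(signalNoise k d) := by
  have hl : Measurable (lcn v) := by unfold lcn lsa patch; fun_prop
  rw [risk, DSD_eq_map, lintegral_map (by fun_prop) (by fun_prop), lintegral_prod _ (by fun_prop)]
  refine lintegral_mono fun ω => ?_
  rw [lintegral_fairSign]
  have h : ∀ y : ℝ, (y = 1 ∨ y = -1) → (lcn v (y • noisySignal w σ ω) - y) ^ 2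
      = (1 - lcn v (noisySignal w σ ω)) ^ 2 := by
    intro y hy
    rw [← sq_sign_sub_lcn v _ hy]; ring
  simp only [h 1 (by simp), h (-1) (by simp)]
  rw [← two_mul, ← mul_assoc, ENNReal.inv_mul_cancel (by simp) (by simp), one_mul]

/-- The parameter after training, in terms of the noise. -/
noncomputable def trainedParam {k d N : ℕ} (γ : ℝ≥0) (η : Fin 2 → ℝ) (b : Fin 2 → ℝ≥0)
    (w : EuclideanSpace ℝ (Fin d)) (σ : ℝ)
    (S₁ S₂ : NoiseBatch k d N)
    (w₀ : EuclideanSpace ℝ (Fin k × Fin d)) : LCNParam k d :=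
  projGradStep (η 1) (b 1)
    (projGradStep (η 0) (b 0) (mkParam (patch (√(γ : ℝ) • w₀)) 0) (positiveSample w σ S₁))
    (positiveSample w σ S₂)

theorem lcnAlgorithm_output {k d n : ℕ} (γ : ℝ≥0) (η : Fin 2 → ℝ) (b : Fin 2 → ℝ≥0)
    (S : Fin n → EuclideanSpace ℝ (Fin k × Fin d) × ℝ) (v : LCNParam k d) :
    (lcnAlgorithm k d γ η b).output S v
      = projGradStep (η 1) (b 1) (projGradStep (η 0) (b 0) v (halfBatch S 0)) (halfBatch S 1) := by
  change Fin.foldl 2 (fun v t => projGradStep (η t) (b t) v (halfBatch S t)) v = _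
  rw [Fin.foldl_succ, Fin.foldl_succ, Fin.foldl_zero]
  rfl

/-- An inequality instead of an equality, since `lintegral_map_le` holds without measurability and
the risk of the trained model is never shown to be measurable. -/
theorem lintegral_lcnAlgorithm_init_le {k d : ℕ} (γ : ℝ≥0) (η : Fin 2 → ℝ) (b : Fin 2 → ℝ≥0)
    (f : LCNParam k d → ℝ≥0∞) :
    ∫⁻ v, f v ∂(lcnAlgorithm k d γ η b).init
      ≤ ∫⁻ w₀, f (mkParam (patch (√(γ : ℝ) • w₀)) 0) ∂(stdGaussian _) := by
  have h1 : isoGaussian (0 : EuclideanSpace ℝ (Fin k × Fin d)) γ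
      = (stdGaussian _).map (fun ξ => √(γ : ℝ) • ξ) := by
    have := isoGaussian_eq_map_stdGaussian (0 : EuclideanSpace ℝ (Fin k × Fin d)) (√(γ : ℝ))
    simpa using this
  change ∫⁻ v, f v ∂(isoGaussian _ γ).map _ ≤ _
  refine (lintegral_map_le _ _).trans ?_
  rw [h1]
  exact lintegral_map_le _ _

theorem pi_DSD_eq_map {k d : ℕ} [NeZero k] (n : ℕ) (w : EuclideanSpace ℝ (Fin d)) (σ : ℝ) :
    (Measure.pi fun _ : Fin n => DSD k d w σ)
      = (Measure.pi fun _ : Fin n => (signalNoise k d).prod fairSign).map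
        (fun S j => ((S j).2 • noisySignal w σ (S j).1, (S j).2)) := by
  have hm : Measurable fun p : (Fin k × EuclideanSpace ℝ (Fin k × Fin d)) × ℝ =>
      (p.2 • noisySignal w σ p.1, p.2) := by fun_prop
  have h : IsProbabilityMeasure (((signalNoise k d).prod fairSign).map
      fun p => (p.2 • noisySignal w σ p.1, p.2)) :=
    Measure.isProbabilityMeasure_map hm.aemeasurable
  rw [DSD_eq_map]
  exact (Measure.pi_map_pi (f := fun _ (p : (Fin k × _) × ℝ) => (p.2 • noisySignal w σ p.1, p.2))
    (hμ := fun _ => inferInstance) fun _ => hm.aemeasurable).symm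

theorem ae_pi_fairSign {Ω : Type*} [MeasurableSpace Ω] (Q : Measure Ω) [IsProbabilityMeasure Q]
    (n : ℕ) : ∀ᵐ S ∂(Measure.pi fun _ : Fin n => Q.prod fairSign),
      ∀ j, (S j).2 = 1 ∨ (S j).2 = -1 := by
  rw [ae_all_iff]
  intro j
  have h : ∀ᵐ z ∂(Q.prod fairSign), z.2 = 1 ∨ z.2 = -1 :=
    Measure.quasiMeasurePreserving_snd.ae ae_fairSign
  exact (Measure.tendsto_eval_ae_ae (μ := fun _ : Fin n => Q.prod fairSign) (i := j)).eventually h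

theorem map_pi_fst_fairSign {Ω : Type*} [MeasurableSpace Ω] (Q : Measure Ω)
    [IsProbabilityMeasure Q] (n : ℕ) :
    (Measure.pi fun _ : Fin n => Q.prod fairSign).map (fun S j => (S j).1)
      = Measure.pi fun _ : Fin n => Q := by
  have h : IsProbabilityMeasure ((Q.prod fairSign).map Prod.fst) :=
    Measure.isProbabilityMeasure_map measurable_fst.aemeasurable
  rw [Measure.pi_map_pi (f := fun _ => Prod.fst) (hμ := fun _ => inferInstance)
    fun _ => measurable_fst.aemeasurable]
  simp

/-- Only the majorant `G` has to be measurable, not the trained parameter. The labels are integrated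
out, the batches become independent, and Tonelli puts the second batch innermost, so that it can be
averaged with the initialization and the first batch fixed. -/
theorem expectedRisk_le {k d n : ℕ} [NeZero k] (γ : ℝ≥0) (η : Fin 2 → ℝ) (b : Fin 2 → ℝ≥0)
    (w : EuclideanSpace ℝ (Fin d)) (σ : ℝ)
    {G : EuclideanSpace ℝ (Fin k × Fin d) → NoiseBatch k d (n / 2) → NoiseBatch k d (n / 2) →
      ℝ≥0∞}
    (hG : Measurable fun p : EuclideanSpace ℝ (Fin k × Fin d) × NoiseBatch k d (n / 2) ×
      NoiseBatch k d (n / 2) => G p.1 p.2.1 p.2.2)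
    (h : ∀ w₀ S₁ S₂, risk (lcn (trainedParam γ η b w σ S₁ S₂ w₀)) (DSD k d w σ) ≤ G w₀ S₁ S₂) :
    (lcnAlgorithm k d γ η b).expectedRisk (DSD k d w σ) n
      ≤ ∫⁻ w₀, ∫⁻ S₁, ∫⁻ S₂, G w₀ S₁ S₂ ∂(Measure.pi fun _ => signalNoise k d)
        ∂(Measure.pi fun _ => signalNoise k d) ∂(stdGaussian _) := by
  have hGs : Measurable fun q : (NoiseBatch k d (n / 2) × NoiseBatch k d (n / 2)) ×
      EuclideanSpace ℝ (Fin k × Fin d) => G q.2 q.1.1 q.1.2 :=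
    hG.comp (f := fun q : (NoiseBatch k d (n / 2) × NoiseBatch k d (n / 2)) ×
      EuclideanSpace ℝ (Fin k × Fin d) => (q.2, q.1.1, q.1.2)) (by fun_prop)
  have hHm : Measurable fun p : NoiseBatch k d (n / 2) × NoiseBatch k d (n / 2) =>
      ∫⁻ w₀, G w₀ p.1 p.2 ∂(stdGaussian _) := hGs.lintegral_prod_right'
  have hhalf : Measurable fun S : NoiseBatch k d n => (halfBatch S 0, halfBatch S 1) := by
    unfold halfBatch; fun_prop
  calc _ ≤ ∫⁻ S, ∫⁻ v, risk (lcn ((lcnAlgorithm k d γ η b).output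
          (fun j => ((S j).2 • noisySignal w σ (S j).1, (S j).2)) v)) (DSD k d w σ)
          ∂(lcnAlgorithm k d γ η b).init
          ∂(Measure.pi fun _ : Fin n => (signalNoise k d).prod fairSign) := by
        rw [IterativeAlgorithm.expectedRisk, pi_DSD_eq_map]
        exact lintegral_map_le _ _
    _ ≤ ∫⁻ S, ∫⁻ w₀, G w₀ (halfBatch (fun j => (S j).1) 0) (halfBatch (fun j => (S j).1) 1)
          ∂(stdGaussian _) ∂(Measure.pi fun _ : Fin n => (signalNoise k d).prod fairSign) := by
        refine lintegral_mono_ae ((ae_pi_fairSign (signalNoise k d) n).mono fun S hS => ?_)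
        refine (lintegral_lcnAlgorithm_init_le _ _ _ _).trans (lintegral_mono fun w₀ => ?_)
        refine le_trans (le_of_eq ?_) (h w₀ _ _)
        rw [lcnAlgorithm_output]
        have e : ∀ (t : Fin 2) (η b : ℝ) (v : LCNParam k d), projGradStep η b v
              (halfBatch (fun j => ((S j).2 • noisySignal w σ (S j).1, (S j).2)) t)
            = projGradStep η b v (positiveSample w σ (halfBatch (fun j => (S j).1) t)) := by
          intro t η b v
          exact projGradStep_sign η b v (fun j => noisySignal w σ (halfBatch (fun j => (S j).1) t j))
            (y := halfBatch (fun j => (S j).2) t) fun j => hS _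
        rw [e, e]
        rfl
    _ = ∫⁻ S, ∫⁻ w₀, G w₀ (halfBatch S 0) (halfBatch S 1)
          ∂(stdGaussian _) ∂(Measure.pi fun _ : Fin n => signalNoise k d) := by
        rw [← map_pi_fst_fairSign (signalNoise k d)]
        have hf : Measurable fun (S : Fin n → (Fin k × EuclideanSpace ℝ (Fin k × Fin d)) × ℝ) j =>
            (S j).1 := by fun_prop
        exact (lintegral_map (hHm.comp hhalf) hf).symm
    _ = ∫⁻ p, ∫⁻ w₀, G w₀ p.1 p.2 ∂(stdGaussian _)
          ∂((Measure.pi fun _ : Fin (n / 2) => signalNoise k d).prod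
          (Measure.pi fun _ : Fin (n / 2) => signalNoise k d)) := by
        rw [← map_halfBatch, lintegral_map hHm hhalf]
    _ = ∫⁻ w₀, ∫⁻ p, G w₀ p.1 p.2 ∂((Measure.pi fun _ : Fin (n / 2) => signalNoise k d).prod
          (Measure.pi fun _ : Fin (n / 2) => signalNoise k d)) ∂(stdGaussian _) :=
        lintegral_lintegral_swap hGs.aemeasurable
    _ = _ := by
        refine lintegral_congr fun w₀ => ?_
        have : Measurable fun p : NoiseBatch k d (n / 2) × NoiseBatch k d (n / 2) =>
            G w₀ p.1 p.2 := hG.comp (measurable_const.prodMk measurable_id)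
        rw [lintegral_prod _ this.aemeasurable]

/-! Equivariance -/

section orthAct
variable {ι : Type} [Fintype ι] [DecidableEq ι]

theorem orthAct_one (x : EuclideanSpace ℝ ι) : orthAct 1 x = x := by
  simp [orthAct]

theorem orthAct_mul (U V : Matrix.orthogonalGroup ι ℝ) (x : EuclideanSpace ℝ ι) :
    orthAct (U * V) x = orthAct U (orthAct V x) := by
  simp [orthAct, Matrix.mulVec_mulVec]

theorem orthAct_inv_orthAct (U : Matrix.orthogonalGroup ι ℝ) (x : EuclideanSpace ℝ ι) :
    orthAct U⁻¹ (orthAct U x) = x := by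
  rw [← orthAct_mul, inv_mul_cancel, orthAct_one]

theorem orthAct_orthAct_inv (U : Matrix.orthogonalGroup ι ℝ) (x : EuclideanSpace ℝ ι) :
    orthAct U (orthAct U⁻¹ x) = x := by
  rw [← orthAct_mul, mul_inv_cancel, orthAct_one]

theorem norm_orthAct (U : Matrix.orthogonalGroup ι ℝ) (x : EuclideanSpace ℝ ι) :
    ‖orthAct U x‖ = ‖x‖ := by
  have h : (star (U : Matrix ι ι ℝ)) * (U : Matrix ι ι ℝ) = 1 :=
    (Matrix.mem_orthogonalGroup_iff' ι ℝ).1 U.2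
  rw [← sq_eq_sq₀ (norm_nonneg _) (norm_nonneg _), ← real_inner_self_eq_norm_sq,
    ← real_inner_self_eq_norm_sq]
  simp only [orthAct, EuclideanSpace.inner_eq_star_dotProduct, star_trivial]
  rw [Matrix.dotProduct_mulVec, Matrix.vecMul_mulVec]
  rw [Matrix.star_eq_conjTranspose, Matrix.conjTranspose_eq_transpose_of_trivial] at h
  rw [h, Matrix.vecMul_one]

/-- An orthogonal matrix as a linear isometry. -/
noncomputable def orthIsometry (U : Matrix.orthogonalGroup ι ℝ) :
    EuclideanSpace ℝ ι ≃ₗᵢ[ℝ] EuclideanSpace ℝ ι where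
  toFun := orthAct U
  invFun := orthAct U⁻¹
  map_add' x y := by simp [orthAct, Matrix.mulVec_add]
  map_smul' c x := by simp [orthAct, Matrix.mulVec_smul]
  left_inv := orthAct_inv_orthAct U
  right_inv := orthAct_orthAct_inv U
  norm_map' := norm_orthAct U

theorem orthIsometry_apply (U : Matrix.orthogonalGroup ι ℝ) (x : EuclideanSpace ℝ ι) :
    orthIsometry U x = orthAct U x := rfl

theorem map_orthAct_isoGaussian (U : Matrix.orthogonalGroup ι ℝ) (γ : ℝ≥0) :
    (isoGaussian 0 γ).map (orthAct U) = isoGaussian 0 γ := by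
  have h1 : isoGaussian (0 : EuclideanSpace ℝ ι) γ
      = (stdGaussian _).map (fun ξ => √(γ : ℝ) • ξ) := by
    have := isoGaussian_eq_map_stdGaussian (0 : EuclideanSpace ℝ ι) (√(γ : ℝ))
    simpa using this
  have hm : Measurable (orthIsometry U) := (orthIsometry U).continuous.measurable
  change (isoGaussian 0 γ).map (orthIsometry U) = _
  rw [h1, Measure.map_map hm (by fun_prop)]
  conv_rhs => rw [← stdGaussian_map (orthIsometry U), Measure.map_map (by fun_prop) hm]
  congr 1
  ext1 ξ
  simp

end orthAct

/-- The transformations which permute the patches and act orthogonally on each of them are closed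
under products and inverses, so closure induction gives a normal form for the whole generated group.
-/
theorem exists_perm_of_mem_patchGroup {k d : ℕ} {U : Matrix.orthogonalGroup (Fin k × Fin d) ℝ}
    (hU : U ∈ patchGroup k d) :
    ∃ (π : Equiv.Perm (Fin k)) (Q : Fin k → Matrix.orthogonalGroup (Fin d) ℝ),
      ∀ x i, patch (orthAct U x) (π i) = orthAct (Q i) (patch x i) := by
  refine Subgroup.closure_induction
    (p := fun U _ => ∃ (π : Equiv.Perm (Fin k)) (Q : Fin k → Matrix.orthogonalGroup (Fin d) ℝ),
      ∀ x i, patch (orthAct U x) (π i) = orthAct (Q i) (patch x i)) ?_ ?_ ?_ ?_ hU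
  · rintro U (⟨Q, hQ⟩ | ⟨π, hπ⟩)
    · refine ⟨1, Q, fun x i => ?_⟩
      ext j
      simp only [patch, orthAct, Matrix.mulVec, dotProduct, hQ, Fintype.sum_prod_type, ite_mul,
        zero_mul, Equiv.Perm.one_apply]
      rw [Finset.sum_eq_single i]
      · simp
      · intro i' _ h; simp [h.symm]
      · simp
    · refine ⟨π, 1, fun x i => ?_⟩
      ext j
      simp only [patch, orthAct, Matrix.mulVec, dotProduct, hπ, Fintype.sum_prod_type, ite_mul,
        zero_mul, one_mul, EmbeddingLike.apply_eq_iff_eq, Pi.one_apply, OneMemClass.coe_one]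
      rw [Finset.sum_eq_single i]
      · simp [Matrix.one_apply]
      · intro i' _ h; simp [h.symm]
      · simp
  · exact ⟨1, 1, fun x i => by simp [orthAct_one]⟩
  · rintro U V _ _ ⟨π, Q, h⟩ ⟨π', Q', h'⟩
    refine ⟨π * π', fun i => Q (π' i) * Q' i, fun x i => ?_⟩
    rw [orthAct_mul, orthAct_mul, Equiv.Perm.mul_apply, h, h']
  · rintro U _ ⟨π, Q, h⟩
    refine ⟨π⁻¹, fun i => (Q (π⁻¹ i))⁻¹, fun x i => ?_⟩
    have := h (orthAct U⁻¹ x) (π⁻¹ i)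
    rw [orthAct_orthAct_inv, show π (π⁻¹ i) = i from π.apply_symm_apply i] at this
    rw [this, orthAct_inv_orthAct]

/-- The action on the weights which fixes the bias. -/
noncomputable def paramOrth {k d : ℕ} (U : Matrix.orthogonalGroup (Fin k × Fin d) ℝ) :
    Matrix.orthogonalGroup ((Fin k × Fin d) ⊕ Unit) ℝ :=
  ⟨Matrix.fromBlocks (U : Matrix _ _ ℝ) 0 0 1, by
    have h := (Matrix.mem_orthogonalGroup_iff (Fin k × Fin d) ℝ).1 U.2
    rw [Matrix.mem_orthogonalGroup_iff, Matrix.fromBlocks_transpose, Matrix.fromBlocks_multiply]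
    simp [h]⟩

theorem bias_paramOrth {k d : ℕ} (U : Matrix.orthogonalGroup (Fin k × Fin d) ℝ)
    (v : LCNParam k d) : bias (orthAct (paramOrth U) v) = bias v := by
  simp [bias, orthAct, paramOrth, Matrix.mulVec, dotProduct]

theorem weight_paramOrth {k d : ℕ} (U : Matrix.orthogonalGroup (Fin k × Fin d) ℝ)
    (v : LCNParam k d) (i : Fin k) : weight (orthAct (paramOrth U) v) i
      = patch (orthAct U (WithLp.toLp 2 fun a => v (Sum.inl a))) i := by
  ext j
  simp [weight, patch, orthAct, paramOrth, Matrix.mulVec, dotProduct]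

theorem weight_eq_patch {k d : ℕ} (v : LCNParam k d) :
    weight v = patch (WithLp.toLp 2 fun a => v (Sum.inl a)) := rfl

theorem mkParam_weight_bias {k d : ℕ} (v : LCNParam k d) : mkParam (weight v) (bias v) = v := by
  ext a
  rcases a with ⟨i, j⟩ | u <;> simp [mkParam, weight, bias]

theorem weight_mkParam {k d : ℕ} (w : Fin k → EuclideanSpace ℝ (Fin d)) (b : ℝ) (i : Fin k) :
    weight (mkParam w b) i = w i := by
  ext j; simp [weight, mkParam]

theorem bias_mkParam {k d : ℕ} (w : Fin k → EuclideanSpace ℝ (Fin d)) (b : ℝ) :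
    bias (mkParam w b) = b := rfl

theorem param_ext {k d : ℕ} {v v' : LCNParam k d} (h : ∀ i, weight v i = weight v' i)
    (hb : bias v = bias v') : v = v' := by
  rw [← mkParam_weight_bias v, ← mkParam_weight_bias v', hb]
  congr 1
  exact funext h

theorem paramOrth_mkParam {k d : ℕ} (U : Matrix.orthogonalGroup (Fin k × Fin d) ℝ)
    (w : EuclideanSpace ℝ (Fin k × Fin d)) (b : ℝ) :
    orthAct (paramOrth U) (mkParam (patch w) b) = mkParam (patch (orthAct U w)) b :=
  param_ext (fun i => by rw [weight_paramOrth, weight_mkParam]; rfl)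
    (by rw [bias_paramOrth, bias_mkParam, bias_mkParam])

/-! ### Equivariance of the network and of a single training step -/

section equivariance
variable {k d : ℕ} {U : Matrix.orthogonalGroup (Fin k × Fin d) ℝ} {π : Equiv.Perm (Fin k)}
  {Q : Fin k → Matrix.orthogonalGroup (Fin d) ℝ}

theorem lcn_orthAct (h : ∀ x i, patch (orthAct U x) (π i) = orthAct (Q i) (patch x i))
    {v v' : LCNParam k d} (hw : ∀ i, weight v' (π i) = orthAct (Q i) (weight v i))
    (hb : bias v' = bias v) (x : EuclideanSpace ℝ (Fin k × Fin d)) :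
    lcn v' (orthAct U x) = lcn v x := by
  rw [lcn, lcn, ← Equiv.sum_comp π]
  refine Finset.sum_congr rfl fun i _ => ?_
  rw [hw, hb, h, ← orthIsometry_apply, ← orthIsometry_apply, LinearIsometryEquiv.inner_map_map]

/-- No differentiability is required: `fderiv` commutes with composition by a linear equivalence in
all cases. Hence the kinks of the activation cause no trouble for equivariance. -/
theorem gradient_of_comp_isometry {E : Type*} [NormedAddCommGroup E] [InnerProductSpace ℝ E]
    [CompleteSpace E] (L : E ≃ₗᵢ[ℝ] E) {f g : E → ℝ} (h : ∀ u, g (L u) = f u) (a : E) :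
    gradient g (L a) = L (gradient f a) := by
  have h1 : f = g ∘ L.toContinuousLinearEquiv := by ext u; exact (h u).symm
  refine ext_inner_right ℝ fun z => ?_
  obtain ⟨z, rfl⟩ := L.surjective z
  rw [LinearIsometryEquiv.inner_map_map, gradient, gradient, InnerProductSpace.toDual_symm_apply,
    InnerProductSpace.toDual_symm_apply, h1, ContinuousLinearEquiv.comp_right_fderiv]
  rfl

theorem gradWeight_orthAct (h : ∀ x i, patch (orthAct U x) (π i) = orthAct (Q i) (patch x i))
    {v v' : LCNParam k d} (hw : ∀ i, weight v' (π i) = orthAct (Q i) (weight v i))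
    (hb : bias v' = bias v) {N : ℕ} (S : Fin N → EuclideanSpace ℝ (Fin k × Fin d) × ℝ)
    (i : Fin k) :
    gradWeight v' (fun j => (orthAct U (S j).1, (S j).2)) (π i)
      = orthAct (Q i) (gradWeight v S i) := by
  rw [gradWeight, gradWeight, hw, ← orthIsometry_apply, ← orthIsometry_apply]
  refine gradient_of_comp_isometry _ (fun u => ?_) _
  have e : ∀ x, lcn (mkParam (Function.update (weight v') (π i) (orthIsometry (Q i) u)) (bias v'))
      (orthAct U x) = lcn (mkParam (Function.update (weight v) i u) (bias v)) x := by
    refine lcn_orthAct h (fun j => ?_) hb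
    rw [weight_mkParam, weight_mkParam]
    by_cases hj : j = i
    · subst hj; simp [orthIsometry_apply]
    · rw [Function.update_of_ne (by simpa using hj), Function.update_of_ne hj, hw]
  simp only [empLoss, e]

theorem weight_projGradStep {N : ℕ} (η b : ℝ) (v : LCNParam k d)
    (S : Fin N → EuclideanSpace ℝ (Fin k × Fin d) × ℝ) (i : Fin k) :
    weight (projGradStep η b v S) i
      = ‖weight v i - η • gradWeight v S i‖⁻¹ • (weight v i - η • gradWeight v S i) :=
  weight_mkParam _ _ _

theorem bias_projGradStep {N : ℕ} (η b : ℝ) (v : LCNParam k d)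
    (S : Fin N → EuclideanSpace ℝ (Fin k × Fin d) × ℝ) : bias (projGradStep η b v S) = b :=
  bias_mkParam _ _

theorem weight_paramOrth_perm
    (h : ∀ x i, patch (orthAct U x) (π i) = orthAct (Q i) (patch x i)) (v : LCNParam k d)
    (i : Fin k) : weight (orthAct (paramOrth U) v) (π i) = orthAct (Q i) (weight v i) := by
  rw [weight_paramOrth, h, weight_eq_patch]

theorem projGradStep_orthAct
    (h : ∀ x i, patch (orthAct U x) (π i) = orthAct (Q i) (patch x i))
    (η b : ℝ) (v : LCNParam k d) {N : ℕ} (S : Fin N → EuclideanSpace ℝ (Fin k × Fin d) × ℝ) :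
    orthAct (paramOrth U) (projGradStep η b v S)
      = projGradStep η b (orthAct (paramOrth U) v) (fun j => (orthAct U (S j).1, (S j).2)) := by
  refine param_ext (fun i => ?_) ?_
  · obtain ⟨i, rfl⟩ := π.surjective i
    rw [weight_paramOrth_perm h, weight_projGradStep, weight_projGradStep,
      gradWeight_orthAct h (weight_paramOrth_perm h v) (bias_paramOrth U v),
      weight_paramOrth_perm h]
    simp only [← orthIsometry_apply]
    rw [← map_smul, ← map_sub, LinearIsometryEquiv.norm_map, ← map_smul]
  · rw [bias_paramOrth, bias_projGradStep, bias_projGradStep]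

end equivariance

/-- The matrix acting on the parameters is the given one on the weights and the identity on the
bias. It preserves the initialization because an isotropic centred Gaussian is rotation invariant.
-/
theorem lcnAlgorithm_isEquivariant (k d : ℕ) (γ : ℝ≥0) (η : Fin 2 → ℝ) (b : Fin 2 → ℝ≥0) :
    (lcnAlgorithm k d γ η b).IsEquivariant (patchGroup k d) := by
  refine ⟨{V | ∃ U ∈ patchGroup k d, V = paramOrth U}, fun U hU => ?_, ?_⟩
  · obtain ⟨π, Q, h⟩ := exists_perm_of_mem_patchGroup hU
    refine ⟨paramOrth U, ⟨U, hU, rfl⟩, fun v hv => ?_, fun x v _ => ?_, fun n S t v _ => ?_⟩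
    · change 0 ≤ bias _
      rw [bias_paramOrth]; exact hv
    · exact (lcn_orthAct h (weight_paramOrth_perm h v) (bias_paramOrth U v) x).symm
    · exact projGradStep_orthAct h _ _ _ _
  · rintro V ⟨U, _, rfl⟩
    have hm : Measurable (orthAct U) := (orthIsometry U).continuous.measurable
    have hm' : Measurable (orthAct (paramOrth U)) :=
      (orthIsometry (paramOrth U)).continuous.measurable
    change ((isoGaussian _ γ).map _).map _ = (isoGaussian _ γ).map _
    conv_rhs => rw [← map_orthAct_isoGaussian U γ]
    rw [Measure.map_map hm' (measurable_mkParam_patch k d),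
      Measure.map_map (measurable_mkParam_patch k d) hm]
    congr 1
    ext1 w
    exact paramOrth_mkParam U w 0

/-! The gradient of the loss -/

theorem lsa_zero (t : ℝ) : lsa 0 t = t := by
  rw [lsa, sub_zero, sub_zero]
  exact max_zero_sub_max_neg_zero_eq_self t

theorem hasDerivAt_lsa_zero (t : ℝ) : HasDerivAt (lsa 0) 1 t := by
  have : lsa 0 = id := funext lsa_zero
  rw [this]; exact hasDerivAt_id t

theorem lsa_of_le {b t : ℝ} (hb : 0 ≤ b) (h : b ≤ t) : lsa b t = t - b := by
  rw [lsa, max_eq_left (by linarith), max_eq_right (by linarith), sub_zero]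

theorem lsa_of_abs_le {b t : ℝ} (h : |t| ≤ b) : lsa b t = 0 := by
  have := abs_le.1 h
  rw [lsa, max_eq_right (by linarith), max_eq_right (by linarith), sub_zero]

theorem hasDerivAt_lsa_of_lt {b t : ℝ} (hb : 0 ≤ b) (h : b < t) : HasDerivAt (lsa b) 1 t := by
  refine ((hasDerivAt_id t).sub_const b).congr_of_eventuallyEq ?_
  filter_upwards [lt_mem_nhds h] with s hs using lsa_of_le hb hs.le

theorem hasDerivAt_lsa_of_abs_lt {b t : ℝ} (h : |t| < b) : HasDerivAt (lsa b) 0 t := by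
  refine (hasDerivAt_const t (0 : ℝ)).congr_of_eventuallyEq ?_
  filter_upwards [continuous_abs.continuousAt.eventually_lt continuousAt_const h] with s hs
    using lsa_of_abs_le hs.le

/-- The derivatives of the activation are an input, so the formula serves both the linear network
and a thresholded one whose preactivations avoid the kinks. -/
theorem gradWeight_eq {k d N : ℕ} (v : LCNParam k d)
    (S : Fin N → EuclideanSpace ℝ (Fin k × Fin d) × ℝ) (i : Fin k) {s : Fin N → ℝ}
    (hs : ∀ j, HasDerivAt (lsa (bias v)) (s j) (inner ℝ (weight v i) (patch (S j).1 i))) :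
    gradWeight v S i
      = -(2 : ℝ) • (1 / (N : ℝ)) •
        ∑ j, (((S j).2 - lcn v (S j).1) * s j) • patch (S j).1 i := by
  refine HasGradientAt.gradient ?_
  rw [hasGradientAt_iff_hasFDerivAt]
  have hl : ∀ j, HasFDerivAt (fun u =>
      lcn (mkParam (Function.update (weight v) i u) (bias v)) (S j).1)
      (s j • innerSL ℝ (patch (S j).1 i)) (weight v i) := by
    intro j
    have e : (fun u => lcn (mkParam (Function.update (weight v) i u) (bias v)) (S j).1)
        = fun u => lsa (bias v) (inner ℝ (patch (S j).1 i) u) +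
          ∑ i' ∈ Finset.univ.erase i, lsa (bias v) (inner ℝ (weight v i') (patch (S j).1 i')) := by
      ext u
      rw [lcn, ← Finset.add_sum_erase _ _ (Finset.mem_univ i)]
      simp only [weight_mkParam, bias_mkParam, Function.update_self]
      rw [real_inner_comm]
      congr 1
      refine Finset.sum_congr rfl fun i' hi' => ?_
      rw [Function.update_of_ne (Finset.ne_of_mem_erase hi')]
    rw [e]
    have h0 := hs j
    rw [real_inner_comm] at h0
    exact (h0.comp_hasFDerivAt _ (innerSL ℝ (patch (S j).1 i)).hasFDerivAt).add_const _
  have hv : mkParam (Function.update (weight v) i (weight v i)) (bias v) = v := by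
    rw [Function.update_eq_self, mkParam_weight_bias]
  have h2 : HasFDerivAt (fun u =>
      1 / (N : ℝ) * ∑ j, ((S j).2 - lcn (mkParam (Function.update (weight v) i u) (bias v))
        (S j).1) ^ 2) _ (weight v i) :=
    (HasFDerivAt.fun_sum fun j (_ : j ∈ Finset.univ) =>
      ((hl j).const_sub ((S j).2)).pow 2).const_mul (1 / (N : ℝ))
  refine h2.congr_fderiv ?_
  ext z
  simp only [hv, smul_apply, sum_apply,
    neg_apply, innerSL_apply_apply, smul_eq_mul,
    InnerProductSpace.toDual_apply_apply, inner_smul_left, sum_inner]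
  simp only [Finset.mul_sum]
  refine Finset.sum_congr rfl fun j _ => ?_
  simp
  ring

/-! The risk of a network with weights close to the signal -/

section patches
variable {k d : ℕ}

theorem inner_signalMean (u : EuclideanSpace ℝ (Fin d)) (i : Fin k)
    (ξ : EuclideanSpace ℝ (Fin k × Fin d)) :
    inner ℝ (signalMean u i) ξ = inner ℝ u (patch ξ i) := by
  simp only [PiLp.inner_apply, signalMean, patch, Fintype.sum_prod_type]
  rw [Finset.sum_eq_single i]
  · simp
  · intro i' _ h; simp [h]
  · simp

theorem patch_signalMean (u : EuclideanSpace ℝ (Fin d)) (i i' : Fin k) :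
    patch (signalMean u i) i' = if i = i' then u else 0 := by
  ext j
  by_cases h : i = i' <;> simp [patch, signalMean, h, eq_comm]

theorem norm_signalMean (u : EuclideanSpace ℝ (Fin d)) (i : Fin k) : ‖signalMean u i‖ = ‖u‖ := by
  rw [← sq_eq_sq₀ (norm_nonneg _) (norm_nonneg _), ← real_inner_self_eq_norm_sq,
    ← real_inner_self_eq_norm_sq, inner_signalMean, patch_signalMean, if_pos rfl]

theorem sum_inner_patch (x y : EuclideanSpace ℝ (Fin k × Fin d)) :
    ∑ i, inner ℝ (patch x i) (patch y i) = inner ℝ x y := by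
  simp [PiLp.inner_apply, patch, Fintype.sum_prod_type]

theorem norm_patch_le (x : EuclideanSpace ℝ (Fin k × Fin d)) (i : Fin k) : ‖patch x i‖ ≤ ‖x‖ := by
  rw [← sq_le_sq₀ (norm_nonneg _) (norm_nonneg _), ← real_inner_self_eq_norm_sq,
    ← real_inner_self_eq_norm_sq x, ← sum_inner_patch]
  exact Finset.single_le_sum (f := fun i => inner ℝ (patch x i) (patch x i))
    (fun i _ => real_inner_self_nonneg) (Finset.mem_univ i)

theorem patch_noisySignal (w : EuclideanSpace ℝ (Fin d)) (σ : ℝ)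
    (ω : Fin k × EuclideanSpace ℝ (Fin k × Fin d)) (i : Fin k) :
    patch (noisySignal w σ ω) i = (if ω.1 = i then w else 0) + σ • patch ω.2 i := by
  rw [noisySignal, patch_add, patch_signalMean, patch_smul]

end patches

theorem abs_lsa_sub_self_le {b : ℝ} (hb : 0 ≤ b) (t : ℝ) : |lsa b t - t| ≤ b := by
  rw [lsa, abs_le]
  rcases max_cases (t - b) 0 with ⟨h1, h2⟩ | ⟨h1, h2⟩ <;>
  rcases max_cases (-t - b) 0 with ⟨h3, h4⟩ | ⟨h3, h4⟩ <;> rw [h1, h3] <;>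
  constructor <;> linarith

/-- A Chernoff-type bound: for `t ≥ b` it is `u² / 2 ≤ exp u` at `u = s (t - b)`, and oddness covers
`t ≤ -b`. -/
theorem lsa_sq_le {b s : ℝ} (hb : 0 ≤ b) (hs : 0 < s) (t : ℝ) :
    lsa b t ^ 2 ≤ 2 / s ^ 2 * Real.exp (-(s * b)) * (Real.exp (s * t) + Real.exp (-(s * t))) := by
  have key : ∀ t, b ≤ t → lsa b t ^ 2 ≤ 2 / s ^ 2 * Real.exp (-(s * b)) * Real.exp (s * t) := by
    intro t ht
    have h1 := Real.pow_div_factorial_le_exp (s * (t - b)) (by nlinarith) 2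
    rw [mul_assoc, ← Real.exp_add, lsa_of_le hb ht,
      show -(s * b) + s * t = s * (t - b) by ring]
    norm_num [Nat.factorial] at h1
    rw [div_mul_eq_mul_div, le_div_iff₀ (by positivity)]
    nlinarith
  have p1 := Real.exp_pos (s * t)
  have p2 := Real.exp_pos (-(s * t))
  have p3 : 0 < 2 / s ^ 2 * Real.exp (-(s * b)) := by positivity
  rcases le_total b t with h | h
  · have := key t h
    nlinarith [mul_pos p3 p2]
  rcases le_total b (-t) with h' | h'
  · have := key (-t) h'
    rw [lsa_neg, neg_sq, mul_neg] at this
    nlinarith [mul_pos p3 p1]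
  · rw [lsa_of_abs_le (abs_le.2 ⟨by linarith, h⟩), zero_pow two_ne_zero]
    positivity

theorem measurable_lcn_noisySignal {k d : ℕ} (w : EuclideanSpace ℝ (Fin d)) (σ : ℝ)
    (v : LCNParam k d) : Measurable fun ω => lcn v (noisySignal w σ ω) := by
  have hl : Measurable (lcn v) := by unfold lcn lsa patch; fun_prop
  exact hl.comp (measurable_noisySignal w σ)

/-- The output splits into the signal patch, where thresholding costs at most the bias, and the
noise patches, where Cauchy–Schwarz and the exponential bound on the activation reduce everything to
Gaussian moment generating functions. -/
theorem lintegral_sq_one_sub_lcn_le {k d : ℕ} {w : EuclideanSpace ℝ (Fin d)} (hw : ‖w‖ = 1)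
    {σ : ℝ} {v : LCNParam k d} (hv : ∀ i, ‖weight v i‖ ≤ 1) (hb : 0 ≤ bias v) {s : ℝ}
    (hs : 0 < s) (i : Fin k) :
    ∫⁻ ξ, ENNReal.ofReal ((1 - lcn v (noisySignal w σ (i, ξ))) ^ 2) ∂(stdGaussian _)
      ≤ ENNReal.ofReal (6 * ‖weight v i - w‖ ^ 2 + (6 * σ ^ 2 + 6 * bias v ^ 2 +
        8 * (k : ℝ) ^ 2 / s ^ 2 * Real.exp (-(s * bias v) + s ^ 2 * σ ^ 2 / 2))) := by
  set b := bias v with hbdef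
  set F : EuclideanSpace ℝ (Fin k × Fin d) → ℝ := fun ξ =>
    (6 * ‖weight v i - w‖ ^ 2 + 6 * b ^ 2 +
      6 * σ ^ 2 * inner ℝ (signalMean (weight v i) i) ξ ^ 2) +
    ∑ i', 4 * (k : ℝ) / s ^ 2 * Real.exp (-(s * b)) *
      (Real.exp (inner ℝ ((s * σ) • signalMean (weight v i') i') ξ)
        + Real.exp (inner ℝ (-((s * σ) • signalMean (weight v i') i')) ξ)) with hF
  have hpt : ∀ ξ, (1 - lcn v (noisySignal w σ (i, ξ))) ^ 2 ≤ F ξ := by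
    intro ξ
    set ζ : Fin k → ℝ := fun i' => inner ℝ (weight v i') (patch ξ i') with hζ
    have h1 : ∀ i', inner ℝ (weight v i') (patch (noisySignal w σ (i, ξ)) i')
        = (if i = i' then inner ℝ (weight v i) w else 0) + σ * ζ i' := by
      intro i'
      rw [patch_noisySignal, inner_add_right, inner_smul_right]
      by_cases h : i = i'
      · subst h; simp [hζ]
      · simp [h, hζ]
    have h2 : 1 - lcn v (noisySignal w σ (i, ξ))
        = (1 - lsa b (inner ℝ (weight v i) w + σ * ζ i))
          - ∑ i' ∈ Finset.univ.erase i, lsa b (σ * ζ i') := by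
      rw [lcn, ← Finset.add_sum_erase _ _ (Finset.mem_univ i), h1, if_pos rfl, sub_sub]
      congr 2
      refine Finset.sum_congr rfl fun i' hi' => ?_
      rw [h1, if_neg (Finset.ne_of_mem_erase hi').symm, zero_add]
    have h3 : (1 - lsa b (inner ℝ (weight v i) w + σ * ζ i)) ^ 2
        ≤ 3 * ‖weight v i - w‖ ^ 2 + 3 * b ^ 2 + 3 * σ ^ 2 * ζ i ^ 2 := by
      have e1 : |1 - inner ℝ (weight v i) w| ≤ ‖weight v i - w‖ := by
        have : 1 - inner ℝ (weight v i) w = -inner ℝ (weight v i - w) w := by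
          rw [inner_sub_left, real_inner_self_eq_norm_sq, hw]; ring
        rw [this, abs_neg]
        simpa [hw] using abs_real_inner_le_norm (weight v i - w) w
      have e2 := abs_lsa_sub_self_le hb (inner ℝ (weight v i) w + σ * ζ i)
      have e3 := sq_le_sq' (abs_le.1 e1).1 (abs_le.1 e1).2
      have e4 := sq_le_sq' (abs_le.1 e2).1 (abs_le.1 e2).2
      -- The error on the signal patch has three sources: misalignment of the weight, thresholding,
      -- and noise projected on the weight.
      set p := 1 - inner ℝ (weight v i) w
      set q := lsa b (inner ℝ (weight v i) w + σ * ζ i) - (inner ℝ (weight v i) w + σ * ζ i) with hq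
      have e5 : 1 - lsa b (inner ℝ (weight v i) w + σ * ζ i) = p - q - σ * ζ i := by
        rw [hq]; ring
      rw [e5]
      nlinarith [sq_nonneg (p + q), sq_nonneg (p + σ * ζ i), sq_nonneg (q - σ * ζ i)]
    have h4 : (∑ i' ∈ Finset.univ.erase i, lsa b (σ * ζ i')) ^ 2
        ≤ k * ∑ i', lsa b (σ * ζ i') ^ 2 := by
      refine (sq_sum_le_card_mul_sum_sq).trans ?_
      have c1 : ((Finset.univ.erase i).card : ℝ) ≤ k := by
        have := (Finset.univ.erase i).card_le_univ
        rw [Fintype.card_fin] at this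
        exact_mod_cast this
      have c2 : ∑ i' ∈ Finset.univ.erase i, lsa b (σ * ζ i') ^ 2 ≤ ∑ i', lsa b (σ * ζ i') ^ 2 :=
        Finset.sum_le_sum_of_subset_of_nonneg (Finset.erase_subset _ _) fun _ _ _ => sq_nonneg _
      have c3 : 0 ≤ ∑ i' ∈ Finset.univ.erase i, lsa b (σ * ζ i') ^ 2 :=
        Finset.sum_nonneg fun _ _ => sq_nonneg _
      exact mul_le_mul c1 c2 c3 (by positivity)
    have h5 : k * ∑ i', lsa b (σ * ζ i') ^ 2
        ≤ ∑ i', 2 * (k : ℝ) / s ^ 2 * Real.exp (-(s * b)) *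
          (Real.exp (s * (σ * ζ i')) + Real.exp (-(s * (σ * ζ i')))) := by
      rw [Finset.mul_sum]
      refine Finset.sum_le_sum fun i' _ => ?_
      have := mul_le_mul_of_nonneg_left (lsa_sq_le hb hs (σ * ζ i')) (Nat.cast_nonneg (α := ℝ) k)
      refine this.trans (le_of_eq ?_)
      ring
    have h6 : ∀ i', inner ℝ ((s * σ) • signalMean (weight v i') i') ξ = s * (σ * ζ i') := by
      intro i'
      rw [real_inner_smul_left, inner_signalMean]; ring
    simp only [hF, inner_neg_left, h6, inner_signalMean]
    rw [h2]
    have h7 : ∑ i', 4 * (k : ℝ) / s ^ 2 * Real.exp (-(s * b)) *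
          (Real.exp (s * (σ * ζ i')) + Real.exp (-(s * (σ * ζ i'))))
        = 2 * ∑ i', 2 * (k : ℝ) / s ^ 2 * Real.exp (-(s * b)) *
          (Real.exp (s * (σ * ζ i')) + Real.exp (-(s * (σ * ζ i')))) := by
      rw [Finset.mul_sum]
      refine Finset.sum_congr rfl fun i' _ => ?_
      ring
    rw [h7]
    have h8 : inner ℝ (weight v i) (patch ξ i) = ζ i := rfl
    rw [h8]
    nlinarith [sq_nonneg (1 - lsa b (inner ℝ (weight v i) w + σ * ζ i)
      + ∑ i' ∈ Finset.univ.erase i, lsa b (σ * ζ i'))]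
  have i1 : Integrable (fun ξ => 6 * ‖weight v i - w‖ ^ 2 + 6 * b ^ 2 +
      6 * σ ^ 2 * inner ℝ (signalMean (weight v i) i) ξ ^ 2) (stdGaussian _) :=
    (integrable_const _).add ((memLp_inner_stdGaussian (signalMean (weight v i) i) (p := 2)
      ENNReal.ofNat_ne_top).integrable_sq.const_mul _)
  have i2 : ∀ i', Integrable (fun ξ => 4 * (k : ℝ) / s ^ 2 * Real.exp (-(s * b)) *
      (Real.exp (inner ℝ ((s * σ) • signalMean (weight v i') i') ξ)
        + Real.exp (inner ℝ (-((s * σ) • signalMean (weight v i') i')) ξ))) (stdGaussian _) :=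
    fun i' => ((integrable_exp_inner_stdGaussian _).add
      (integrable_exp_inner_stdGaussian _)).const_mul _
  have i3 : Integrable F (stdGaussian _) := i1.add (integrable_finsetSum _ fun i' _ => i2 i')
  calc _ ≤ ∫⁻ ξ, ENNReal.ofReal (F ξ) ∂(stdGaussian _) :=
        lintegral_mono fun ξ => ENNReal.ofReal_le_ofReal (hpt ξ)
    _ = ENNReal.ofReal (∫ ξ, F ξ ∂(stdGaussian _)) :=
        (ofReal_integral_eq_lintegral_ofReal i3 (Filter.Eventually.of_forall fun ξ =>
          (sq_nonneg _).trans (hpt ξ))).symm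
    _ ≤ _ := by
        apply ENNReal.ofReal_le_ofReal
        have e1 : ∫ ξ, F ξ ∂(stdGaussian _)
            = 6 * ‖weight v i - w‖ ^ 2 + 6 * b ^ 2 + 6 * σ ^ 2 * ‖weight v i‖ ^ 2 +
              ∑ i', 4 * (k : ℝ) / s ^ 2 * Real.exp (-(s * b)) *
                (2 * Real.exp (‖(s * σ) • signalMean (weight v i') i'‖ ^ 2 / 2)) := by
          rw [hF, integral_add i1 (integrable_finsetSum _ fun i' _ => i2 i'),
            integral_finsetSum _ fun i' _ => i2 i']
          congr 1
          · rw [integral_add (integrable_const _) ((memLp_inner_stdGaussian _ (p := 2)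
              ENNReal.ofNat_ne_top).integrable_sq.const_mul _), integral_const_mul,
              integral_inner_sq_stdGaussian, norm_signalMean]
            simp
          · refine Finset.sum_congr rfl fun i' _ => ?_
            rw [integral_const_mul, integral_add (integrable_exp_inner_stdGaussian _)
              (integrable_exp_inner_stdGaussian _), integral_exp_inner_stdGaussian,
              integral_exp_inner_stdGaussian, norm_neg]
            ring
        rw [e1]
        have e2 : ‖weight v i‖ ^ 2 ≤ 1 := by nlinarith [hv i, norm_nonneg (weight v i)]
        have e3 : ∀ i', Real.exp (‖(s * σ) • signalMean (weight v i') i'‖ ^ 2 / 2)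
            ≤ Real.exp (s ^ 2 * σ ^ 2 / 2) := by
          intro i'
          apply Real.exp_le_exp.2
          rw [norm_smul, norm_signalMean, mul_pow, Real.norm_eq_abs, sq_abs]
          have : ‖weight v i'‖ ^ 2 ≤ 1 := by nlinarith [hv i', norm_nonneg (weight v i')]
          nlinarith [sq_nonneg (s * σ)]
        have e4 : ∑ i' : Fin k, 4 * (k : ℝ) / s ^ 2 * Real.exp (-(s * b)) *
                (2 * Real.exp (‖(s * σ) • signalMean (weight v i') i'‖ ^ 2 / 2))
            ≤ ∑ i' : Fin k, 4 * (k : ℝ) / s ^ 2 * Real.exp (-(s * b)) *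
                (2 * Real.exp (s ^ 2 * σ ^ 2 / 2)) := by
          refine Finset.sum_le_sum fun i' _ => ?_
          have := e3 i'
          gcongr
        rw [Finset.sum_const, Finset.card_univ, Fintype.card_fin, nsmul_eq_mul] at e4
        have e5 : (k : ℝ) * (4 * (k : ℝ) / s ^ 2 * Real.exp (-(s * b)) *
                (2 * Real.exp (s ^ 2 * σ ^ 2 / 2)))
            = 8 * (k : ℝ) ^ 2 / s ^ 2 * Real.exp (-(s * b) + s ^ 2 * σ ^ 2 / 2) := by
          rw [Real.exp_add]; ring
        have e6 : 6 * σ ^ 2 * ‖weight v i‖ ^ 2 ≤ 6 * σ ^ 2 := by nlinarith [sq_nonneg σ]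
        linarith

theorem risk_lcn_le {k d : ℕ} [NeZero k] {w : EuclideanSpace ℝ (Fin d)} (hw : ‖w‖ = 1)
    {σ : ℝ} {v : LCNParam k d} (hv : ∀ i, ‖weight v i‖ ≤ 1) (hb : 0 ≤ bias v) {s : ℝ}
    (hs : 0 < s) :
    risk (lcn v) (DSD k d w σ)
      ≤ ENNReal.ofReal (6 * σ ^ 2 + 6 * bias v ^ 2 +
          8 * (k : ℝ) ^ 2 / s ^ 2 * Real.exp (-(s * bias v) + s ^ 2 * σ ^ 2 / 2)) +
        6 * ((k : ℝ≥0∞)⁻¹ * ∑ i, ENNReal.ofReal (‖weight v i - w‖ ^ 2)) := by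
  have hl := measurable_lcn_noisySignal w σ v
  have hk : (k : ℝ≥0∞) ≠ 0 := by exact_mod_cast NeZero.ne k
  refine (risk_lcn_DSD w σ v).trans ?_
  rw [lintegral_signalNoise _ _ (by fun_prop)]
  set R := 6 * σ ^ 2 + 6 * bias v ^ 2 +
          8 * (k : ℝ) ^ 2 / s ^ 2 * Real.exp (-(s * bias v) + s ^ 2 * σ ^ 2 / 2) with hR
  have hR0 : 0 ≤ R := by positivity
  calc _ ≤ (k : ℝ≥0∞)⁻¹ * ∑ i : Fin k,
          (ENNReal.ofReal R + 6 * ENNReal.ofReal (‖weight v i - w‖ ^ 2)) := by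
        gcongr with i
        refine (lintegral_sq_one_sub_lcn_le hw hv hb hs i).trans (le_of_eq ?_)
        rw [ENNReal.ofReal_add (by positivity) hR0, add_comm, ENNReal.ofReal_mul (by norm_num)]
        simp
    _ = _ := by
        rw [Finset.sum_add_distrib, Finset.sum_const, Finset.card_univ, Fintype.card_fin,
          nsmul_eq_mul, mul_add, ← mul_assoc, ENNReal.inv_mul_cancel hk (by simp), one_mul,
          ← Finset.mul_sum]
        ring

theorem norm_inv_norm_smul_le {E : Type*} [NormedAddCommGroup E] [NormedSpace ℝ E] (u : E) :
    ‖‖u‖⁻¹ • u‖ ≤ 1 := by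
  rw [norm_smul, norm_inv, norm_norm]
  exact inv_mul_le_one

/-- It suffices to bound the expected squared distance of each trained weight vector to the
signal. -/
theorem expectedRisk_le_of_weight {k d n : ℕ} [NeZero k] (γ : ℝ≥0) (η : Fin 2 → ℝ)
    (b : Fin 2 → ℝ≥0) {w : EuclideanSpace ℝ (Fin d)} (hw : ‖w‖ = 1) (σ : ℝ)
    {D : Fin k → EuclideanSpace ℝ (Fin k × Fin d) → NoiseBatch k d (n / 2) →
      NoiseBatch k d (n / 2) → ℝ≥0∞}
    (hD : ∀ i, Measurable fun p : EuclideanSpace ℝ (Fin k × Fin d) × NoiseBatch k d (n / 2) ×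
      NoiseBatch k d (n / 2) => D i p.1 p.2.1 p.2.2)
    (h : ∀ i w₀ S₁ S₂, ENNReal.ofReal (‖weight (trainedParam γ η b w σ S₁ S₂ w₀) i - w‖ ^ 2)
      ≤ D i w₀ S₁ S₂) {ε : ℝ} (hε : 0 ≤ ε)
    (hi : ∀ i, ∫⁻ w₀, ∫⁻ S₁, ∫⁻ S₂, D i w₀ S₁ S₂ ∂(Measure.pi fun _ => signalNoise k d)
        ∂(Measure.pi fun _ => signalNoise k d) ∂(stdGaussian _) ≤ ENNReal.ofReal ε)
    {s : ℝ} (hs : 0 < s) :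
    (lcnAlgorithm k d γ η b).expectedRisk (DSD k d w σ) n
      ≤ ENNReal.ofReal (6 * σ ^ 2 + 6 * (b 1 : ℝ) ^ 2 + 8 * (k : ℝ) ^ 2 / s ^ 2 *
        Real.exp (-(s * b 1) + s ^ 2 * σ ^ 2 / 2) + 6 * ε) := by
  have hk : (k : ℝ≥0∞) ≠ 0 := by exact_mod_cast NeZero.ne k
  set R := 6 * σ ^ 2 + 6 * (b 1 : ℝ) ^ 2 + 8 * (k : ℝ) ^ 2 / s ^ 2 *
        Real.exp (-(s * b 1) + s ^ 2 * σ ^ 2 / 2) with hR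
  have hR0 : 0 ≤ R := by positivity
  have hm2 : ∀ i w₀ S₁, Measurable fun S₂ => D i w₀ S₁ S₂ := fun i w₀ S₁ =>
    (hD i).comp (measurable_const.prodMk (measurable_const.prodMk measurable_id))
  have hm1' : ∀ i, Measurable fun p : EuclideanSpace ℝ (Fin k × Fin d) × NoiseBatch k d (n / 2) =>
      ∫⁻ S₂, D i p.1 p.2 S₂ ∂(Measure.pi fun _ => signalNoise k d) := fun i =>
    Measurable.lintegral_prod_right' (f := fun q : (EuclideanSpace ℝ (Fin k × Fin d) ×
      NoiseBatch k d (n / 2)) × NoiseBatch k d (n / 2) => D i q.1.1 q.1.2 q.2)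
      ((hD i).comp (f := fun q : (EuclideanSpace ℝ (Fin k × Fin d) × NoiseBatch k d (n / 2)) ×
        NoiseBatch k d (n / 2) => (q.1.1, q.1.2, q.2)) (by fun_prop))
  have hm1 : ∀ i w₀, Measurable fun S₁ =>
      ∫⁻ S₂, D i w₀ S₁ S₂ ∂(Measure.pi fun _ => signalNoise k d) := fun i w₀ =>
    (hm1' i).comp (measurable_const.prodMk measurable_id)
  have hm0 : ∀ i, Measurable fun w₀ => ∫⁻ S₁, ∫⁻ S₂, D i w₀ S₁ S₂
      ∂(Measure.pi fun _ => signalNoise k d) ∂(Measure.pi fun _ => signalNoise k d) := fun i =>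
    (hm1' i).lintegral_prod_right'
  refine (expectedRisk_le γ η b w σ (G := fun w₀ S₁ S₂ => ENNReal.ofReal R +
    6 * ((k : ℝ≥0∞)⁻¹ * ∑ i, D i w₀ S₁ S₂)) ?_ fun w₀ S₁ S₂ => ?_).trans ?_
  · exact (((Finset.measurable_sum _ fun i _ => hD i).const_mul _).const_mul _).const_add _
  · refine (risk_lcn_le hw (fun i => ?_) ?_ hs).trans ?_
    · rw [trainedParam, weight_projGradStep]
      exact norm_inv_norm_smul_le _
    · rw [trainedParam, bias_projGradStep]
      exact (b 1).2
    · have e : bias (trainedParam γ η b w σ S₁ S₂ w₀) = b 1 := bias_projGradStep _ _ _ _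
      rw [e]
      gcongr with i
      exact h i w₀ S₁ S₂
  · have e2 : ∀ w₀ S₁, ∫⁻ S₂, (ENNReal.ofReal R + 6 * ((k : ℝ≥0∞)⁻¹ * ∑ i, D i w₀ S₁ S₂))
        ∂(Measure.pi fun _ => signalNoise k d) = ENNReal.ofReal R + 6 * ((k : ℝ≥0∞)⁻¹ *
          ∑ i, ∫⁻ S₂, D i w₀ S₁ S₂ ∂(Measure.pi fun _ => signalNoise k d)) := by
      intro w₀ S₁
      have m := fun i => hm2 i w₀ S₁
      rw [lintegral_add_left measurable_const, lintegral_const_mul _ (by fun_prop),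
        lintegral_const_mul _ (by fun_prop), lintegral_finsetSum _ (by fun_prop)]
      simp
    have e1 : ∀ w₀, ∫⁻ S₁, (ENNReal.ofReal R + 6 * ((k : ℝ≥0∞)⁻¹ *
          ∑ i, ∫⁻ S₂, D i w₀ S₁ S₂ ∂(Measure.pi fun _ => signalNoise k d)))
        ∂(Measure.pi fun _ => signalNoise k d) = ENNReal.ofReal R + 6 * ((k : ℝ≥0∞)⁻¹ *
          ∑ i, ∫⁻ S₁, ∫⁻ S₂, D i w₀ S₁ S₂ ∂(Measure.pi fun _ => signalNoise k d)
            ∂(Measure.pi fun _ => signalNoise k d)) := by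
      intro w₀
      have m := fun i => hm1 i w₀
      rw [lintegral_add_left measurable_const, lintegral_const_mul _ (by fun_prop),
        lintegral_const_mul _ (by fun_prop), lintegral_finsetSum _ (by fun_prop)]
      simp
    simp_rw [e2, e1]
    rw [lintegral_add_left measurable_const, lintegral_const_mul _ (by fun_prop),
      lintegral_const_mul _ (by fun_prop), lintegral_finsetSum _ (by fun_prop)]
    rw [ENNReal.ofReal_add hR0 (by positivity), ENNReal.ofReal_mul (by norm_num)]
    simp only [lintegral_const, measure_univ, mul_one, ENNReal.ofReal_ofNat]
    gcongr
    calc _ ≤ (k : ℝ≥0∞)⁻¹ * ∑ i : Fin k, ENNReal.ofReal ε := by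
          gcongr with i
          exact hi i
      _ = ENNReal.ofReal ε := by
          rw [Finset.sum_const, Finset.card_univ, Fintype.card_fin, nsmul_eq_mul, ← mul_assoc,
            ENNReal.inv_mul_cancel hk (by simp), one_mul]

/-! Expectations over the noise representation -/

section Gaussian
variable {E : Type*} [NormedAddCommGroup E] [InnerProductSpace ℝ E] [FiniteDimensional ℝ E]
  [MeasurableSpace E] [BorelSpace E]

theorem memLp_const_add_inner (c σ : ℝ) (u : E) :
    MemLp (fun ξ => c + σ * inner ℝ u ξ) 2 (stdGaussian E) :=
  (memLp_const c).add ((memLp_inner_stdGaussian u ENNReal.ofNat_ne_top).const_mul σ)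

theorem integral_const_add_inner (c σ : ℝ) (u : E) :
    ∫ ξ, (c + σ * inner ℝ u ξ) ∂(stdGaussian E) = c := by
  rw [integral_add (integrable_const c) (((memLp_inner_stdGaussian u (p := 2)
    ENNReal.ofNat_ne_top).integrable (by norm_num)).const_mul σ), integral_const_mul,
    integral_inner_stdGaussian]
  simp

theorem integral_const_add_inner_sq (c σ : ℝ) (u : E) :
    ∫ ξ, (c + σ * inner ℝ u ξ) ^ 2 ∂(stdGaussian E) = c ^ 2 + σ ^ 2 * ‖u‖ ^ 2 := by
  have i1 : Integrable (fun ξ => inner ℝ u ξ) (stdGaussian E) :=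
    (memLp_inner_stdGaussian u (p := 2) ENNReal.ofNat_ne_top).integrable (by norm_num)
  have i2 : Integrable (fun ξ => inner ℝ u ξ ^ 2)
      (stdGaussian E) :=
    (memLp_inner_stdGaussian u (p := 2) ENNReal.ofNat_ne_top).integrable_sq
  have e : ∀ ξ, (c + σ * inner ℝ u ξ) ^ 2
      = c ^ 2 + (2 * c * σ * inner ℝ u ξ + σ ^ 2 * inner ℝ u ξ ^ 2) := fun ξ => by ring
  simp_rw [e]
  rw [integral_add (integrable_const _)
    (g := fun ξ => 2 * c * σ * inner ℝ u ξ + σ ^ 2 * inner ℝ u ξ ^ 2)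
    ((i1.const_mul _).add (i2.const_mul _)),
    integral_add (i1.const_mul _) (i2.const_mul _), integral_const_mul, integral_const_mul,
    integral_inner_stdGaussian, integral_inner_sq_stdGaussian]
  simp

end Gaussian

theorem inner_patch_noisySignal {k d : ℕ} (u w : EuclideanSpace ℝ (Fin d)) (σ : ℝ)
    (i' : Fin k) (ξ : EuclideanSpace ℝ (Fin k × Fin d)) (i : Fin k) :
    inner ℝ u (patch (noisySignal w σ (i', ξ)) i)
      = (if i' = i then inner ℝ u w else 0) + σ * inner ℝ (signalMean u i) ξ := by
  rw [patch_noisySignal, inner_add_right, inner_smul_right, inner_signalMean]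
  by_cases h : i' = i <;> simp [h]

@[fun_prop]
theorem measurable_patch {k d : ℕ} (i : Fin k) : Measurable fun x : EuclideanSpace ℝ (Fin k × Fin d) =>
    patch x i := by unfold patch; fun_prop

theorem measurable_inner_patch_noisySignal {k d : ℕ} (u w : EuclideanSpace ℝ (Fin d)) (σ : ℝ) (i : Fin k) :
    Measurable fun ω => inner ℝ u (patch (noisySignal w σ ω) i) := by
  fun_prop

section signalNoise
variable {k d : ℕ} [NeZero k]

theorem integrable_signalNoise {f : Fin k × EuclideanSpace ℝ (Fin k × Fin d) → ℝ}
    (hf : Measurable f) (hi : ∀ i, Integrable (fun ξ => f (i, ξ)) (stdGaussian _)) :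
    Integrable f (signalNoise k d) := by
  have : IsFiniteMeasure ((k : ℝ≥0∞)⁻¹ • (Measure.count : Measure (Fin k))) :=
    ⟨by simp [Measure.count_univ, ENNReal.inv_mul_cancel, NeZero.ne k]⟩
  rw [signalNoise, integrable_prod_iff hf.aestronglyMeasurable]
  exact ⟨Filter.Eventually.of_forall hi, Integrable.of_finite⟩

theorem integral_signalNoise {f : Fin k × EuclideanSpace ℝ (Fin k × Fin d) → ℝ}
    (hf : Measurable f) (hi : ∀ i, Integrable (fun ξ => f (i, ξ)) (stdGaussian _)) :
    ∫ ω, f ω ∂(signalNoise k d) = 1 / (k : ℝ) * ∑ i, ∫ ξ, f (i, ξ) ∂(stdGaussian _) := by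
  have h := integrable_signalNoise hf hi
  have : IsFiniteMeasure ((k : ℝ≥0∞)⁻¹ • (Measure.count : Measure (Fin k))) :=
    ⟨by simp [Measure.count_univ, ENNReal.inv_mul_cancel, NeZero.ne k]⟩
  rw [signalNoise] at h ⊢
  rw [integral_prod _ h, integral_smul_measure, integral_count]
  simp

theorem memLp_two_signalNoise {f : Fin k × EuclideanSpace ℝ (Fin k × Fin d) → ℝ}
    (hf : Measurable f) (hi : ∀ i, MemLp (fun ξ => f (i, ξ)) 2 (stdGaussian _)) :
    MemLp f 2 (signalNoise k d) := by
  rw [memLp_two_iff_integrable_sq hf.aestronglyMeasurable]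
  exact integrable_signalNoise (hf.pow_const 2) fun i => (hi i).integrable_sq

theorem memLp_inner_patch_noisySignal (u w : EuclideanSpace ℝ (Fin d)) (σ : ℝ) (i : Fin k) :
    MemLp (fun ω => inner ℝ u (patch (noisySignal w σ ω) i)) 2 (signalNoise k d) := by
  refine memLp_two_signalNoise (measurable_inner_patch_noisySignal u w σ i) fun i' => ?_
  simp_rw [inner_patch_noisySignal]
  exact memLp_const_add_inner _ _ _

theorem integral_inner_patch_noisySignal (u w : EuclideanSpace ℝ (Fin d)) (σ : ℝ) (i : Fin k) :
    ∫ ω, inner ℝ u (patch (noisySignal w σ ω) i) ∂(signalNoise k d)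
      = 1 / (k : ℝ) * inner ℝ u w := by
  rw [integral_signalNoise (measurable_inner_patch_noisySignal u w σ i) fun i' => ?_]
  · simp_rw [inner_patch_noisySignal, integral_const_add_inner]
    simp
  · simp_rw [inner_patch_noisySignal]
    exact (memLp_const_add_inner _ _ _).integrable (by norm_num)

theorem integral_inner_patch_noisySignal_sq (u w : EuclideanSpace ℝ (Fin d)) (σ : ℝ) (i : Fin k) :
    ∫ ω, inner ℝ u (patch (noisySignal w σ ω) i) ^ 2 ∂(signalNoise k d)
      = 1 / (k : ℝ) * inner ℝ u w ^ 2 + σ ^ 2 * ‖u‖ ^ 2 := by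
  have hk : (k : ℝ) ≠ 0 := by exact_mod_cast NeZero.ne k
  rw [integral_signalNoise ((measurable_inner_patch_noisySignal u w σ i).pow_const 2)
    fun i' => ?_]
  · simp_rw [inner_patch_noisySignal, integral_const_add_inner_sq]
    rw [Finset.sum_add_distrib]
    simp [norm_signalMean, ite_pow]
    field_simp
  · simp_rw [inner_patch_noisySignal]
    exact (memLp_const_add_inner _ _ _).integrable_sq

/-- The average of the `i`-th patches, with the signs of the labels removed. -/
noncomputable def patchMean {N : ℕ} (w : EuclideanSpace ℝ (Fin d)) (σ : ℝ)
    (S : NoiseBatch k d N) (i : Fin k) : EuclideanSpace ℝ (Fin d) :=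
  (1 / (N : ℝ)) • ∑ j, patch (noisySignal w σ (S j)) i

/-- The variance is bounded by the second moment. The signal appears in the patch with probability
`1 / k`, and each of the `d` noise coordinates contributes `σ²`. -/
theorem lintegral_normSq_patchMean_le {w : EuclideanSpace ℝ (Fin d)} (hw : ‖w‖ = 1) (σ : ℝ)
    {N : ℕ} (hN : 0 < N) (i : Fin k) :
    ∫⁻ S : NoiseBatch k d N, ENNReal.ofReal (‖patchMean w σ S i - (1 / (k : ℝ)) • w‖ ^ 2)
      ∂(Measure.pi fun _ => signalNoise k d) ≤ ENNReal.ofReal ((1 / k + σ ^ 2 * d) / N) := by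
  have e : ∀ (x : EuclideanSpace ℝ (Fin d)) a, x a = inner ℝ (EuclideanSpace.single a (1 : ℝ)) x :=
    fun x a => by simp [EuclideanSpace.inner_single_left]
  refine lintegral_normSq_empirical_mean_sub_le (signalNoise k d)
    (h := fun ω => patch (noisySignal w σ ω) i) (by fun_prop) (fun a => ?_) (fun a => ?_) ?_ hN
  · simp_rw [e (patch _ _) a]
    exact memLp_inner_patch_noisySignal _ w σ i
  · simp_rw [e (patch _ _) a]
    rw [integral_inner_patch_noisySignal]
    simp [EuclideanSpace.inner_single_left]
  · simp_rw [e (patch _ _) _, integral_inner_patch_noisySignal_sq]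
    rw [Finset.sum_add_distrib, ← Finset.mul_sum]
    have : ∑ a, inner ℝ (EuclideanSpace.single a (1 : ℝ)) w ^ 2 = 1 := by
      simp_rw [← e w]
      rw [← EuclideanSpace.real_norm_sq_eq, hw, one_pow]
    rw [this]
    simp [mul_comm]

/-- Along the single direction `w` the noise contributes `σ²` instead of `σ² d`. This gain is what
makes a weak correlation available after the first step. -/
theorem lintegral_sq_inner_patchMean_le {w : EuclideanSpace ℝ (Fin d)} (hw : ‖w‖ = 1) (σ : ℝ)
    {N : ℕ} (hN : 0 < N) (i : Fin k) :
    ∫⁻ S : NoiseBatch k d N, ENNReal.ofReal (inner ℝ w (patchMean w σ S i - (1 / (k : ℝ)) • w) ^ 2)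
      ∂(Measure.pi fun _ => signalNoise k d) ≤ ENNReal.ofReal ((1 / k + σ ^ 2) / N) := by
  have h := lintegral_sq_empirical_mean_sub_le (signalNoise k d)
    (memLp_inner_patch_noisySignal w w σ i) hN
  rw [integral_inner_patch_noisySignal_sq, integral_inner_patch_noisySignal,
    real_inner_self_eq_norm_sq, hw] at h
  simpa [patchMean, inner_sub_right, inner_smul_right, inner_sum, hw] using h

theorem lintegral_normSq_stdGaussian (ι : Type) [Fintype ι] :
    ∫⁻ ξ : EuclideanSpace ℝ ι, ENNReal.ofReal (‖ξ‖ ^ 2) ∂(stdGaussian _)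
      = ENNReal.ofReal (Fintype.card ι) := by
  classical
  have e : ∀ (x : EuclideanSpace ℝ ι) a, x a = inner ℝ (EuclideanSpace.single a (1 : ℝ)) x :=
    fun x a => by simp [EuclideanSpace.inner_single_left]
  have h1 : ∀ x : EuclideanSpace ℝ ι, ENNReal.ofReal (‖x‖ ^ 2)
      = ∑ a, ENNReal.ofReal (inner ℝ (EuclideanSpace.single a (1 : ℝ)) x ^ 2) := by
    intro x
    rw [EuclideanSpace.real_norm_sq_eq, ENNReal.ofReal_sum_of_nonneg fun a _ => sq_nonneg _]
    simp_rw [e x]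
  simp_rw [h1]
  rw [lintegral_finsetSum _ fun a _ => by fun_prop]
  have h2 : ∀ a, ∫⁻ x : EuclideanSpace ℝ ι,
      ENNReal.ofReal (inner ℝ (EuclideanSpace.single a (1 : ℝ)) x ^ 2) ∂(stdGaussian _) = 1 := by
    intro a
    rw [← ofReal_integral_eq_lintegral_ofReal (memLp_inner_stdGaussian _
      ENNReal.ofNat_ne_top).integrable_sq (Filter.Eventually.of_forall fun x => sq_nonneg _),
      integral_inner_sq_stdGaussian]
    simp
  simp [h2]

theorem lintegral_normSq_noisySignal_le {w : EuclideanSpace ℝ (Fin d)} (hw : ‖w‖ = 1) (σ : ℝ) :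
    ∫⁻ ω, ENNReal.ofReal (‖noisySignal w σ ω‖ ^ 2) ∂(signalNoise k d)
      ≤ ENNReal.ofReal (2 + 2 * σ ^ 2 * (k * d)) := by
  have hk : (k : ℝ≥0∞) ≠ 0 := by exact_mod_cast NeZero.ne k
  rw [lintegral_signalNoise _ _ (by fun_prop)]
  calc _ ≤ (k : ℝ≥0∞)⁻¹ * ∑ i : Fin k, ENNReal.ofReal (2 + 2 * σ ^ 2 * (k * d)) := by
        gcongr with i
        calc _ ≤ ∫⁻ ξ : EuclideanSpace ℝ (Fin k × Fin d), (ENNReal.ofReal 2 +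
              ENNReal.ofReal (2 * σ ^ 2) * ENNReal.ofReal (‖ξ‖ ^ 2)) ∂(stdGaussian _) := by
              refine lintegral_mono fun ξ => ?_
              rw [← ENNReal.ofReal_mul (by positivity),
                ← ENNReal.ofReal_add (by positivity) (by positivity)]
              apply ENNReal.ofReal_le_ofReal
              have h1 : ‖noisySignal w σ (i, ξ)‖ ≤ 1 + |σ| * ‖ξ‖ := by
                refine (norm_add_le _ _).trans ?_
                rw [norm_signalMean, hw, norm_smul, Real.norm_eq_abs]
              have h2 : ‖noisySignal w σ (i, ξ)‖ ^ 2 ≤ (1 + |σ| * ‖ξ‖) ^ 2 := by gcongr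
              have h3 : (|σ| * ‖ξ‖) ^ 2 = σ ^ 2 * ‖ξ‖ ^ 2 := by rw [mul_pow, sq_abs]
              nlinarith [sq_nonneg (1 - |σ| * ‖ξ‖)]
          _ = _ := by
              rw [lintegral_add_left measurable_const, lintegral_const_mul _ (by fun_prop),
                lintegral_normSq_stdGaussian, ← ENNReal.ofReal_mul (by positivity),
                lintegral_const, measure_univ, mul_one,
                ← ENNReal.ofReal_add (by positivity) (by positivity)]
              simp
    _ = _ := by
        rw [Finset.sum_const, Finset.card_univ, Fintype.card_fin, nsmul_eq_mul, ← mul_assoc,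
          ENNReal.inv_mul_cancel hk (by simp), one_mul]

theorem lintegral_mean_normSq_noisySignal_le {w : EuclideanSpace ℝ (Fin d)} (hw : ‖w‖ = 1) (σ : ℝ)
    {N : ℕ} (hN : 0 < N) :
    ∫⁻ S : NoiseBatch k d N, ENNReal.ofReal (1 / (N : ℝ) * ∑ j, ‖noisySignal w σ (S j)‖ ^ 2)
      ∂(Measure.pi fun _ => signalNoise k d) ≤ ENNReal.ofReal (2 + 2 * σ ^ 2 * (k * d)) := by
  have hN' : (N : ℝ) ≠ 0 := by positivity
  have h1 : ∀ S : NoiseBatch k d N,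
      ENNReal.ofReal (1 / (N : ℝ) * ∑ j, ‖noisySignal w σ (S j)‖ ^ 2)
        = ENNReal.ofReal (1 / (N : ℝ)) * ∑ j, ENNReal.ofReal (‖noisySignal w σ (S j)‖ ^ 2) := by
    intro S
    rw [ENNReal.ofReal_mul (by positivity),
      ENNReal.ofReal_sum_of_nonneg fun a _ => sq_nonneg _]
  simp_rw [h1]
  rw [lintegral_const_mul _ (by fun_prop), lintegral_finsetSum _ fun j _ => by fun_prop]
  have h2 : ∀ j : Fin N, ∫⁻ S : NoiseBatch k d N, ENNReal.ofReal (‖noisySignal w σ (S j)‖ ^ 2)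
      ∂(Measure.pi fun _ => signalNoise k d) ≤ ENNReal.ofReal (2 + 2 * σ ^ 2 * (k * d)) := by
    intro j
    have := (measurePreserving_eval (fun _ : Fin N => signalNoise k d) j).lintegral_comp
      (f := fun ω => ENNReal.ofReal (‖noisySignal w σ ω‖ ^ 2)) (by fun_prop)
    exact this.trans_le (lintegral_normSq_noisySignal_le hw σ)
  calc _ ≤ ENNReal.ofReal (1 / (N : ℝ)) *
        ∑ _j : Fin N, ENNReal.ofReal (2 + 2 * σ ^ 2 * (k * d)) := by
        gcongr with j
        exact h2 j
    _ = _ := by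
        rw [Finset.sum_const, Finset.card_univ, Fintype.card_fin, nsmul_eq_mul,
          ← ENNReal.ofReal_natCast N, ← mul_assoc, ← ENNReal.ofReal_mul (by positivity)]
        field_simp
        simp

/-- A bound for the effect of the initialization on the first step. -/
noncomputable def initEffect {N : ℕ} (γ : ℝ≥0) (w : EuclideanSpace ℝ (Fin d)) (σ : ℝ)
    (w₀ : EuclideanSpace ℝ (Fin k × Fin d)) (S : NoiseBatch k d N) : ℝ :=
  √(γ : ℝ) * ‖w₀‖ * (1 + 1 / (N : ℝ) * ∑ j, ‖noisySignal w σ (S j)‖ ^ 2)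

/-- The initialization is independent of the data, and its norm is at most one plus its square,
whose expectation is `k d`. Crude moments suffice, since the variance of the initialization is
polynomially small. -/
theorem lintegral_initEffect_le (γ : ℝ≥0) {w : EuclideanSpace ℝ (Fin d)} (hw : ‖w‖ = 1)
    (σ : ℝ) {N : ℕ} (hN : 0 < N) :
    ∫⁻ w₀, ∫⁻ S : NoiseBatch k d N, ENNReal.ofReal (initEffect γ w σ w₀ S)
      ∂(Measure.pi fun _ => signalNoise k d) ∂(stdGaussian _)
      ≤ ENNReal.ofReal (√(γ : ℝ) * (1 + k * d) * (3 + 2 * σ ^ 2 * (k * d))) := by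
  have h1 : ∀ w₀ (S : NoiseBatch k d N), ENNReal.ofReal (initEffect γ w σ w₀ S)
      = ENNReal.ofReal (√(γ : ℝ) * ‖w₀‖) * (1 +
        ENNReal.ofReal (1 / (N : ℝ) * ∑ j, ‖noisySignal w σ (S j)‖ ^ 2)) := by
    intro w₀ S
    rw [initEffect, ENNReal.ofReal_mul (by positivity), ENNReal.ofReal_add zero_le_one
      (mul_nonneg (by positivity) (Finset.sum_nonneg fun _ _ => sq_nonneg _)), ENNReal.ofReal_one]
  have h2 : ∀ w₀, ∫⁻ S : NoiseBatch k d N, ENNReal.ofReal (initEffect γ w σ w₀ S)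
      ∂(Measure.pi fun _ => signalNoise k d)
      ≤ ENNReal.ofReal (√(γ : ℝ)) * (1 + ENNReal.ofReal (‖w₀‖ ^ 2)) *
        ENNReal.ofReal (3 + 2 * σ ^ 2 * (k * d)) := by
    intro w₀
    simp_rw [h1]
    rw [lintegral_const_mul _ (by fun_prop), lintegral_add_left measurable_const]
    simp only [lintegral_const, measure_univ, mul_one]
    gcongr
    · rw [ENNReal.ofReal_mul (by positivity), ← ENNReal.ofReal_one,
        ← ENNReal.ofReal_add zero_le_one (by positivity)]
      gcongr
      nlinarith [sq_nonneg (‖w₀‖ - 1)]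
    · calc _ ≤ 1 + ENNReal.ofReal (2 + 2 * σ ^ 2 * (k * d)) := by
            gcongr
            exact lintegral_mean_normSq_noisySignal_le hw σ hN
        _ = _ := by
            rw [← ENNReal.ofReal_one, ← ENNReal.ofReal_add zero_le_one (by positivity)]
            ring_nf
  refine (lintegral_mono h2).trans ?_
  rw [lintegral_mul_const _ (by fun_prop), lintegral_const_mul _ (by fun_prop),
    lintegral_add_left measurable_const, lintegral_normSq_stdGaussian]
  simp only [lintegral_const, measure_univ, mul_one]
  rw [← ENNReal.ofReal_one, ← ENNReal.ofReal_add zero_le_one (by positivity),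
    ← ENNReal.ofReal_mul (by positivity), ← ENNReal.ofReal_mul (by positivity)]
  simp

end signalNoise

/-! The first step -/

section geometry
variable {E : Type*} [NormedAddCommGroup E] [InnerProductSpace ℝ E]

/-- The error is counted twice: once for the direction, once for replacing `M` by the true length
`‖u‖`. If `u = 0`, the normalized vector is 0 and the hypothesis forces `ε ≥ 1`. -/
theorem norm_normalize_sub_le {u w : E} (hw : ‖w‖ = 1) {M ε : ℝ} (hM : 0 < M)
    (h : ‖u - M • w‖ ≤ ε * M) : ‖‖u‖⁻¹ • u - w‖ ≤ 2 * ε := by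
  have hMw : ‖M • w‖ = M := by rw [norm_smul, hw, mul_one, Real.norm_eq_abs, abs_of_pos hM]
  by_cases hu : u = 0
  · subst hu
    rw [zero_sub, norm_neg, hMw] at h
    have : 1 ≤ ε := by by_contra! h'; nlinarith
    simp [hw]; linarith
  · have h1 : M • (‖u‖⁻¹ • u - w) = (M - ‖u‖) • (‖u‖⁻¹ • u) + (u - M • w) := by
      rw [sub_smul, smul_inv_smul₀ (norm_ne_zero_iff.2 hu), smul_sub]
      abel
    have h2 : ‖M • (‖u‖⁻¹ • u - w)‖ ≤ |M - ‖u‖| + ε * M := by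
      rw [h1]
      refine (norm_add_le _ _).trans (add_le_add ?_ h)
      rw [norm_smul, norm_smul, norm_inv, norm_norm, inv_mul_cancel₀ (norm_ne_zero_iff.2 hu),
        mul_one, Real.norm_eq_abs]
    have h3 : |M - ‖u‖| ≤ ε * M := by
      have := abs_norm_sub_norm_le (M • w) u
      rw [hMw, norm_sub_rev] at this
      linarith
    rw [norm_smul, Real.norm_eq_abs, abs_of_pos hM] at h2
    by_contra! h4
    nlinarith

theorem le_inner_normalize {u w : E} {a b c : ℝ} (ha : 0 < a) (hi : a ≤ inner ℝ u w)
    (hc : ‖u‖ ≤ c) (hb : 0 ≤ b) (h : b * c ≤ a) : b ≤ inner ℝ (‖u‖⁻¹ • u) w := by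
  have hu : 0 < ‖u‖ := by
    rw [norm_pos_iff]
    rintro rfl
    rw [inner_zero_left] at hi
    linarith
  rw [real_inner_smul_left, inv_mul_eq_div, le_div_iff₀ hu]
  nlinarith

end geometry

section firstStep
variable {k d : ℕ}

theorem lcn_of_bias_eq_zero {v : LCNParam k d} (h : bias v = 0)
    (x : EuclideanSpace ℝ (Fin k × Fin d)) :
    lcn v x = ∑ i, inner ℝ (weight v i) (patch x i) := by
  simp [lcn, h, lsa_zero]

theorem gradWeight_of_bias_eq_zero {N : ℕ} {v : LCNParam k d} (h : bias v = 0)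
    (S : Fin N → EuclideanSpace ℝ (Fin k × Fin d) × ℝ) (i : Fin k) :
    gradWeight v S i = -(2 : ℝ) • (1 / (N : ℝ)) •
        ∑ j, ((S j).2 - lcn v (S j).1) • patch (S j).1 i := by
  rw [gradWeight_eq v S i (s := fun _ => 1) fun j => by rw [h]; exact hasDerivAt_lsa_zero _]
  simp

/-- The weight vectors after the first step, before normalization. -/
noncomputable def firstDirection {N : ℕ} (γ : ℝ≥0) (w : EuclideanSpace ℝ (Fin d)) (σ : ℝ)
    (w₀ : EuclideanSpace ℝ (Fin k × Fin d)) (S : NoiseBatch k d N) (i : Fin k) :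
    EuclideanSpace ℝ (Fin d) :=
  patch (√(γ : ℝ) • w₀) i + (1 / (N : ℝ)) •
    ∑ j, (1 - inner ℝ (√(γ : ℝ) • w₀) (noisySignal w σ (S j))) • patch (noisySignal w σ (S j)) i

/-- The weight vectors after the first step. -/
noncomputable def firstWeight {N : ℕ} (γ : ℝ≥0) (w : EuclideanSpace ℝ (Fin d)) (σ : ℝ)
    (w₀ : EuclideanSpace ℝ (Fin k × Fin d)) (S : NoiseBatch k d N) (i : Fin k) :
    EuclideanSpace ℝ (Fin d) :=
  ‖firstDirection γ w σ w₀ S i‖⁻¹ • firstDirection γ w σ w₀ S i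

theorem norm_firstWeight_le {N : ℕ} (γ : ℝ≥0) (w : EuclideanSpace ℝ (Fin d)) (σ : ℝ)
    (w₀ : EuclideanSpace ℝ (Fin k × Fin d)) (S : NoiseBatch k d N) (i : Fin k) :
    ‖firstWeight γ w σ w₀ S i‖ ≤ 1 := norm_inv_norm_smul_le _

@[fun_prop]
theorem measurable_firstWeight {N : ℕ} (γ : ℝ≥0) (w : EuclideanSpace ℝ (Fin d)) (σ : ℝ)
    (i : Fin k) : Measurable fun p : EuclideanSpace ℝ (Fin k × Fin d) × NoiseBatch k d N =>
      firstWeight γ w σ p.1 p.2 i := by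
  unfold firstWeight firstDirection
  fun_prop

/-- Step size `1/2` cancels the factor 2 from differentiating the square. -/
theorem weight_first_projGradStep {N : ℕ} (γ : ℝ≥0) (w : EuclideanSpace ℝ (Fin d)) (σ b : ℝ)
    (w₀ : EuclideanSpace ℝ (Fin k × Fin d)) (S : NoiseBatch k d N) (i : Fin k) :
    weight (projGradStep (1 / 2) b (mkParam (patch (√(γ : ℝ) • w₀)) 0) (positiveSample w σ S)) i
      = firstWeight γ w σ w₀ S i := by
  have h : weight (mkParam (patch (√(γ : ℝ) • w₀)) 0) i - (1 / 2 : ℝ) •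
      gradWeight (mkParam (patch (√(γ : ℝ) • w₀)) 0) (positiveSample w σ S) i
      = firstDirection γ w σ w₀ S i := by
    rw [gradWeight_of_bias_eq_zero rfl, weight_mkParam, firstDirection, sub_eq_add_neg]
    congr 1
    rw [smul_smul, ← neg_smul]
    norm_num
    congr 1
    refine Finset.sum_congr rfl fun j _ => ?_
    rw [lcn_of_bias_eq_zero rfl]
    simp_rw [weight_mkParam]
    rw [sum_inner_patch]
    rfl
  rw [weight_projGradStep, h, firstWeight]

/-- The initialization enters twice: as the starting point, and through the predictions subtracted
from the labels. -/
theorem norm_firstDirection_sub_patchMean_le {N : ℕ} (γ : ℝ≥0) (w : EuclideanSpace ℝ (Fin d))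
    (σ : ℝ) (w₀ : EuclideanSpace ℝ (Fin k × Fin d)) (S : NoiseBatch k d N) (i : Fin k) :
    ‖firstDirection γ w σ w₀ S i - patchMean w σ S i‖ ≤ initEffect γ w σ w₀ S := by
  have h : firstDirection γ w σ w₀ S i - patchMean w σ S i
      = patch (√(γ : ℝ) • w₀) i - (1 / (N : ℝ)) • ∑ j,
        inner ℝ (√(γ : ℝ) • w₀) (noisySignal w σ (S j)) • patch (noisySignal w σ (S j)) i := by
    simp only [firstDirection, patchMean, sub_smul, one_smul, Finset.sum_sub_distrib, smul_sub]
    abel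
  have h0 : ‖√(γ : ℝ) • w₀‖ = √(γ : ℝ) * ‖w₀‖ := by
    rw [norm_smul, Real.norm_eq_abs, abs_of_nonneg (Real.sqrt_nonneg _)]
  rw [h, initEffect, mul_add, mul_one]
  refine (norm_sub_le _ _).trans (add_le_add ?_ ?_)
  · rw [← h0]; exact norm_patch_le _ _
  · rw [norm_smul, Real.norm_eq_abs, abs_of_nonneg (by positivity), mul_left_comm]
    gcongr
    rw [Finset.mul_sum]
    refine (norm_sum_le _ _).trans (Finset.sum_le_sum fun j _ => ?_)
    rw [norm_smul, Real.norm_eq_abs, sq, ← mul_assoc, ← h0]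
    exact mul_le_mul (abs_real_inner_le_norm _ _) (norm_patch_le _ _) (norm_nonneg _)
      (by positivity)

theorem norm_firstWeight_sub_le {N : ℕ} {γ : ℝ≥0} {w : EuclideanSpace ℝ (Fin d)} (hw : ‖w‖ = 1)
    {σ : ℝ} {w₀ : EuclideanSpace ℝ (Fin k × Fin d)} {S : NoiseBatch k d N} {i : Fin k} {τ : ℝ}
    (hk : 0 < k) (h1 : k * ‖patchMean w σ S i - (1 / (k : ℝ)) • w‖ ≤ τ)
    (h2 : k * initEffect γ w σ w₀ S ≤ τ) : ‖firstWeight γ w σ w₀ S i - w‖ ≤ 4 * τ := by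
  have hk' : (0 : ℝ) < k := by exact_mod_cast hk
  have h3 := norm_firstDirection_sub_patchMean_le γ w σ w₀ S i
  have h4 : ‖firstDirection γ w σ w₀ S i - (1 / (k : ℝ)) • w‖ ≤ 2 * τ * (1 / (k : ℝ)) := by
    rw [← sub_add_sub_cancel _ (patchMean w σ S i)]
    refine (norm_add_le _ _).trans ?_
    rw [mul_one_div, le_div_iff₀ hk']
    nlinarith
  have := norm_normalize_sub_le hw (by positivity) h4
  rw [firstWeight]
  linarith

/-- The full error of the patch mean may exceed the signal `1 / k` by a factor `1 / (8 b)`; only its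
component along `w` must be small. The inner product before normalization then stays of order `1 /
k`, and the length is at most of order `1 / (b k)`. -/
theorem le_inner_firstWeight {N : ℕ} {γ : ℝ≥0} {w : EuclideanSpace ℝ (Fin d)} (hw : ‖w‖ = 1)
    {σ : ℝ} {w₀ : EuclideanSpace ℝ (Fin k × Fin d)} {S : NoiseBatch k d N} {i : Fin k} {b : ℝ}
    (hk : 0 < k) (hb : 0 < b) (hb' : b ≤ 1 / 8)
    (h1 : 8 * b * k * ‖patchMean w σ S i - (1 / (k : ℝ)) • w‖ ≤ 1)
    (h2 : 8 * k * initEffect γ w σ w₀ S ≤ 1)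
    (h3 : 8 * k * |inner ℝ w (patchMean w σ S i - (1 / (k : ℝ)) • w)| ≤ 1) :
    2 * b ≤ inner ℝ (firstWeight γ w σ w₀ S i) w := by
  have hk' : (0 : ℝ) < k := by exact_mod_cast hk
  have h4 := norm_firstDirection_sub_patchMean_le γ w σ w₀ S i
  set A := patchMean w σ S i
  set u := firstDirection γ w σ w₀ S i with hu
  have e1 : inner ℝ u w = 1 / (k : ℝ) + inner ℝ w (A - (1 / (k : ℝ)) • w) + inner ℝ (u - A) w := by
    rw [inner_sub_right, inner_smul_right, real_inner_self_eq_norm_sq, hw, inner_sub_left,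
      real_inner_comm w A]
    ring
  have e2 : |inner ℝ (u - A) w| ≤ initEffect γ w σ w₀ S := by
    refine (abs_real_inner_le_norm _ _).trans ?_
    rw [hw, mul_one]; exact h4
  have e3 : ‖u‖ ≤ 1 / (k : ℝ) + ‖A - (1 / (k : ℝ)) • w‖ + initEffect γ w σ w₀ S := by
    have : u = (1 / (k : ℝ)) • w + (A - (1 / (k : ℝ)) • w) + (u - A) := by abel
    rw [this]
    refine (norm_add_le _ _).trans (add_le_add ((norm_add_le _ _).trans ?_) h4)
    rw [norm_smul, hw, mul_one, Real.norm_eq_abs, abs_of_pos (by positivity)]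
  have f1 := abs_le.1 e2
  have f2 := neg_abs_le (inner ℝ w (A - (1 / (k : ℝ)) • w))
  have g2 : initEffect γ w σ w₀ S ≤ 1 / 8 * (1 / (k : ℝ)) := by
    rw [mul_one_div, le_div_iff₀ hk']; linarith
  have g3 : |inner ℝ w (A - (1 / (k : ℝ)) • w)| ≤ 1 / 8 * (1 / (k : ℝ)) := by
    rw [mul_one_div, le_div_iff₀ hk']; linarith
  have g1 : b * ‖A - (1 / (k : ℝ)) • w‖ ≤ 1 / 8 * (1 / (k : ℝ)) := by
    rw [mul_one_div, le_div_iff₀ hk']; linarith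
  have p : 0 < 1 / (k : ℝ) := by positivity
  -- Two errors of at most `1 / (8 k)` are lost from `1 / k`, leaving `3 / (4 k)`.
  refine le_inner_normalize (a := 3 / 4 * (1 / (k : ℝ))) (by positivity) (by linarith) e3
    (by positivity) ?_
  nlinarith

end firstStep

/-! The second step -/

section Gaussian
variable {E : Type*} [NormedAddCommGroup E] [InnerProductSpace ℝ E] [FiniteDimensional ℝ E]
  [MeasurableSpace E] [BorelSpace E]

theorem integral_affine_mul_affine (ρ σ c : ℝ) (u v : E) :
    ∫ ξ, (ρ - σ * inner ℝ u ξ) * (c + σ * inner ℝ v ξ) ∂(stdGaussian E)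
      = ρ * c - σ ^ 2 * inner ℝ u v := by
  have i1 : ∀ u : E, Integrable (fun ξ => inner ℝ u ξ) (stdGaussian E) := fun u =>
    (memLp_inner_stdGaussian u (p := 2) ENNReal.ofNat_ne_top).integrable (by norm_num)
  have i2 := integrable_inner_mul_inner_stdGaussian u v
  have e : ∀ ξ, (ρ - σ * inner ℝ u ξ) * (c + σ * inner ℝ v ξ)
      = (ρ * c + (ρ * σ * inner ℝ v ξ - c * σ * inner ℝ u ξ))
        - σ ^ 2 * (inner ℝ u ξ * inner ℝ v ξ) := fun ξ => by ring
  simp_rw [e]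
  have i3 : Integrable (fun ξ => ρ * σ * inner ℝ v ξ - c * σ * inner ℝ u ξ) (stdGaussian E) :=
    ((i1 v).const_mul _).sub ((i1 u).const_mul _)
  rw [integral_sub (f := fun ξ => ρ * c + (ρ * σ * inner ℝ v ξ - c * σ * inner ℝ u ξ))
    ((integrable_const _).add i3) (i2.const_mul _),
    integral_add (integrable_const _) i3, integral_sub ((i1 v).const_mul _) ((i1 u).const_mul _)]
  simp only [integral_const_mul, integral_inner_stdGaussian, integral_inner_mul_inner_stdGaussian]
  simp

/-- A polynomial bound for the square of a product of two affine functions. -/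
theorem sq_affine_mul_affine_le (ρ σ c p q : ℝ) :
    ((ρ - σ * p) * (c + σ * q)) ^ 2
      ≤ 4 * ρ ^ 2 * c ^ 2 + 4 * ρ ^ 2 * σ ^ 2 * q ^ 2 + 4 * σ ^ 2 * c ^ 2 * p ^ 2
        + 2 * σ ^ 4 * (p ^ 4 + q ^ 4) := by
  have h1 : (ρ - σ * p) ^ 2 ≤ 2 * (ρ ^ 2 + σ ^ 2 * p ^ 2) := by nlinarith [sq_nonneg (ρ + σ * p)]
  have h2 : (c + σ * q) ^ 2 ≤ 2 * (c ^ 2 + σ ^ 2 * q ^ 2) := by nlinarith [sq_nonneg (c - σ * q)]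
  have h3 := mul_le_mul h1 h2 (sq_nonneg _) (by positivity)
  have h4 : 0 ≤ σ ^ 4 * (p ^ 2 - q ^ 2) ^ 2 := by positivity
  rw [mul_pow]
  nlinarith

theorem integrable_affine_mul_affine_sq (ρ σ c : ℝ) (u v : E) :
    Integrable (fun ξ => ((ρ - σ * inner ℝ u ξ) * (c + σ * inner ℝ v ξ)) ^ 2) (stdGaussian E) := by
  have i2 : ∀ u : E, Integrable (fun ξ => inner ℝ u ξ ^ 2) (stdGaussian E) := fun u =>
    (memLp_inner_stdGaussian u ENNReal.ofNat_ne_top).integrable_sq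
  have i4 := integrable_inner_pow_four_stdGaussian (E := E)
  refine Integrable.mono' ((((integrable_const (4 * ρ ^ 2 * c ^ 2)).add
    ((i2 v).const_mul (4 * ρ ^ 2 * σ ^ 2))).add ((i2 u).const_mul (4 * σ ^ 2 * c ^ 2))).add
    (((i4 u).add (i4 v)).const_mul (2 * σ ^ 4))) (by fun_prop)
    (Filter.Eventually.of_forall fun ξ => ?_)
  rw [Real.norm_eq_abs, abs_of_nonneg (sq_nonneg _)]
  exact sq_affine_mul_affine_le _ _ _ _ _

/-- The assumption `σ ≤ ρ` turns `σ ^ 4` into `ρ ^ 2 * σ ^ 2`, so that `ρ ^ 2` factors out of the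
whole bound. The constant is `4 * 97 = 4 + 2 * (96 + 96)`. -/
theorem integral_affine_mul_affine_sq_le {ρ σ : ℝ} (hσ : 0 ≤ σ) (hρ : σ ≤ ρ) (c : ℝ) {u v : E}
    (hu : ‖u‖ ≤ 1) (hv : ‖v‖ ≤ 1) :
    ∫ ξ, ((ρ - σ * inner ℝ u ξ) * (c + σ * inner ℝ v ξ)) ^ 2 ∂(stdGaussian E)
      ≤ 4 * ρ ^ 2 * (2 * c ^ 2 + 97 * σ ^ 2) := by
  have i2 : ∀ u : E, Integrable (fun ξ => inner ℝ u ξ ^ 2) (stdGaussian E) := fun u =>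
    (memLp_inner_stdGaussian u ENNReal.ofNat_ne_top).integrable_sq
  have i4 := integrable_inner_pow_four_stdGaussian (E := E)
  have j1 : Integrable (fun ξ => 4 * ρ ^ 2 * c ^ 2 + 4 * ρ ^ 2 * σ ^ 2 * inner ℝ v ξ ^ 2)
      (stdGaussian E) := (integrable_const _).add ((i2 v).const_mul _)
  have j2 : Integrable (fun ξ => 4 * ρ ^ 2 * c ^ 2 + 4 * ρ ^ 2 * σ ^ 2 * inner ℝ v ξ ^ 2
      + 4 * σ ^ 2 * c ^ 2 * inner ℝ u ξ ^ 2) (stdGaussian E) := j1.add ((i2 u).const_mul _)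
  have j3 : Integrable (fun ξ => 2 * σ ^ 4 * (inner ℝ u ξ ^ 4 + inner ℝ v ξ ^ 4))
      (stdGaussian E) := ((i4 u).add (i4 v)).const_mul _
  refine (integral_mono (integrable_affine_mul_affine_sq ρ σ c u v) (j2.add j3)
    fun ξ => sq_affine_mul_affine_le _ _ _ _ _).trans ?_
  rw [integral_add' j2 j3, integral_add j1 ((i2 u).const_mul _),
    integral_add (integrable_const _) ((i2 v).const_mul _)]
  simp only [integral_const_mul, integral_inner_sq_stdGaussian]
  rw [integral_add (i4 u) (i4 v)]
  have h1 := integral_inner_pow_four_stdGaussian_le hu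
  have h2 := integral_inner_pow_four_stdGaussian_le hv
  have hu2 : ‖u‖ ^ 2 ≤ 1 := by nlinarith [norm_nonneg u]
  have hv2 : ‖v‖ ^ 2 ≤ 1 := by nlinarith [norm_nonneg v]
  have hs : σ ^ 2 ≤ ρ ^ 2 := by gcongr
  have a1 : 4 * ρ ^ 2 * σ ^ 2 * ‖v‖ ^ 2 ≤ 4 * ρ ^ 2 * σ ^ 2 * 1 := by gcongr
  have a2 : 4 * σ ^ 2 * c ^ 2 * ‖u‖ ^ 2 ≤ 4 * ρ ^ 2 * c ^ 2 * 1 := by gcongr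
  have a3 : 2 * σ ^ 4 * ((∫ ξ, inner ℝ u ξ ^ 4 ∂(stdGaussian E)) +
      ∫ ξ, inner ℝ v ξ ^ 4 ∂(stdGaussian E)) ≤ 2 * (ρ ^ 2 * σ ^ 2) * (96 + 96) := by
    have : σ ^ 4 ≤ ρ ^ 2 * σ ^ 2 := by nlinarith [sq_nonneg σ]
    gcongr
  simp only [integral_const, probReal_univ, one_smul]
  nlinarith

end Gaussian

/-! ### The gradient of the thresholded network -/

section secondStep
variable {k d : ℕ}

/-- The contribution of a sample to the gradient in the second step when all noise in the other
patches is thresholded: `u` is the current weight vector of patch `i` and `b` the bias. -/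
noncomputable def signalGrad (b : ℝ) (w : EuclideanSpace ℝ (Fin d)) (σ : ℝ)
    (u : EuclideanSpace ℝ (Fin d)) (i : Fin k)
    (ω : Fin k × EuclideanSpace ℝ (Fin k × Fin d)) : EuclideanSpace ℝ (Fin d) :=
  if ω.1 = i then
    (1 - inner ℝ u w + b - σ * inner ℝ u (patch ω.2 i)) • (w + σ • patch ω.2 i) else 0

/-- Joint measurability in `u` is needed because the current weight depends on the initialization
and on the first batch. -/
theorem measurable_signalGrad_uncurry (b : ℝ) (w : EuclideanSpace ℝ (Fin d)) (σ : ℝ) (i : Fin k) :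
    Measurable fun p : EuclideanSpace ℝ (Fin d) × (Fin k × EuclideanSpace ℝ (Fin k × Fin d)) =>
      signalGrad b w σ p.1 i p.2 := by
  unfold signalGrad
  refine Measurable.ite ?_ (by fun_prop) (by fun_prop)
  exact (measurable_fst.comp measurable_snd) (measurableSet_singleton i)

theorem measurable_signalGrad (b : ℝ) (w : EuclideanSpace ℝ (Fin d)) (σ : ℝ)
    (u : EuclideanSpace ℝ (Fin d)) (i : Fin k) : Measurable (signalGrad b w σ u i) :=
  (measurable_signalGrad_uncurry b w σ i).comp (measurable_const.prodMk measurable_id)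

theorem signalGrad_apply (b : ℝ) (w : EuclideanSpace ℝ (Fin d)) (σ : ℝ)
    (u : EuclideanSpace ℝ (Fin d)) (i i' : Fin k) (ξ : EuclideanSpace ℝ (Fin k × Fin d))
    (a : Fin d) : signalGrad b w σ u i (i', ξ) a
      = if i' = i then (1 - inner ℝ u w + b - σ * inner ℝ (signalMean u i) ξ) *
        (w a + σ * inner ℝ (signalMean (EuclideanSpace.single a (1 : ℝ)) i) ξ) else 0 := by
  rw [signalGrad, inner_signalMean, inner_signalMean]
  by_cases h : i' = i
  · simp [h, EuclideanSpace.inner_single_left]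
    ring
  · simp [h]

/-- Each coordinate is a product of two affine functions of the noise, present with probability `1 /
k`. The second moment carries the same factor `(1 - ⟪u, w⟫ + b)²` as the square of the signal part
of the mean, so the relative error does not depend on how well `u` is aligned. -/
theorem lintegral_normSq_mean_signalGrad_le [NeZero k] {b : ℝ} {w : EuclideanSpace ℝ (Fin d)}
    (hw : ‖w‖ = 1) {σ : ℝ} (hσ : 0 ≤ σ) {u : EuclideanSpace ℝ (Fin d)} (hu : ‖u‖ ≤ 1)
    (hρ : σ ≤ 1 - inner ℝ u w + b) (i : Fin k) {N : ℕ} (hN : 0 < N) :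
    ∫⁻ S : NoiseBatch k d N, ENNReal.ofReal (‖(1 / (N : ℝ)) • ∑ j, signalGrad b w σ u i (S j) -
        (1 / (k : ℝ)) • ((1 - inner ℝ u w + b) • w - σ ^ 2 • u)‖ ^ 2)
      ∂(Measure.pi fun _ => signalNoise k d)
      ≤ ENNReal.ofReal
        ((1 / (k : ℝ) * (4 * (1 - inner ℝ u w + b) ^ 2 * (2 + 97 * σ ^ 2 * d))) / N) := by
  set ρ := 1 - inner ℝ u w + b with hρdef
  have hm := measurable_signalGrad b w σ u i
  have hint : ∀ (a : Fin d) (i' : Fin k), Integrable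
      (fun ξ => signalGrad b w σ u i (i', ξ) a ^ 2) (stdGaussian _) := by
    intro a i'
    simp_rw [signalGrad_apply]
    by_cases h : i' = i
    · simp only [h, if_true]; exact integrable_affine_mul_affine_sq _ _ _ _ _
    · simp [h]
  have hLp : ∀ (a : Fin d) (i' : Fin k), MemLp
      (fun ξ => signalGrad b w σ u i (i', ξ) a) 2 (stdGaussian _) := by
    intro a i'
    refine (memLp_two_iff_integrable_sq ?_).2 (hint a i')
    have h1 : Measurable fun ξ => signalGrad b w σ u i (i', ξ) :=
      hm.comp (measurable_const.prodMk measurable_id)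
    have h2 : Measurable fun ξ => signalGrad b w σ u i (i', ξ) a := by fun_prop
    exact h2.aestronglyMeasurable
  have hns : ∀ a : Fin d, ‖signalMean (EuclideanSpace.single a (1 : ℝ)) i‖ ≤ 1 := by
    intro a; rw [norm_signalMean]; simp
  refine lintegral_normSq_empirical_mean_sub_le (signalNoise k d) hm
    (fun a => memLp_two_signalNoise (by fun_prop) (hLp a)) (fun a => ?_) ?_ hN
  · rw [integral_signalNoise (by fun_prop) fun i' => (hLp a i').integrable (by norm_num)]
    simp_rw [signalGrad_apply]
    rw [Finset.sum_eq_single i]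
    · simp only [if_true]
      rw [integral_affine_mul_affine, inner_signalMean, patch_signalMean, if_pos rfl]
      simp [EuclideanSpace.inner_single_right, ← hρdef]
    · intro i' _ h; simp [h]
    · simp
  · have h1 : ∀ a, ∫ ω, signalGrad b w σ u i ω a ^ 2 ∂(signalNoise k d)
        ≤ 1 / (k : ℝ) * (4 * ρ ^ 2 * (2 * w a ^ 2 + 97 * σ ^ 2)) := by
      intro a
      rw [integral_signalNoise (by fun_prop) (hint a)]
      simp_rw [signalGrad_apply]
      rw [Finset.sum_eq_single i]
      · simp only [if_true]
        gcongr
        exact integral_affine_mul_affine_sq_le hσ hρ _ (by rwa [norm_signalMean]) (hns a)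
      · intro i' _ h; simp [h]
      · simp
    refine (Finset.sum_le_sum fun a _ => h1 a).trans (le_of_eq ?_)
    rw [← Finset.mul_sum, ← Finset.mul_sum, Finset.sum_add_distrib, ← Finset.mul_sum,
      ← EuclideanSpace.real_norm_sq_eq, hw]
    simp only [Finset.sum_const, Finset.card_univ, Fintype.card_fin, nsmul_eq_mul]
    ring

/-- An exponential bound for the number of noise patches exceeding a quarter of the threshold. -/
noncomputable def exceedance {N : ℕ} (s b σ : ℝ) (W : Fin k → EuclideanSpace ℝ (Fin d))
    (S : NoiseBatch k d N) : ℝ :=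
  ∑ j, ∑ i, Real.exp (-(s * b / 4)) * (Real.exp (s * (σ * inner ℝ (W i) (patch (S j).2 i))) +
    Real.exp (-(s * (σ * inner ℝ (W i) (patch (S j).2 i)))))

/-- A single projection of size at least `b / 4` already makes its own summand at least 1, and all
summands are nonnegative. -/
theorem abs_lt_of_exceedance_lt_one {N : ℕ} {s b σ : ℝ} (hs : 0 < s)
    {W : Fin k → EuclideanSpace ℝ (Fin d)} {S : NoiseBatch k d N}
    (h : exceedance s b σ W S < 1) (j : Fin N) (i : Fin k) :
    |σ * inner ℝ (W i) (patch (S j).2 i)| < b / 4 := by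
  by_contra! h1
  set t := σ * inner ℝ (W i) (patch (S j).2 i) with ht
  have h2 : 1 ≤ Real.exp (-(s * b / 4)) * (Real.exp (s * t) + Real.exp (-(s * t))) := by
    have h3 : Real.exp (s * |t|) ≤ Real.exp (s * t) + Real.exp (-(s * t)) := by
      have p1 := Real.exp_pos (s * t)
      have p2 := Real.exp_pos (-(s * t))
      rcases abs_cases t with ⟨e, _⟩ | ⟨e, _⟩ <;> rw [e]
      · linarith
      · rw [mul_neg]; linarith
    calc (1 : ℝ) ≤ Real.exp (-(s * b / 4)) * Real.exp (s * |t|) := by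
          rw [← Real.exp_add]
          apply Real.one_le_exp
          nlinarith
      _ ≤ _ := by gcongr
  have h4 : Real.exp (-(s * b / 4)) * (Real.exp (s * t) + Real.exp (-(s * t)))
      ≤ exceedance s b σ W S := by
    rw [exceedance]
    refine le_trans ?_ (Finset.single_le_sum (f := fun j => ∑ i, Real.exp (-(s * b / 4)) *
      (Real.exp (s * (σ * inner ℝ (W i) (patch (S j).2 i))) +
        Real.exp (-(s * (σ * inner ℝ (W i) (patch (S j).2 i))))))
      (fun j _ => Finset.sum_nonneg fun i _ => by positivity) (Finset.mem_univ j))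
    exact Finset.single_le_sum (f := fun i => Real.exp (-(s * b / 4)) *
      (Real.exp (s * (σ * inner ℝ (W i) (patch (S j).2 i))) +
        Real.exp (-(s * (σ * inner ℝ (W i) (patch (S j).2 i))))))
      (fun i _ => by positivity) (Finset.mem_univ i)
  linarith

/-- Union bound over `N k` Gaussian projections by their moment generating functions. The weights
are fixed here, which suits the fresh second batch. -/
theorem lintegral_exceedance_le [NeZero k] (s b σ : ℝ) {W : Fin k → EuclideanSpace ℝ (Fin d)}
    (hW : ∀ i, ‖W i‖ ≤ 1) (N : ℕ) :
    ∫⁻ S : NoiseBatch k d N, ENNReal.ofReal (exceedance s b σ W S)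
      ∂(Measure.pi fun _ => signalNoise k d)
      ≤ ENNReal.ofReal (2 * N * k * Real.exp (-(s * b / 4) + s ^ 2 * σ ^ 2 / 2)) := by
  set f : Fin k → Fin k × EuclideanSpace ℝ (Fin k × Fin d) → ℝ := fun i ω =>
    Real.exp (-(s * b / 4)) * (Real.exp (s * (σ * inner ℝ (W i) (patch ω.2 i))) +
    Real.exp (-(s * (σ * inner ℝ (W i) (patch ω.2 i))))) with hf
  have hfm : ∀ i, Measurable (f i) := fun i => by fun_prop
  have hf0 : ∀ i ω, 0 ≤ f i ω := fun i ω => by positivity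
  have h1 : ∀ S : NoiseBatch k d N, ENNReal.ofReal (exceedance s b σ W S)
      = ∑ j, ∑ i, ENNReal.ofReal (f i (S j)) := by
    intro S
    rw [exceedance, ENNReal.ofReal_sum_of_nonneg fun j _ => Finset.sum_nonneg fun i _ =>
      hf0 i (S j)]
    refine Finset.sum_congr rfl fun j _ => ?_
    rw [ENNReal.ofReal_sum_of_nonneg fun i _ => hf0 i (S j)]
  have h2 : ∀ i, ∫⁻ ω, ENNReal.ofReal (f i ω) ∂(signalNoise k d)
      ≤ ENNReal.ofReal (2 * Real.exp (-(s * b / 4) + s ^ 2 * σ ^ 2 / 2)) := by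
    intro i
    have hk : (k : ℝ≥0∞) ≠ 0 := by exact_mod_cast NeZero.ne k
    have e : ∀ ξ : EuclideanSpace ℝ (Fin k × Fin d), ∀ i', f i (i', ξ) = Real.exp (-(s * b / 4)) *
        (Real.exp (inner ℝ ((s * σ) • signalMean (W i) i) ξ) +
          Real.exp (inner ℝ (-((s * σ) • signalMean (W i) i)) ξ)) := by
      intro ξ i'
      simp only [hf, inner_neg_left, real_inner_smul_left, inner_signalMean]
      ring_nf
    rw [lintegral_signalNoise _ _ (by fun_prop)]
    simp_rw [e]
    have hint : Integrable (fun ξ => Real.exp (-(s * b / 4)) *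
        (Real.exp (inner ℝ ((s * σ) • signalMean (W i) i) ξ) +
          Real.exp (inner ℝ (-((s * σ) • signalMean (W i) i)) ξ))) (stdGaussian _) :=
      ((integrable_exp_inner_stdGaussian _).add (integrable_exp_inner_stdGaussian _)).const_mul _
    rw [← ofReal_integral_eq_lintegral_ofReal hint
      (Filter.Eventually.of_forall fun ξ => by positivity), integral_const_mul,
      integral_add (integrable_exp_inner_stdGaussian _) (integrable_exp_inner_stdGaussian _),
      integral_exp_inner_stdGaussian, integral_exp_inner_stdGaussian, norm_neg, Finset.sum_const,
      Finset.card_univ, Fintype.card_fin, nsmul_eq_mul, ← mul_assoc,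
      ENNReal.inv_mul_cancel hk (by simp), one_mul]
    apply ENNReal.ofReal_le_ofReal
    have : Real.exp (‖(s * σ) • signalMean (W i) i‖ ^ 2 / 2) ≤ Real.exp (s ^ 2 * σ ^ 2 / 2) := by
      apply Real.exp_le_exp.2
      rw [norm_smul, norm_signalMean, mul_pow, Real.norm_eq_abs, sq_abs]
      have : ‖W i‖ ^ 2 ≤ 1 := by nlinarith [hW i, norm_nonneg (W i)]
      nlinarith [sq_nonneg (s * σ)]
    rw [Real.exp_add]
    nlinarith [Real.exp_pos (-(s * b / 4))]
  simp_rw [h1]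
  rw [lintegral_finsetSum _ fun j _ => by fun_prop]
  calc _ ≤ ∑ _j : Fin N, ∑ _i : Fin k,
        ENNReal.ofReal (2 * Real.exp (-(s * b / 4) + s ^ 2 * σ ^ 2 / 2)) := by
        refine Finset.sum_le_sum fun j _ => ?_
        rw [lintegral_finsetSum _ fun i _ => by fun_prop]
        refine Finset.sum_le_sum fun i _ => ?_
        exact ((measurePreserving_eval (fun _ : Fin N => signalNoise k d) j).lintegral_comp
          (f := fun ω => ENNReal.ofReal (f i ω)) (by fun_prop)).trans_le (h2 i)
    _ = _ := by
        simp only [Finset.sum_const, Finset.card_univ, Fintype.card_fin, nsmul_eq_mul]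
        rw [← ENNReal.ofReal_natCast N, ← ENNReal.ofReal_natCast k,
          ← ENNReal.ofReal_mul (by positivity), ← ENNReal.ofReal_mul (by positivity)]
        ring_nf

/-- The active preactivation is at least `2 b - b / 4 > b`, while patches without signal stay below
`b / 4`, so no kink is met. Correlation with `w` is needed in patch `i` only: for a sample with
signal elsewhere the derivative in patch `i` vanishes, whatever its residual. -/
theorem gradWeight_second_eq {N : ℕ} {v : LCNParam k d} {w : EuclideanSpace ℝ (Fin d)}
    {σ : ℝ} {S : NoiseBatch k d N} {i : Fin k} (hb : 0 < bias v)
    (hS : ∀ j i', |σ * inner ℝ (weight v i') (patch (S j).2 i')| < bias v / 4)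
    (hi : 2 * bias v ≤ inner ℝ (weight v i) w) :
    gradWeight v (positiveSample w σ S) i
      = -(2 : ℝ) • (1 / (N : ℝ)) • ∑ j, signalGrad (bias v) w σ (weight v i) i (S j) := by
  have hin : ∀ j i', inner ℝ (weight v i') (patch (noisySignal w σ (S j)) i')
      = (if (S j).1 = i' then inner ℝ (weight v i') w else 0)
        + σ * inner ℝ (weight v i') (patch (S j).2 i') := by
    intro j i'
    have h := inner_patch_noisySignal (weight v i') w σ (S j).1 (S j).2 i'
    rwa [inner_signalMean] at h
  rw [gradWeight_eq v _ i (s := fun j => if (S j).1 = i then 1 else 0) fun j => ?_]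
  · congr 2
    refine Finset.sum_congr rfl fun j _ => ?_
    by_cases h : (S j).1 = i
    · have e1 : lcn v (noisySignal w σ (S j)) = inner ℝ (weight v i) w
          + σ * inner ℝ (weight v i) (patch (S j).2 i) - bias v := by
        rw [lcn, Finset.sum_eq_single i]
        · rw [hin, if_pos h, lsa_of_le hb.le]
          have := abs_lt.1 (hS j i)
          linarith
        · intro i' _ h'
          rw [hin, if_neg (fun e => h' (e.symm.trans h)), zero_add]
          exact lsa_of_abs_le ((hS j i').le.trans (by linarith))
        · simp
      simp only [positiveSample, e1, signalGrad, h, if_true, patch_noisySignal]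
      congr 1
      ring
    · simp [signalGrad, h]
  · simp only [positiveSample]
    rw [hin]
    have := abs_lt.1 (hS j i)
    by_cases h : (S j).1 = i
    · simp only [h, if_true]
      exact hasDerivAt_lsa_of_lt hb.le (by linarith)
    · simp only [h, if_false, zero_add]
      exact hasDerivAt_lsa_of_abs_lt ((hS j i).trans (by linarith))

/-- The step is compared with `M • w`, where `M = 2 η ρ / k`. Three errors are each at most `τ M`:
the old weight since `η` is large, the bias `σ² u` of the mean gradient since `σ²` is small, and the
sampling error. Normalization doubles `3 τ`. -/
theorem norm_second_weight_sub_le {N : ℕ} {v : LCNParam k d} {w : EuclideanSpace ℝ (Fin d)}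
    (hw : ‖w‖ = 1) {σ : ℝ} {S : NoiseBatch k d N} {i : Fin k} (hb : 0 < bias v)
    (hv : ‖weight v i‖ ≤ 1)
    (hS : ∀ j i', |σ * inner ℝ (weight v i') (patch (S j).2 i')| < bias v / 4)
    (hi : 2 * bias v ≤ inner ℝ (weight v i) w) {η τ : ℝ} (hk : 0 < k)
    (hτ : 0 < τ) (hη : k / (2 * τ * bias v) ≤ η) (hσ : σ ^ 2 ≤ τ * bias v)
    (h : k * ‖(1 / (N : ℝ)) • ∑ j, signalGrad (bias v) w σ (weight v i) i (S j) -
        (1 / (k : ℝ)) • ((1 - inner ℝ (weight v i) w + bias v) • w - σ ^ 2 • weight v i)‖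
      ≤ τ * (1 - inner ℝ (weight v i) w + bias v)) (b : ℝ) :
    ‖weight (projGradStep η b v (positiveSample w σ S)) i - w‖ ≤ 6 * τ := by
  have hk' : (0 : ℝ) < k := by exact_mod_cast hk
  rw [weight_projGradStep, gradWeight_second_eq hb hS hi]
  set u := weight v i
  set c := bias v
  set ρ := 1 - inner ℝ u w + c with hρ
  set H := (1 / (N : ℝ)) • ∑ j, signalGrad c w σ u i (S j)
  have hρc : c ≤ ρ := by
    have := (real_inner_le_norm u w)
    rw [hw, mul_one] at this
    linarith
  have hη0 : 0 < η := lt_of_lt_of_le (by positivity) hη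
  have hρ0 : 0 < ρ := hb.trans_le hρc
  have hM : 0 < 2 * η * ρ / k := by positivity
  have e : u - η • (-(2 : ℝ)) • H - (2 * η * ρ / k) • w
      = u - (2 * η * σ ^ 2 / k) • u
        + (2 * η) • (H - (1 / (k : ℝ)) • (ρ • w - σ ^ 2 • u)) := by
    module
  refine (norm_normalize_sub_le (ε := 3 * τ) hw hM ?_).trans (by linarith)
  rw [e]
  have h1 : 1 ≤ τ * (2 * η * ρ / k) := by
    rw [div_le_iff₀ (by positivity)] at hη
    rw [mul_div_assoc', le_div_iff₀ hk', one_mul]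
    have : η * (2 * τ * c) ≤ η * (2 * τ * ρ) := by gcongr
    linarith
  have h2 : 2 * η * σ ^ 2 / k ≤ τ * (2 * η * ρ / k) := by
    rw [mul_div_assoc', div_le_div_iff_of_pos_right hk']
    have : σ ^ 2 ≤ τ * ρ := hσ.trans (by gcongr)
    nlinarith
  have h3 : 2 * η * ‖H - (1 / (k : ℝ)) • (ρ • w - σ ^ 2 • u)‖ ≤ τ * (2 * η * ρ / k) := by
    rw [mul_div_assoc', le_div_iff₀ hk']
    nlinarith
  calc _ ≤ ‖u‖ + ‖(2 * η * σ ^ 2 / k) • u‖ +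
        ‖(2 * η) • (H - (1 / (k : ℝ)) • (ρ • w - σ ^ 2 • u))‖ :=
        (norm_add_le _ _).trans (add_le_add_left (norm_sub_le _ _) _)
    _ ≤ 1 + 2 * η * σ ^ 2 / k + 2 * η * ‖H - (1 / (k : ℝ)) • (ρ • w - σ ^ 2 • u)‖ := by
        rw [norm_smul, norm_smul, Real.norm_eq_abs, Real.norm_eq_abs,
          abs_of_nonneg (by positivity), abs_of_nonneg (by positivity)]
        have : 2 * η * σ ^ 2 / k * ‖u‖ ≤ 2 * η * σ ^ 2 / k * 1 := by gcongr
        linarith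
    _ ≤ _ := by linarith

/-- With zero bias the second gradient is at most a polynomial in the size of the inputs. -/
theorem norm_gradWeight_le {N : ℕ} {v : LCNParam k d} (hb : bias v = 0)
    (hv : ∀ i, ‖weight v i‖ ≤ 1) (w : EuclideanSpace ℝ (Fin d)) (σ : ℝ)
    (S : NoiseBatch k d N) (i : Fin k) (hN : 0 < N) :
    ‖gradWeight v (positiveSample w σ S) i‖
      ≤ 2 * (k + 1) * (1 + 1 / (N : ℝ) * ∑ j, ‖noisySignal w σ (S j)‖ ^ 2) := by
  have hN' : (N : ℝ) ≠ 0 := by positivity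
  have h1 : ∀ x, |lcn v x| ≤ k * ‖x‖ := by
    intro x
    rw [lcn_of_bias_eq_zero hb]
    refine (Finset.abs_sum_le_sum_abs _ _).trans ?_
    calc _ ≤ ∑ _i : Fin k, ‖x‖ := by
          refine Finset.sum_le_sum fun i _ => (abs_real_inner_le_norm _ _).trans ?_
          have := mul_le_mul (hv i) (norm_patch_le x i) (norm_nonneg _) zero_le_one
          linarith
      _ = _ := by simp
  rw [gradWeight_of_bias_eq_zero hb, norm_smul, norm_smul, norm_neg, Real.norm_eq_abs,
    Real.norm_eq_abs, abs_of_pos two_pos, abs_of_nonneg (by positivity), mul_assoc]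
  refine mul_le_mul_of_nonneg_left ?_ two_pos.le
  calc _ ≤ 1 / (N : ℝ) * ∑ j, ((k : ℝ) + 1) * (1 + ‖noisySignal w σ (S j)‖ ^ 2) := by
        gcongr
        refine (norm_sum_le _ _).trans (Finset.sum_le_sum fun j _ => ?_)
        simp only [positiveSample]
        set x := noisySignal w σ (S j)
        have h2 : |1 - lcn v x| ≤ 1 + k * ‖x‖ := by
          refine (abs_sub _ _).trans ?_
          rw [abs_one]; linarith [h1 x]
        rw [norm_smul, Real.norm_eq_abs]
        calc _ ≤ (1 + k * ‖x‖) * ‖x‖ :=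
              mul_le_mul h2 (norm_patch_le _ _) (norm_nonneg _) (by positivity)
          _ ≤ _ := by
              have : (0 : ℝ) ≤ k := Nat.cast_nonneg k
              nlinarith [sq_nonneg (‖x‖ - 1), norm_nonneg x]
    _ = _ := by
        rw [← Finset.mul_sum, Finset.sum_add_distrib]
        simp only [Finset.sum_const, Finset.card_univ, Fintype.card_fin, nsmul_eq_mul, mul_one]
        field_simp

end secondStep

/-! The expected risk after training -/

/-- The pointwise form of Markov's inequality: the trivial bound 4 is paid only where the error sum
`X` reaches 1. -/
theorem le_add_four_mul {q c X : ℝ≥0∞} (hq : q ≤ 4) (h : X < 1 → q ≤ c) : q ≤ c + 4 * X := by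
  rcases lt_or_ge X 1 with hX | hX
  · exact (h hX).trans le_self_add
  · calc q ≤ 4 * 1 := by simpa using hq
      _ ≤ 4 * X := by gcongr
      _ ≤ _ := le_add_self

/-- The bound on `f₃` is uniform in the initialization and the first batch, so the second batch can
be integrated out first. Measurability of `f₁` alone is enough to split the sums. -/
theorem lintegral_triple_le {α β κ : Type*} [MeasurableSpace α] [MeasurableSpace β]
    [MeasurableSpace κ] {P : Measure α} {Q : Measure β} {M : Measure κ} [IsProbabilityMeasure P]
    [IsProbabilityMeasure Q] [IsProbabilityMeasure M] (c : ℝ≥0∞) {f₁ : β → ℝ≥0∞}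
    {f₂ : α → β → ℝ≥0∞} {f₃ : α → β → κ → ℝ≥0∞} (hf₁ : Measurable f₁) {δ₁ δ₂ δ₃ : ℝ≥0∞}
    (h₁ : ∫⁻ y, f₁ y ∂Q ≤ δ₁) (h₂ : ∫⁻ x, ∫⁻ y, f₂ x y ∂Q ∂P ≤ δ₂)
    (h₃ : ∀ x y, ∫⁻ z, f₃ x y z ∂M ≤ δ₃) :
    ∫⁻ x, ∫⁻ y, ∫⁻ z, (c + 4 * (f₁ y + f₂ x y + f₃ x y z)) ∂M ∂Q ∂P
      ≤ c + 4 * (δ₁ + δ₂ + δ₃) := by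
  calc _ ≤ ∫⁻ x, ∫⁻ y, ((c + 4 * δ₃) + 4 * (f₁ y + f₂ x y)) ∂Q ∂P := by
        refine lintegral_mono fun x => lintegral_mono fun y => ?_
        dsimp only
        rw [lintegral_add_left measurable_const, lintegral_const_mul' _ _ (by simp),
          lintegral_add_left measurable_const]
        simp only [lintegral_const, measure_univ, mul_one]
        calc _ ≤ c + 4 * (f₁ y + f₂ x y + δ₃) := by gcongr; exact h₃ x y
          _ = _ := by ring
    _ ≤ ∫⁻ x, ((c + 4 * δ₃ + 4 * δ₁) + 4 * ∫⁻ y, f₂ x y ∂Q) ∂P := by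
        refine lintegral_mono fun x => ?_
        dsimp only
        rw [lintegral_add_left measurable_const, lintegral_const_mul' _ _ (by simp),
          lintegral_add_left hf₁]
        simp only [lintegral_const, measure_univ, mul_one]
        rw [add_assoc _ (4 * δ₁), ← mul_add 4 δ₁]
        gcongr
    _ ≤ _ := by
        rw [lintegral_add_left measurable_const, lintegral_const_mul' _ _ (by simp)]
        simp only [lintegral_const, measure_univ, mul_one]
        calc _ ≤ c + 4 * δ₃ + 4 * δ₁ + 4 * δ₂ := by gcongr
          _ = _ := by ring

theorem lintegral_ofReal_const_mul {α : Type*} [MeasurableSpace α] {P : Measure α} {c V : ℝ}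
    (hc : 0 ≤ c) {f : α → ℝ} (h : ∫⁻ x, ENNReal.ofReal (f x) ∂P ≤ ENNReal.ofReal V) :
    ∫⁻ x, ENNReal.ofReal (c * f x) ∂P ≤ ENNReal.ofReal (c * V) := by
  simp_rw [ENNReal.ofReal_mul hc]
  rw [lintegral_const_mul' _ _ ENNReal.ofReal_ne_top]
  gcongr

theorem normSq_normalize_sub_le {d : ℕ} {w : EuclideanSpace ℝ (Fin d)} (hw : ‖w‖ = 1)
    (u : EuclideanSpace ℝ (Fin d)) :
    ENNReal.ofReal (‖‖u‖⁻¹ • u - w‖ ^ 2) ≤ 4 := by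
  have h1 : ‖‖u‖⁻¹ • u - w‖ ≤ 2 := by
    refine (norm_sub_le _ _).trans ?_
    linarith [norm_inv_norm_smul_le u]
  calc _ ≤ ENNReal.ofReal 4 := by
        apply ENNReal.ofReal_le_ofReal
        nlinarith [norm_nonneg (‖u‖⁻¹ • u - w)]
    _ = 4 := by simp

theorem lt_one_of_ofReal_le {x : ℝ} {X : ℝ≥0∞} (h : ENNReal.ofReal x ≤ X) (hX : X < 1) : x < 1 := by
  have := h.trans_lt hX
  rwa [← ENNReal.ofReal_one, ENNReal.ofReal_lt_ofReal_iff zero_lt_one] at this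

/-! ### Expected risk with and without thresholding in the second step -/

section training
variable {k d n : ℕ}

/-- The distance of the empirical gradient of the second step from its mean. -/
noncomputable def gradError {N : ℕ} (b : ℝ) (w : EuclideanSpace ℝ (Fin d)) (σ : ℝ)
    (u : EuclideanSpace ℝ (Fin d)) (i : Fin k) (S : NoiseBatch k d N) : ℝ :=
  ‖(1 / (N : ℝ)) • ∑ j, signalGrad b w σ u i (S j) -
    (1 / (k : ℝ)) • ((1 - inner ℝ u w + b) • w - σ ^ 2 • u)‖

theorem measurable_gradError {N : ℕ} (γ : ℝ≥0) (b : ℝ) (w : EuclideanSpace ℝ (Fin d)) (σ : ℝ)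
    (i : Fin k) : Measurable fun p : EuclideanSpace ℝ (Fin k × Fin d) × NoiseBatch k d N ×
      NoiseBatch k d N => gradError b w σ (firstWeight γ w σ p.1 p.2.1 i) i p.2.2 := by
  have h1 : Measurable fun p : EuclideanSpace ℝ (Fin k × Fin d) × NoiseBatch k d N ×
      NoiseBatch k d N => firstWeight γ w σ p.1 p.2.1 i :=
    (measurable_firstWeight γ w σ i).comp (f := fun p : EuclideanSpace ℝ (Fin k × Fin d) ×
      NoiseBatch k d N × NoiseBatch k d N => (p.1, p.2.1)) (by fun_prop)
  have h2 : ∀ j, Measurable fun p : EuclideanSpace ℝ (Fin k × Fin d) × NoiseBatch k d N ×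
      NoiseBatch k d N => signalGrad b w σ (firstWeight γ w σ p.1 p.2.1 i) i (p.2.2 j) :=
    fun j => (measurable_signalGrad_uncurry b w σ i).comp (h1.prodMk (by fun_prop))
  unfold gradError
  fun_prop

variable [NeZero k]

/-- The expected risk when the threshold of the first step removes the noise patches. -/
theorem expectedRisk_le_of_threshold {γ : ℝ≥0} {η : Fin 2 → ℝ} {b : Fin 2 → ℝ≥0}
    {w : EuclideanSpace ℝ (Fin d)} (hw : ‖w‖ = 1) {σ δ s₀ s₁ : ℝ} (hη : η 0 = 1 / 2)
    (hb : 0 < (b 0 : ℝ)) (hb' : (b 0 : ℝ) ≤ 1 / 8) (hσ : 0 ≤ σ) (hσb : σ ≤ b 0)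
    (hσb' : σ ^ 2 ≤ 1 / 1000 * b 0) (hη' : k / (2 * (1 / 1000) * b 0) ≤ η 1) (hN : 0 < n / 2)
    (hs₀ : 0 < s₀) (hs₁ : 0 < s₁)
    (h1 : (8 * b 0 * k) ^ 2 * ((1 / k + σ ^ 2 * d) / (n / 2 : ℕ)) ≤ δ)
    (h2 : (8 * k) ^ 2 * ((1 / k + σ ^ 2) / (n / 2 : ℕ)) ≤ δ)
    (h3 : 8 * k * (√(γ : ℝ) * (1 + k * d) * (3 + 2 * σ ^ 2 * (k * d))) ≤ δ)
    (h4 : 2 * (n / 2 : ℕ) * k * Real.exp (-(s₀ * b 0 / 4) + s₀ ^ 2 * σ ^ 2 / 2) ≤ δ)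
    (h5 : 1000000 * k * (4 * (2 + 97 * σ ^ 2 * d)) / (n / 2 : ℕ) ≤ δ) :
    (lcnAlgorithm k d γ η b).expectedRisk (DSD k d w σ) n
      ≤ ENNReal.ofReal (6 * σ ^ 2 + 6 * (b 1 : ℝ) ^ 2 + 8 * (k : ℝ) ^ 2 / s₁ ^ 2 *
        Real.exp (-(s₁ * b 1) + s₁ ^ 2 * σ ^ 2 / 2) + 6 * (36 / 1000000 + 20 * δ)) := by
  have hk : 0 < k := Nat.pos_of_ne_zero (NeZero.ne k)
  have hk' : (0 : ℝ) < k := by exact_mod_cast hk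
  have hδ : 0 ≤ δ := le_trans (by positivity) h4
  set c : ℝ := ((b 0 : ℝ≥0) : ℝ) with hc
  -- The error terms are scaled so that being below 1 gives exactly the smallness conditions of
  -- `le_inner_firstWeight`, `abs_lt_of_exceedance_lt_one` and `norm_second_weight_sub_le`.
  set f₁ : Fin k → NoiseBatch k d (n / 2) → ℝ≥0∞ := fun i S₁ =>
    ENNReal.ofReal ((8 * c * k) ^ 2 * ‖patchMean w σ S₁ i - (1 / (k : ℝ)) • w‖ ^ 2) +
    ENNReal.ofReal ((8 * k) ^ 2 *
      inner ℝ w (patchMean w σ S₁ i - (1 / (k : ℝ)) • w) ^ 2) with hf₁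
  set f₂ : EuclideanSpace ℝ (Fin k × Fin d) → NoiseBatch k d (n / 2) → ℝ≥0∞ := fun w₀ S₁ =>
    ENNReal.ofReal (8 * k * initEffect γ w σ w₀ S₁) with hf₂
  set f₃ : Fin k → EuclideanSpace ℝ (Fin k × Fin d) → NoiseBatch k d (n / 2) →
      NoiseBatch k d (n / 2) → ℝ≥0∞ := fun i w₀ S₁ S₂ =>
    ENNReal.ofReal (exceedance s₀ c σ (firstWeight γ w σ w₀ S₁) S₂) +
    ENNReal.ofReal ((1000 * k / (1 - inner ℝ (firstWeight γ w σ w₀ S₁ i) w + c)) ^ 2 *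
      gradError c w σ (firstWeight γ w σ w₀ S₁ i) i S₂ ^ 2) with hf₃
  have m1 : ∀ i, Measurable fun S₁ : NoiseBatch k d (n / 2) => patchMean w σ S₁ i := by
    intro i; unfold patchMean; fun_prop
  have mf1 : ∀ i, Measurable (f₁ i) := by
    intro i
    have := m1 i
    fun_prop
  have m2 : Measurable fun p : EuclideanSpace ℝ (Fin k × Fin d) × NoiseBatch k d (n / 2) ×
      NoiseBatch k d (n / 2) => f₂ p.1 p.2.1 := by
    simp only [hf₂, initEffect]
    fun_prop
  have m4 : ∀ i, Measurable fun p : EuclideanSpace ℝ (Fin k × Fin d) × NoiseBatch k d (n / 2) ×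
      NoiseBatch k d (n / 2) => firstWeight γ w σ p.1 p.2.1 i := fun i =>
    (measurable_firstWeight γ w σ i).comp (f := fun p : EuclideanSpace ℝ (Fin k × Fin d) ×
      NoiseBatch k d (n / 2) × NoiseBatch k d (n / 2) => (p.1, p.2.1)) (by fun_prop)
  have m3e : Measurable fun p : EuclideanSpace ℝ (Fin k × Fin d) × NoiseBatch k d (n / 2) ×
      NoiseBatch k d (n / 2) => exceedance s₀ c σ (firstWeight γ w σ p.1 p.2.1) p.2.2 := by
    unfold exceedance
    fun_prop
  have m3 : ∀ i, Measurable fun p : EuclideanSpace ℝ (Fin k × Fin d) × NoiseBatch k d (n / 2) ×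
      NoiseBatch k d (n / 2) => f₃ i p.1 p.2.1 p.2.2 := by
    intro i
    have e1 := measurable_gradError (N := n / 2) γ c w σ i
    have e2 := m4 i
    simp only [hf₃]
    fun_prop
  -- The value `36 / 1000000` is `(6 τ)²` with `τ = 1 / 1000`.
  refine expectedRisk_le_of_weight γ η b hw σ (D := fun i w₀ S₁ S₂ =>
    ENNReal.ofReal (36 / 1000000) + 4 * (f₁ i S₁ + f₂ w₀ S₁ + f₃ i w₀ S₁ S₂))
    (fun i => ?_) (fun i w₀ S₁ S₂ => ?_) (by positivity) (fun i => ?_) hs₁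
  · exact (((((mf1 i).comp (measurable_fst.comp measurable_snd)).add m2).add
      (m3 i)).const_mul 4).const_add _
  · refine le_add_four_mul ?_ fun hX => ?_
    · rw [trainedParam, weight_projGradStep]
      exact normSq_normalize_sub_le hw _
    · have x1 := lt_one_of_ofReal_le (le_self_add.trans (le_self_add.trans le_self_add)) hX
      have x2 := lt_one_of_ofReal_le (le_add_self.trans (le_self_add.trans le_self_add)) hX
      have x3 := lt_one_of_ofReal_le (le_add_self.trans le_self_add) hX
      have x4 := lt_one_of_ofReal_le (le_self_add.trans le_add_self) hX
      have x5 := lt_one_of_ofReal_le (le_add_self.trans le_add_self) hX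
      set v := projGradStep (η 0) (b 0) (mkParam (patch (√(γ : ℝ) • w₀)) 0)
        (positiveSample w σ S₁) with hv
      have hbias : bias v = c := bias_projGradStep _ _ _ _
      have hweight : weight v = firstWeight γ w σ w₀ S₁ := by
        funext i'
        rw [hv, hη]
        exact weight_first_projGradStep γ w σ _ w₀ S₁ i'
      have hle := norm_firstWeight_le γ w σ w₀ S₁
      rw [← mul_pow, sq_lt_one_iff_abs_lt_one] at x1 x2 x5
      have hα : 2 * c ≤ inner ℝ (firstWeight γ w σ w₀ S₁ i) w := by
        refine le_inner_firstWeight hw hk hb hb' ((le_abs_self _).trans x1.le) x3.le ?_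
        rw [abs_mul, abs_of_nonneg (by positivity)] at x2
        exact x2.le
      have hρ : 0 < 1 - inner ℝ (firstWeight γ w σ w₀ S₁ i) w + c := by
        have := real_inner_le_norm (firstWeight γ w σ w₀ S₁ i) w
        rw [hw, mul_one] at this
        linarith [hle i]
      have hfin : ‖weight (projGradStep (η 1) (b 1) v (positiveSample w σ S₂)) i - w‖
          ≤ 6 * (1 / 1000) := by
        refine norm_second_weight_sub_le hw ?_ ?_ ?_ ?_ hk (by norm_num) ?_ ?_ ?_ _
        · rw [hbias]; exact hb
        · rw [hweight]; exact hle i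
        · rw [hbias, hweight]
          exact abs_lt_of_exceedance_lt_one hs₀ x4
        · rw [hbias, hweight]; exact hα
        · rw [hbias]; exact hη'
        · rw [hbias]; exact hσb'
        · rw [hbias, hweight]
          have := (le_abs_self _).trans x5.le
          rw [div_mul_eq_mul_div, div_le_one hρ] at this
          change k * gradError c w σ (firstWeight γ w σ w₀ S₁ i) i S₂ ≤ _
          linarith
      apply ENNReal.ofReal_le_ofReal
      rw [trainedParam, ← hv]
      nlinarith [norm_nonneg (weight (projGradStep (η 1) (b 1) v (positiveSample w σ S₂)) i - w)]
  -- The first and third terms each consist of two errors of mean at most `δ`, hence `20 δ = 4 (2 δ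
  -- + δ + 2 δ)`.
  · refine (lintegral_triple_le _ (mf1 i) (δ₁ := ENNReal.ofReal (2 * δ)) (δ₂ := ENNReal.ofReal δ)
      (δ₃ := ENNReal.ofReal (2 * δ)) ?_ ?_ fun w₀ S₁ => ?_).trans ?_
    · have := m1 i
      rw [lintegral_add_left (by fun_prop), two_mul, ENNReal.ofReal_add hδ hδ]
      exact add_le_add ((lintegral_ofReal_const_mul (sq_nonneg _)
        (lintegral_normSq_patchMean_le hw σ hN i)).trans (ENNReal.ofReal_le_ofReal h1))
        ((lintegral_ofReal_const_mul (sq_nonneg _)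
        (lintegral_sq_inner_patchMean_le hw σ hN i)).trans (ENNReal.ofReal_le_ofReal h2))
    · have e : (0 : ℝ) ≤ 8 * k := by positivity
      simp_rw [hf₂, ENNReal.ofReal_mul e]
      simp_rw [lintegral_const_mul' _ _ ENNReal.ofReal_ne_top]
      refine le_trans ?_ (ENNReal.ofReal_le_ofReal h3)
      rw [ENNReal.ofReal_mul e]
      gcongr
      exact lintegral_initEffect_le γ hw σ hN
    · have hle := norm_firstWeight_le γ w σ w₀ S₁
      have e0 : Measurable fun S₂ : NoiseBatch k d (n / 2) =>
          exceedance s₀ c σ (firstWeight γ w σ w₀ S₁) S₂ :=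
        by unfold exceedance; fun_prop
      have hρ : c ≤ 1 - inner ℝ (firstWeight γ w σ w₀ S₁ i) w + c := by
        have := real_inner_le_norm (firstWeight γ w σ w₀ S₁ i) w
        rw [hw, mul_one] at this
        linarith [hle i]
      rw [hf₃]
      dsimp only
      rw [lintegral_add_left (by fun_prop), two_mul, ENNReal.ofReal_add hδ hδ]
      refine add_le_add ((lintegral_exceedance_le s₀ c σ hle _).trans
        (ENNReal.ofReal_le_ofReal h4)) ((lintegral_ofReal_const_mul (sq_nonneg _)
        (lintegral_normSq_mean_signalGrad_le hw hσ (hle i) (hσb.trans hρ) i hN)).trans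
        (ENNReal.ofReal_le_ofReal (le_trans (le_of_eq ?_) h5)))
      -- The scale `1000 k / ρ` cancels the factor `ρ²` of the gradient variance, so the bound is
      -- uniform in the outcome of the first step.
      have hρ0 : 1 - inner ℝ (firstWeight γ w σ w₀ S₁ i) w + c ≠ 0 := (hb.trans_le hρ).ne'
      have hNn : ((n / 2 : ℕ) : ℝ) ≠ 0 := by positivity
      field_simp
      norm_num
    · rw [← ENNReal.ofReal_add (by positivity) hδ, ← ENNReal.ofReal_add (by positivity)
        (by positivity), ENNReal.ofReal_add (p := 36 / 1000000) (by norm_num) (by positivity)]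
      gcongr
      rw [← ENNReal.ofReal_ofNat, ← ENNReal.ofReal_mul (by norm_num)]
      apply ENNReal.ofReal_le_ofReal
      linarith

/-- The expected risk when the first step already finds the signal and the second step is small. -/
theorem expectedRisk_le_of_linear {γ : ℝ≥0} {η : Fin 2 → ℝ} {b : Fin 2 → ℝ≥0}
    {w : EuclideanSpace ℝ (Fin d)} (hw : ‖w‖ = 1) {σ δ s₁ : ℝ} (hη : η 0 = 1 / 2)
    (hb : b 0 = 0) (hη' : 0 ≤ η 1) (hN : 0 < n / 2) (hs₁ : 0 < s₁)
    (h1 : (1000 * k) ^ 2 * ((1 / k + σ ^ 2 * d) / (n / 2 : ℕ)) ≤ δ)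
    (h2 : 1000 * k * (√(γ : ℝ) * (1 + k * d) * (3 + 2 * σ ^ 2 * (k * d))) ≤ δ)
    (h3 : 2000 * η 1 * (k + 1) * (3 + 2 * σ ^ 2 * (k * d)) ≤ δ) :
    (lcnAlgorithm k d γ η b).expectedRisk (DSD k d w σ) n
      ≤ ENNReal.ofReal (6 * σ ^ 2 + 6 * (b 1 : ℝ) ^ 2 + 8 * (k : ℝ) ^ 2 / s₁ ^ 2 *
        Real.exp (-(s₁ * b 1) + s₁ ^ 2 * σ ^ 2 / 2) + 6 * (100 / 1000000 + 12 * δ)) := by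
  have hk : 0 < k := Nat.pos_of_ne_zero (NeZero.ne k)
  have hk' : (0 : ℝ) < k := by exact_mod_cast hk
  have hδ : 0 ≤ δ := le_trans (by positivity) h3
  set f₁ : Fin k → NoiseBatch k d (n / 2) → ℝ≥0∞ := fun i S₁ =>
    ENNReal.ofReal ((1000 * k) ^ 2 * ‖patchMean w σ S₁ i - (1 / (k : ℝ)) • w‖ ^ 2) with hf₁
  set f₂ : EuclideanSpace ℝ (Fin k × Fin d) → NoiseBatch k d (n / 2) → ℝ≥0∞ := fun w₀ S₁ =>
    ENNReal.ofReal (1000 * k * initEffect γ w σ w₀ S₁) with hf₂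
  set f₃ : NoiseBatch k d (n / 2) → ℝ≥0∞ := fun S₂ =>
    ENNReal.ofReal (2000 * η 1 * (k + 1)) * (1 + ENNReal.ofReal
      (1 / (n / 2 : ℕ) * ∑ j, ‖noisySignal w σ (S₂ j)‖ ^ 2)) with hf₃
  have mf1 : ∀ i, Measurable (f₁ i) := by
    intro i
    simp only [hf₁, patchMean]
    fun_prop
  have m2 : Measurable fun p : EuclideanSpace ℝ (Fin k × Fin d) × NoiseBatch k d (n / 2) ×
      NoiseBatch k d (n / 2) => f₂ p.1 p.2.1 := by
    simp only [hf₂, initEffect]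
    fun_prop
  have m3 : Measurable f₃ := by fun_prop
  refine expectedRisk_le_of_weight γ η b hw σ (D := fun i w₀ S₁ S₂ =>
    ENNReal.ofReal (100 / 1000000) + 4 * (f₁ i S₁ + f₂ w₀ S₁ + f₃ S₂))
    (fun i => ?_) (fun i w₀ S₁ S₂ => ?_) (by positivity) (fun i => ?_) hs₁
  · exact (((((mf1 i).comp (measurable_fst.comp measurable_snd)).add m2).add
      (m3.comp (measurable_snd.comp measurable_snd))).const_mul 4).const_add _
  · refine le_add_four_mul ?_ fun hX => ?_
    · rw [trainedParam, weight_projGradStep]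
      exact normSq_normalize_sub_le hw _
    · have e3 : f₃ S₂ = ENNReal.ofReal (1000 * η 1 * (2 * (k + 1) *
          (1 + 1 / (n / 2 : ℕ) * ∑ j, ‖noisySignal w σ (S₂ j)‖ ^ 2))) := by
        have : (0 : ℝ) ≤ 1 / (n / 2 : ℕ) * ∑ j, ‖noisySignal w σ (S₂ j)‖ ^ 2 :=
          mul_nonneg (by positivity) (Finset.sum_nonneg fun _ _ => sq_nonneg _)
        rw [hf₃]
        dsimp only
        rw [← ENNReal.ofReal_one, ← ENNReal.ofReal_add zero_le_one this,
          ← ENNReal.ofReal_mul (by positivity)]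
        ring_nf
      have x1 := lt_one_of_ofReal_le (le_self_add.trans le_self_add) hX
      have x2 := lt_one_of_ofReal_le (le_add_self.trans le_self_add) hX
      have x3 := lt_one_of_ofReal_le (e3.symm.le.trans le_add_self) hX
      set v := projGradStep (η 0) (b 0) (mkParam (patch (√(γ : ℝ) • w₀)) 0)
        (positiveSample w σ S₁) with hv
      have hbias : bias v = 0 := by
        rw [hv, bias_projGradStep, hb]; rfl
      have hweight : weight v = firstWeight γ w σ w₀ S₁ := by
        funext i'
        rw [hv, hη]
        exact weight_first_projGradStep γ w σ _ w₀ S₁ i'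
      have hle := norm_firstWeight_le γ w σ w₀ S₁
      rw [← mul_pow, sq_lt_one_iff_abs_lt_one] at x1
      have y1 := (le_abs_self _).trans x1.le
      have hα := norm_firstWeight_sub_le hw (τ := 1 / 1000) hk (γ := γ) (w₀ := w₀)
        (S := S₁) (i := i) (σ := σ) (by linarith) (by linarith)
      have hg := norm_gradWeight_le hbias (by rw [hweight]; exact hle) w σ S₂ i hN
      -- The first step leaves distance `4 / 1000`, the second moves the weight by at most `1 /
      -- 1000`, and normalization doubles the sum.
      have hfin : ‖weight (projGradStep (η 1) (b 1) v (positiveSample w σ S₂)) i - w‖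
          ≤ 2 * (5 / 1000) := by
        rw [weight_projGradStep]
        refine norm_normalize_sub_le hw one_pos ?_
        rw [one_smul, mul_one, hweight, sub_right_comm]
        refine (norm_sub_le _ _).trans ?_
        rw [norm_smul, Real.norm_eq_abs, abs_of_nonneg hη']
        have := mul_le_mul_of_nonneg_left hg hη'
        linarith
      apply ENNReal.ofReal_le_ofReal
      rw [trainedParam, ← hv]
      nlinarith [norm_nonneg (weight (projGradStep (η 1) (b 1) v (positiveSample w σ S₂)) i - w)]
  · refine (lintegral_triple_le _ (mf1 i) (δ₁ := ENNReal.ofReal δ) (δ₂ := ENNReal.ofReal δ)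
      (δ₃ := ENNReal.ofReal δ) ?_ ?_ fun w₀ S₁ => ?_).trans ?_
    · exact (lintegral_ofReal_const_mul (sq_nonneg _)
        (lintegral_normSq_patchMean_le hw σ hN i)).trans (ENNReal.ofReal_le_ofReal h1)
    · have e : (0 : ℝ) ≤ 1000 * k := by positivity
      simp_rw [hf₂, ENNReal.ofReal_mul e]
      simp_rw [lintegral_const_mul' _ _ ENNReal.ofReal_ne_top]
      refine le_trans ?_ (ENNReal.ofReal_le_ofReal h2)
      rw [ENNReal.ofReal_mul e]
      gcongr
      exact lintegral_initEffect_le γ hw σ hN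
    · refine le_trans ?_ (ENNReal.ofReal_le_ofReal h3)
      rw [hf₃, lintegral_const_mul' _ _ ENNReal.ofReal_ne_top, lintegral_add_left measurable_const,
        ENNReal.ofReal_mul (p := 2000 * η 1 * (k + 1)) (by positivity)]
      simp only [lintegral_const, measure_univ, mul_one]
      gcongr
      calc _ ≤ 1 + ENNReal.ofReal (2 + 2 * σ ^ 2 * (k * d)) := by
            gcongr
            exact lintegral_mean_normSq_noisySignal_le hw σ hN
        _ = _ := by
            rw [← ENNReal.ofReal_one, ← ENNReal.ofReal_add zero_le_one (by positivity)]
            ring_nf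
    · rw [← ENNReal.ofReal_add hδ hδ, ← ENNReal.ofReal_add (by positivity)
        hδ, ENNReal.ofReal_add (p := 100 / 1000000) (by norm_num) (by positivity)]
      gcongr
      rw [← ENNReal.ofReal_ofNat, ← ENNReal.ofReal_mul (by norm_num)]
      apply ENNReal.ofReal_le_ofReal
      linarith

end training

/-! Choice of the hyperparameters -/

/-- The variance of the initialization. -/
noncomputable def initVariance (k d : ℕ) : ℝ≥0 := (((k * d + 1 : ℕ) : ℝ≥0) ^ 8)⁻¹

/-- The bias after the first step. -/
noncomputable def firstBias (K : ℝ) (k d : ℕ) : ℝ≥0 :=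
  if 64 * K ^ 2 * Real.log (k * d) ≤ k then Real.toNNReal (K * √(Real.log (k * d) / k)) else 0

/-- The biases. -/
noncomputable def biases (K : ℝ) (k d : ℕ) : Fin 2 → ℝ≥0 :=
  ![firstBias K k d, Real.toNNReal (K * √(Real.log k / k))]

/-- The step sizes. -/
noncomputable def stepSizes (K : ℝ) (k d : ℕ) : Fin 2 → ℝ :=
  ![1 / 2, if 64 * K ^ 2 * Real.log (k * d) ≤ k then k / (2 * (1 / 1000) * firstBias K k d) + 1
    else 1 / ((k : ℝ) * d + 1) ^ 3]

theorem initVariance_pos (k d : ℕ) : 0 < initVariance k d := by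
  unfold initVariance; positivity

theorem stepSizes_pos (K : ℝ) (k d : ℕ) (t : Fin 2) : 0 < stepSizes K k d t := by
  fin_cases t
  · simp [stepSizes]
  · simp only [stepSizes]
    change 0 < ite _ _ _
    -- The summand 1 in the large step size keeps it positive in degenerate cases such as `k = 0` or
    -- `k d = 1`, where the bias is 0.
    split_ifs <;> positivity

theorem sqrt_initVariance (k d : ℕ) :
    √(initVariance k d : ℝ) = 1 / ((k : ℝ) * d + 1) ^ 4 := by
  have : (initVariance k d : ℝ) = (1 / ((k : ℝ) * d + 1) ^ 4) ^ 2 := by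
    unfold initVariance
    push_cast
    field_simp
  rw [this, Real.sqrt_sq (by positivity)]

theorem mul_sqrt_div_sq {K x k : ℝ} (hx : 0 ≤ x) (hk : 0 < k) :
    (K * √(x / k)) ^ 2 = K ^ 2 * (x / k) := by
  rw [mul_pow, Real.sq_sqrt (by positivity)]

theorem sqrt_mul_mul_sqrt_div {x k : ℝ} (hx : 0 ≤ x) (hk : 0 < k) :
    √(k * x) * √(x / k) = x := by
  rw [← Real.sqrt_mul (by positivity), show k * x * (x / k) = x ^ 2 by field_simp,
    Real.sqrt_sq hx]

/-- The part of the risk which is due to the final bias and the noise. -/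
theorem noise_risk_le {B K k σ : ℝ} (hB : 1 ≤ B) (hK : K = 2 * B ^ 2 + 20) (hk : 1 ≤ k)
    (hl : 1000000000000000 ≤ Real.log k) (hlk : 12 * K ^ 2 * (Real.log k / k) ≤ 5 / 10000)
    (hσ : σ ^ 2 ≤ B ^ 2 / k) :
    6 * σ ^ 2 + 6 * (K * √(Real.log k / k)) ^ 2 + 8 * k ^ 2 / √(k * Real.log k) ^ 2 *
      Real.exp (-(√(k * Real.log k) * (K * √(Real.log k / k))) +
        √(k * Real.log k) ^ 2 * σ ^ 2 / 2) ≤ 1 / 1000 := by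
  have hk0 : 0 < k := by linarith
  set ℓ := Real.log k with hℓ
  have hl0 : 0 < ℓ := by linarith
  rw [mul_sqrt_div_sq hl0.le hk0, show √(k * ℓ) * (K * √(ℓ / k)) = K * ℓ by
    rw [mul_left_comm, sqrt_mul_mul_sqrt_div hl0.le hk0], Real.sq_sqrt (by positivity)]
  have e1 : k * ℓ * σ ^ 2 ≤ B ^ 2 * ℓ := by
    rw [le_div_iff₀ hk0] at hσ
    nlinarith
  -- With `s = √(k log k)` the exponent is at most `(B² / 2 - K) log k`, and `K ≥ B² / 2 + 1`. The
  -- resulting `1 / k` turns the prefactor `8 k / log k` into `8 / log k`.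
  have e2 : Real.exp (-(K * ℓ) + k * ℓ * σ ^ 2 / 2) ≤ 1 / k := by
    have hkℓ : 1 / k = Real.exp (-ℓ) := by rw [Real.exp_neg, Real.exp_log hk0, one_div]
    rw [hkℓ]
    apply Real.exp_le_exp.2
    nlinarith [sq_nonneg B]
  have e3 : 8 * k ^ 2 / (k * ℓ) * Real.exp (-(K * ℓ) + k * ℓ * σ ^ 2 / 2) ≤ 8 / ℓ := by
    calc _ ≤ 8 * k ^ 2 / (k * ℓ) * (1 / k) := by gcongr
      _ = 8 / ℓ := by field_simp
  have e4 : 8 / ℓ ≤ 1 / 10000 := by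
    rw [div_le_iff₀ hl0]; linarith
  have e5 : B ^ 2 / k ≤ K ^ 2 * (ℓ / k) := by
    rw [mul_div_assoc']
    gcongr
    have : B ^ 2 ≤ K := by nlinarith
    have : K ≤ K ^ 2 := by nlinarith
    nlinarith [sq_nonneg K]
  linarith

/-- The regime condition `64 K² L ≤ k` says `b² ≤ 1 / 64`. The bounds on `σ` come from `b ≥ 1000 K /
√k`, a consequence of `√L ≥ 1000`. -/
theorem first_bias_bounds {B K k L σ b : ℝ} (hB : 1 ≤ B) (hK : K = 2 * B ^ 2 + 20)
    (hk : 1 ≤ k) (hL : 1000000000000000 ≤ L) (hreg : 64 * K ^ 2 * L ≤ k) (hσ : 0 ≤ σ)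
    (hσB : σ ≤ B / √k) (hb : b = K * √(L / k)) :
    0 < b ∧ b ^ 2 = K ^ 2 * (L / k) ∧ b ≤ 1 / 8 ∧ σ ≤ b ∧ σ ^ 2 ≤ 1 / 1000 * b := by
  have hk0 : 0 < k := by linarith
  have hL0 : 0 < L := by linarith
  have hBK : B ≤ K := by nlinarith
  have hBK2 : B ^ 2 ≤ K := by nlinarith
  have hK0 : 0 < K := by linarith
  have hbpos : 0 < b := by
    rw [hb]; exact mul_pos hK0 (Real.sqrt_pos.2 (by positivity))
  have hbsq : b ^ 2 = K ^ 2 * (L / k) := by rw [hb, mul_sqrt_div_sq hL0.le hk0]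
  have hb8 : b ≤ 1 / 8 := by
    have : b ^ 2 ≤ (1 / 8) ^ 2 := by
      rw [hbsq, mul_div_assoc', div_le_iff₀ hk0]; linarith
    exact (sq_le_sq₀ hbpos.le (by norm_num)).1 this
  have hsk : 1 ≤ √k := Real.one_le_sqrt.2 hk
  have hbk : 1000 * (K / √k) ≤ b := by
    have h1 : 1000 ≤ √L := Real.le_sqrt_of_sq_le (by linarith)
    calc 1000 * (K / √k) ≤ √L * (K / √k) := by gcongr
      _ = b := by rw [hb, Real.sqrt_div hL0.le]; ring
  have hKs : 0 < K / √k := by positivity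
  refine ⟨hbpos, hbsq, hb8, ?_, ?_⟩
  · have : B / √k ≤ K / √k := by gcongr
    linarith
  · have h1 : σ ^ 2 ≤ (B / √k) ^ 2 := by gcongr
    have h2 : (B / √k) ^ 2 ≤ K / √k := by
      rw [div_pow, sq √k]
      exact (div_le_div_of_nonneg_right hBK2 (by positivity)).trans
        (div_le_div_of_nonneg_left hK0.le (by positivity) (by nlinarith only [hsk]))
    linarith

/-! ### Numerical bounds on the error terms -/

section numerics
variable {B K C k d L σ N : ℝ}

/-- Serves both regimes: with many patches `c = (8 b)²` is itself of order `L / k`, and with few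
patches `c` is constant and `k` is of order `L`. In both cases `c k` is of order `K² L`, which the
factor `K²` in `C` absorbs. -/
theorem first_error_le (hK : 1 ≤ K) (hC : C = 100000000000000 * K ^ 2) (hk : 1 ≤ k)
    (hL : 1000000000000000 ≤ L) (hN : 0 < N) (h1 : k / N ≤ 1 / (20 * L))
    (h2 : σ ^ 2 * k * d / N ≤ 4 / (C * L)) {c : ℝ} (hc : 0 ≤ c)
    (hc' : c ≤ 1000000) (hck : c * k ≤ 1000000 * (64 * K ^ 2 * L)) :
    c * k ^ 2 * ((1 / k + σ ^ 2 * d) / N) ≤ 1 / 100000 := by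
  have e : c * k ^ 2 * ((1 / k + σ ^ 2 * d) / N) = c * (k / N) + c * k * (σ ^ 2 * k * d / N) := by
    field_simp
  have hL0 : 0 < L := by linarith
  have hC0 : 0 < C := by rw [hC]; positivity
  rw [e]
  have a1 : c * (k / N) ≤ 1000000 * (1 / (20 * L)) := by
    gcongr
  have a2 : c * k * (σ ^ 2 * k * d / N) ≤ 1000000 * (64 * K ^ 2 * L) * (4 / (C * L)) := by
    calc _ ≤ c * k * (4 / (C * L)) := by gcongr
      _ ≤ _ := by gcongr
  have a3 : 1000000 * (64 * K ^ 2 * L) * (4 / (C * L)) = 256 / 100000000 := by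
    rw [hC]; field_simp; norm_num
  have a4 : 1000000 * (1 / (20 * L)) ≤ 1 / 1000000 := by
    rw [mul_one_div, div_le_div_iff₀ (by positivity) (by norm_num)]
    linarith
  linarith

/-- The standard deviation `(k d + 1)⁻⁴` beats one factor from the initialization norm, one from the
squared input norm, and `k`, with `1 / k` to spare. -/
theorem init_error_le (hB : 1 ≤ B) (hk : 1 ≤ k) (hd : 1 ≤ d) (hσ : σ ^ 2 ≤ B ^ 2) {M : ℝ}
    (hM : 0 ≤ M) :
    M * k * (1 / (k * d + 1) ^ 4 * (1 + k * d) * (3 + 2 * σ ^ 2 * (k * d))) ≤ 3 * M * B ^ 2 / k := by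
  have hX : k ≤ k * d := by nlinarith
  have h1 : 3 + 2 * σ ^ 2 * (k * d) ≤ 3 * B ^ 2 * (k * d + 1) := by
    have : σ ^ 2 * (k * d) ≤ B ^ 2 * (k * d) := by gcongr
    nlinarith
  have hp : 0 < k * d + 1 := by positivity
  calc _ ≤ M * k * (1 / (k * d + 1) ^ 4 * (1 + k * d) * (3 * B ^ 2 * (k * d + 1))) := by gcongr
    _ = 3 * M * B ^ 2 * (k / (k * d + 1) ^ 2) := by
        rw [add_comm 1]; field_simp
    _ ≤ 3 * M * B ^ 2 * (1 / k) := by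
        gcongr 3 * M * B ^ 2 * ?_
        rw [div_le_div_iff₀ (by positivity) (by positivity)]
        nlinarith
    _ = _ := by ring

/-- Of the three powers in the step size, two cancel the growth of the gradient and one is left for
decay. -/
theorem second_linear_error_le (hB : 1 ≤ B) (hk : 1 ≤ k) (hd : 1 ≤ d) (hσ : σ ^ 2 ≤ B ^ 2) :
    2000 * (1 / (k * d + 1) ^ 3) * (k + 1) * (3 + 2 * σ ^ 2 * (k * d)) ≤ 6000 * B ^ 2 / k := by
  have hX : k ≤ k * d := by nlinarith
  have h1 : 3 + 2 * σ ^ 2 * (k * d) ≤ 3 * B ^ 2 * (k * d + 1) := by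
    have : σ ^ 2 * (k * d) ≤ B ^ 2 * (k * d) := by gcongr
    nlinarith
  have hp : 0 < k * d + 1 := by positivity
  calc _ ≤ 2000 * (1 / (k * d + 1) ^ 3) * (k * d + 1) * (3 * B ^ 2 * (k * d + 1)) := by gcongr
    _ = 6000 * B ^ 2 / (k * d + 1) := by field_simp; norm_num
    _ ≤ 6000 * B ^ 2 / k := by gcongr; linarith

/-- The choice `K / 4 = B² / 2 + 5` leaves exponent at most `-5 L` after the variance term is paid,
that is `(k d)⁻⁵`, against at most order `(k d)³` noise projections. -/
theorem exceedance_error_le (hB : 1 ≤ B) (hK : K = 2 * B ^ 2 + 20) (hC : 0 ≤ C) (hk : 1 ≤ k)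
    (hd : 1 ≤ d) (hL : 1 ≤ L) (hLX : L = Real.log (k * d)) (hσ : k * σ ^ 2 ≤ B ^ 2)
    (hN : N ≤ max (C * (σ ^ 2 * k * (k + d) * L)) (80 * k * L)) :
    2 * N * k * Real.exp (-(√(k * L) * (K * √(L / k)) / 4) + √(k * L) ^ 2 * σ ^ 2 / 2)
      ≤ 2 * (2 * C * B ^ 2 + 80) / k := by
  have hk0 : 0 < k := by linarith
  have hL0 : 0 < L := by linarith
  have hX : k ≤ k * d := by nlinarith
  have hdX : d ≤ k * d := by nlinarith
  have hX0 : 0 < k * d := by positivity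
  have hX1 : 1 ≤ k * d := by linarith
  have hLle : L ≤ k * d := by
    rw [hLX]
    linarith [Real.log_le_sub_one_of_pos hX0]
  have e1 : Real.exp (-(√(k * L) * (K * √(L / k)) / 4) + √(k * L) ^ 2 * σ ^ 2 / 2)
      ≤ 1 / (k * d) ^ 5 := by
    rw [mul_left_comm, sqrt_mul_mul_sqrt_div hL0.le hk0, Real.sq_sqrt (by positivity)]
    have h5 : (k * d) ^ 5 = Real.exp (5 * L) := by
      rw [hLX, show (5 : ℝ) * Real.log (k * d) = ((5 : ℕ) : ℝ) * Real.log (k * d) by norm_num,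
        Real.exp_nat_mul, Real.exp_log hX0]
    rw [h5, one_div, ← Real.exp_neg]
    apply Real.exp_le_exp.2
    have : k * L * σ ^ 2 ≤ B ^ 2 * L := by nlinarith
    rw [hK]
    nlinarith
  have e2 : N ≤ (2 * C * B ^ 2 + 80) * (k * d) ^ 2 := by
    refine hN.trans (max_le ?_ ?_)
    · have h1 : σ ^ 2 * k * (k + d) * L ≤ B ^ 2 * (2 * (k * d)) * (k * d) := by
        have : σ ^ 2 * k ≤ B ^ 2 := by linarith
        have h3 : k + d ≤ 2 * (k * d) := by linarith
        gcongr
      nlinarith [mul_le_mul_of_nonneg_left h1 hC, sq_nonneg (k * d)]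
    · have h1 : k * L ≤ (k * d) * (k * d) := by gcongr
      have : 0 ≤ 2 * C * B ^ 2 * (k * d) ^ 2 := by positivity
      nlinarith
  have hM : 0 ≤ 2 * C * B ^ 2 + 80 := by positivity
  calc _ ≤ 2 * ((2 * C * B ^ 2 + 80) * (k * d) ^ 2) * (k * d) * (1 / (k * d) ^ 5) := by gcongr
    _ = 2 * (2 * C * B ^ 2 + 80) / (k * d) ^ 2 := by field_simp
    _ ≤ _ := by
        gcongr
        nlinarith

end numerics

/-- Lower and upper bounds for the size of each of the two batches. -/
theorem half_floor_bounds {x : ℝ} (hx : 4 ≤ x) :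
    x / 4 ≤ ((⌊x⌋₊ / 2 : ℕ) : ℝ) ∧ ((⌊x⌋₊ / 2 : ℕ) : ℝ) ≤ x := by
  have h1 := Nat.lt_floor_add_one x
  have h2 := Nat.floor_le (show 0 ≤ x by linarith)
  have h3 : ⌊x⌋₊ ≤ 2 * (⌊x⌋₊ / 2) + 1 := by omega
  have h4 : 2 * (⌊x⌋₊ / 2) ≤ ⌊x⌋₊ := by omega
  have h3' : (⌊x⌋₊ : ℝ) ≤ 2 * ((⌊x⌋₊ / 2 : ℕ) : ℝ) + 1 := by exact_mod_cast h3
  have h4' : 2 * ((⌊x⌋₊ / 2 : ℕ) : ℝ) ≤ (⌊x⌋₊ : ℝ) := by exact_mod_cast h4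
  -- Rounding twice leaves at least `(x - 2) / 2`, which is at least `x / 4` exactly when `x ≥ 4`.
  constructor <;> linarith

theorem exists_large_enough (K M : ℝ) : ∃ N₀ : ℕ, 1 ≤ N₀ ∧ ∀ k : ℕ, N₀ ≤ k →
    1000000000000000 ≤ Real.log k ∧ 12 * K ^ 2 * (Real.log k / k) ≤ 5 / 10000 ∧
      M / k ≤ 1 / 100000 := by
  have t0 : Filter.Tendsto (fun k : ℕ => (k : ℝ)) Filter.atTop Filter.atTop :=
    tendsto_natCast_atTop_atTop
  have t1 : Filter.Tendsto (fun k : ℕ => Real.log k) Filter.atTop Filter.atTop :=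
    Real.tendsto_log_atTop.comp t0
  have t2 : Filter.Tendsto (fun k : ℕ => 12 * K ^ 2 * (Real.log k / k)) Filter.atTop
      (nhds (12 * K ^ 2 * 0)) :=
    (Real.isLittleO_log_id_atTop.tendsto_div_nhds_zero.comp t0).const_mul _
  have t3 : Filter.Tendsto (fun k : ℕ => M / k) Filter.atTop (nhds 0) :=
    t0.const_div_atTop M
  rw [mul_zero] at t2
  obtain ⟨N₀, h⟩ := Filter.eventually_atTop.1
    (((t1.eventually_ge_atTop 1000000000000000).and
      (t2.eventually_le_const (by norm_num : (0 : ℝ) < 5 / 10000))).and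
      (t3.eventually_le_const (by norm_num : (0 : ℝ) < 1 / 100000)))
  exact ⟨max N₀ 1, le_max_right _ _, fun k hk =>
    have h' := h k ((le_max_left _ _).trans hk)
    ⟨h'.1.1, h'.1.2, h'.2⟩⟩

theorem biases_zero_of_le {K : ℝ} {k d : ℕ} (hK : 0 ≤ K)
    (h : 64 * K ^ 2 * Real.log (k * d) ≤ k) :
    (biases K k d 0 : ℝ) = K * √(Real.log (k * d) / k) := by
  have : 0 ≤ K * √(Real.log (k * d) / k) := by positivity
  simp only [biases, firstBias, if_pos h, Matrix.cons_val_zero, Real.coe_toNNReal _ this]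

theorem biases_zero_of_lt {K : ℝ} {k d : ℕ} (h : k < 64 * K ^ 2 * Real.log (k * d)) :
    biases K k d 0 = 0 := by
  simp [biases, firstBias, not_le.2 h]

theorem biases_one {K : ℝ} (hK : 0 ≤ K) (k d : ℕ) :
    (biases K k d 1 : ℝ) = K * √(Real.log k / k) := by
  have : 0 ≤ K * √(Real.log k / k) := by positivity
  simp only [biases, Matrix.cons_val_one, Matrix.cons_val_fin_one, Real.coe_toNNReal _ this]

theorem stepSizes_zero (K : ℝ) (k d : ℕ) : stepSizes K k d 0 = 1 / 2 := rfl

theorem le_stepSizes_one {K : ℝ} {k d : ℕ} (h : 64 * K ^ 2 * Real.log (k * d) ≤ k) :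
    k / (2 * (1 / 1000) * biases K k d 0) ≤ stepSizes K k d 1 := by
  simp [stepSizes, biases, h]

theorem stepSizes_one_of_lt {K : ℝ} {k d : ℕ} (h : k < 64 * K ^ 2 * Real.log (k * d)) :
    stepSizes K k d 1 = 1 / ((k : ℝ) * d + 1) ^ 3 := by
  simp [stepSizes, not_le.2 h]

/-- The batches are large enough. -/
theorem batch_size_bounds {C k d L σ N : ℝ} (hC : 1 ≤ C) (hk : 1 ≤ k) (hd : 1 ≤ d) (hL : 1 ≤ L)
    (hN : max (C * (σ ^ 2 * k * (k + d) * L)) (80 * k * L) / 4 ≤ N) :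
    0 < N ∧ k / N ≤ 1 / (20 * L) ∧ σ ^ 2 * k * d / N ≤ 4 / (C * L) ∧
      σ ^ 2 * k * k / N ≤ 4 / (C * L) := by
  have hL0 : 0 < L := by linarith
  have hC0 : 0 < C := by linarith
  have hk0 : 0 < k := by linarith
  have h1 := le_max_left (C * (σ ^ 2 * k * (k + d) * L)) (80 * k * L)
  have h2 := le_max_right (C * (σ ^ 2 * k * (k + d) * L)) (80 * k * L)
  have hkL : 0 < k * L := by positivity
  have hN0 : 0 < N := by linarith
  have f2 : σ ^ 2 * k * (k + d) / N ≤ 4 / (C * L) := by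
    rw [div_le_div_iff₀ hN0 (by positivity)]
    linarith
  refine ⟨hN0, ?_, le_trans ?_ f2, le_trans ?_ f2⟩
  · rw [div_le_div_iff₀ hN0 (by positivity)]
    linarith
  · gcongr
    linarith
  · gcongr
    linarith

/-! ### The regimes of many and of few patches -/

section regimes
variable {B K C L : ℝ} {k d : ℕ} [NeZero k] {γ : ℝ≥0} {η : Fin 2 → ℝ} {b : Fin 2 → ℝ≥0}
  {σ : ℝ} {w : EuclideanSpace ℝ (Fin d)} {n : ℕ}

/-- If there are many patches, then the bias after the first step suppresses the noise. -/
theorem expectedRisk_le_of_many_patches (hB : 1 ≤ B) (hK : K = 2 * B ^ 2 + 20)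
    (hC : C = 100000000000000 * K ^ 2) (hk : 1 ≤ k) (hd : 1 ≤ d)
    (hL : L = Real.log (k * d)) (hLbig : 1000000000000000 ≤ L) (hreg : 64 * K ^ 2 * L ≤ k)
    (hM : 2 * (2 * C * B ^ 2 + 80) / k ≤ 1 / 100000)
    (hinit : 8 * k * (√(γ : ℝ) * (1 + k * d) * (3 + 2 * σ ^ 2 * (k * d))) ≤ 1 / 100000)
    (hσ : 0 < σ) (hσB : σ ≤ B / √(k : ℝ)) (hw : ‖w‖ = 1)
    (hN1 : max (C * (σ ^ 2 * k * (k + d) * L)) (80 * k * L) / 4 ≤ ((n / 2 : ℕ) : ℝ))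
    (hN2 : ((n / 2 : ℕ) : ℝ) ≤ max (C * (σ ^ 2 * k * (k + d) * L)) (80 * k * L))
    (hη : η 0 = 1 / 2) (hb0 : (b 0 : ℝ) = K * √(L / k))
    (hη' : k / (2 * (1 / 1000) * (b 0 : ℝ)) ≤ η 1) {s : ℝ} (hs : 0 < s)
    (hrisk : 6 * σ ^ 2 + 6 * (b 1 : ℝ) ^ 2 + 8 * (k : ℝ) ^ 2 / s ^ 2 *
      Real.exp (-(s * b 1) + s ^ 2 * σ ^ 2 / 2) ≤ 1 / 1000) :
    (lcnAlgorithm k d γ η b).expectedRisk (DSD k d w σ) n ≤ ENNReal.ofReal (1 / 400) := by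
  have hk1 : (1 : ℝ) ≤ k := by exact_mod_cast hk
  have hd1 : (1 : ℝ) ≤ d := by exact_mod_cast hd
  have hk0 : (0 : ℝ) < k := by linarith
  have hK1 : 1 ≤ K := by nlinarith
  have hC1 : 100000000000000 ≤ C := by rw [hC]; nlinarith
  have hL0 : 0 < L := by linarith
  have hσsq : σ ^ 2 ≤ B ^ 2 / k := by
    calc σ ^ 2 ≤ (B / √(k : ℝ)) ^ 2 := by gcongr
      _ = B ^ 2 / k := by rw [div_pow, Real.sq_sqrt hk0.le]
  have hσk : k * σ ^ 2 ≤ B ^ 2 := by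
    have := hσsq
    rw [le_div_iff₀ hk0] at this; linarith
  obtain ⟨hN0, f1, f3, f4⟩ := batch_size_bounds (by linarith) hk1 hd1 (by linarith) hN1
  have hNn : 0 < n / 2 := by exact_mod_cast hN0
  have f5 : 4 / (C * L) ≤ 1 / L := by
    rw [div_le_div_iff₀ (by positivity) hL0]
    nlinarith
  have f6 : 1000000000 * (1 / L) ≤ 1 / 100000 := by
    rw [mul_one_div, div_le_div_iff₀ hL0 (by norm_num)]; linarith
  have f7 : 1 / (20 * L) ≤ 1 / L := one_div_le_one_div_of_le hL0 (by linarith)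
  have f8 : 0 < 1 / L := by positivity
  have hs₀ : 0 < √(k * L) := Real.sqrt_pos.2 (by positivity)
  obtain ⟨hbpos, hbsq, hb8, hσb, hσb'⟩ :=
    first_bias_bounds hB hK hk1 hLbig hreg hσ.le hσB hb0
  have e1 : (8 * (b 0 : ℝ) * k) ^ 2 * ((1 / k + σ ^ 2 * d) / (n / 2 : ℕ)) ≤ 1 / 100000 := by
    have hpos : 0 ≤ 64 * K ^ 2 * L := by positivity
    -- Here `(8 b)² k = 64 K² L`: the smallness of `b²` compensates the extra factor `k` in the
    -- error of the full patch mean.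
    have := first_error_le (c := (8 * (b 0 : ℝ)) ^ 2) hK1 hC hk1 hLbig hN0 f1 f3 (by positivity)
      (by nlinarith only [hbpos, hb8]) (by
        rw [mul_pow, hbsq]
        have : 8 ^ 2 * (K ^ 2 * (L / k)) * k = 64 * K ^ 2 * L := by field_simp; norm_num
        rw [this]
        linarith)
    rwa [mul_pow (8 * (b 0 : ℝ))]
  -- The error along `w` needs `σ² k² / N` small, which the summand `k` of `k + d` in the sample
  -- size provides.
  have e2 : (8 * (k : ℝ)) ^ 2 * ((1 / k + σ ^ 2) / (n / 2 : ℕ)) ≤ 1 / 100000 := by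
    have e : (8 * (k : ℝ)) ^ 2 * ((1 / k + σ ^ 2) / (n / 2 : ℕ))
        = 64 * (k / (n / 2 : ℕ)) + 64 * (σ ^ 2 * k * k / (n / 2 : ℕ)) := by
      field_simp; norm_num
    rw [e]
    linarith
  have e4 : 2 * ((n / 2 : ℕ) : ℝ) * k *
      Real.exp (-(√(k * L) * b 0 / 4) + √(k * L) ^ 2 * σ ^ 2 / 2) ≤ 1 / 100000 := by
    rw [hb0]
    exact (exceedance_error_le hB hK (by linarith) hk1 hd1 (by linarith) hL hσk hN2).trans hM
  have e5 : 1000000 * (k : ℝ) * (4 * (2 + 97 * σ ^ 2 * d)) / (n / 2 : ℕ) ≤ 1 / 100000 := by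
    have e : 1000000 * (k : ℝ) * (4 * (2 + 97 * σ ^ 2 * d)) / (n / 2 : ℕ)
        = 8000000 * (k / (n / 2 : ℕ)) + 388000000 * (σ ^ 2 * k * d / (n / 2 : ℕ)) := by
      ring
    rw [e]
    linarith
  refine (expectedRisk_le_of_threshold hw hη hbpos hb8 hσ.le hσb hσb' hη' hNn hs₀ hs e1 e2 hinit
    e4 e5).trans (ENNReal.ofReal_le_ofReal ?_)
  linarith

/-- If there are few patches, then the network is linear in its weights during the first step. -/
theorem expectedRisk_le_of_few_patches (hB : 1 ≤ B) (hK : K = 2 * B ^ 2 + 20)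
    (hC : C = 100000000000000 * K ^ 2) (hk : 1 ≤ k) (hd : 1 ≤ d)
    (hLbig : 1000000000000000 ≤ L) (hreg : k ≤ 64 * K ^ 2 * L)
    (hinit : 1000 * k * (√(γ : ℝ) * (1 + k * d) * (3 + 2 * σ ^ 2 * (k * d))) ≤ 1 / 100000)
    (hw : ‖w‖ = 1)
    (hN1 : max (C * (σ ^ 2 * k * (k + d) * L)) (80 * k * L) / 4 ≤ ((n / 2 : ℕ) : ℝ))
    (hη : η 0 = 1 / 2) (hb0 : b 0 = 0) (hη' : 0 ≤ η 1)
    (hlin : 2000 * η 1 * (k + 1) * (3 + 2 * σ ^ 2 * (k * d)) ≤ 1 / 100000) {s : ℝ} (hs : 0 < s)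
    (hrisk : 6 * σ ^ 2 + 6 * (b 1 : ℝ) ^ 2 + 8 * (k : ℝ) ^ 2 / s ^ 2 *
      Real.exp (-(s * b 1) + s ^ 2 * σ ^ 2 / 2) ≤ 1 / 1000) :
    (lcnAlgorithm k d γ η b).expectedRisk (DSD k d w σ) n ≤ ENNReal.ofReal (1 / 400) := by
  have hk1 : (1 : ℝ) ≤ k := by exact_mod_cast hk
  have hd1 : (1 : ℝ) ≤ d := by exact_mod_cast hd
  have hK1 : 1 ≤ K := by nlinarith
  have hC1 : 100000000000000 ≤ C := by rw [hC]; nlinarith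
  obtain ⟨hN0, f1, f3, -⟩ := batch_size_bounds (by linarith) hk1 hd1 (by linarith) hN1
  have hNn : 0 < n / 2 := by exact_mod_cast hN0
  have e1 : (1000 * (k : ℝ)) ^ 2 * ((1 / k + σ ^ 2 * d) / (n / 2 : ℕ)) ≤ 1 / 100000 := by
    have := first_error_le (c := 1000000) hK1 hC hk1 hLbig hN0 f1 f3 (by positivity)
      le_rfl (by linarith)
    rwa [mul_pow, show (1000 : ℝ) ^ 2 = 1000000 by norm_num]
  refine (expectedRisk_le_of_linear hw hη hb0 hη' hNn hs e1 hinit hlin).trans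
    (ENNReal.ofReal_le_ofReal ?_)
  linarith

end regimes

theorem expectedRisk_lcnAlgorithm_le {B K C : ℝ} (hB : 1 ≤ B) (hK : K = 2 * B ^ 2 + 20)
    (hC : C = 100000000000000 * K ^ 2) {k d : ℕ} (hk : 1 ≤ k) (hd : 1 ≤ d)
    (hl : 1000000000000000 ≤ Real.log k) (hlk : 12 * K ^ 2 * (Real.log k / k) ≤ 5 / 10000)
    (hM : (6000 * B ^ 2 + 2 * (2 * C * B ^ 2 + 80)) / k ≤ 1 / 100000) {σ : ℝ} (hσ : 0 < σ)
    (hσB : σ ≤ B / √(k : ℝ)) {w : EuclideanSpace ℝ (Fin d)} (hw : ‖w‖ = 1) {n : ℕ}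
    (hn : n = ⌊max (C * (σ ^ 2 * k * (k + d) * Real.log (k * d)))
      (80 * k * Real.log (k * d))⌋₊) :
    (lcnAlgorithm k d (initVariance k d) (stepSizes K k d) (biases K k d)).expectedRisk
      (DSD k d w σ) n ≤ ENNReal.ofReal (1 / 400) := by
  have : NeZero k := ⟨by omega⟩
  have hk1 : (1 : ℝ) ≤ k := by exact_mod_cast hk
  have hd1 : (1 : ℝ) ≤ d := by exact_mod_cast hd
  have hk0 : (0 : ℝ) < k := by linarith
  have hK0 : 0 ≤ K := by nlinarith
  have hC0 : 0 ≤ C := by rw [hC]; positivity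
  have hX : (k : ℝ) ≤ k * d := by nlinarith
  have hLbig : 1000000000000000 ≤ Real.log (k * d) := hl.trans (Real.log_le_log hk0 hX)
  have hl0 : 0 < Real.log (k : ℝ) := by linarith
  have hσsq : σ ^ 2 ≤ B ^ 2 / k := by
    calc σ ^ 2 ≤ (B / √(k : ℝ)) ^ 2 := by gcongr
      _ = B ^ 2 / k := by rw [div_pow, Real.sq_sqrt hk0.le]
  have hσ1 : σ ^ 2 ≤ B ^ 2 := hσsq.trans (div_le_self (sq_nonneg B) hk1)
  have hx4 : 4 ≤ max (C * (σ ^ 2 * k * (k + d) * Real.log (k * d)))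
      (80 * k * Real.log (k * d)) := by
    refine le_trans ?_ (le_max_right _ _)
    nlinarith
  obtain ⟨hN1, hN2⟩ := half_floor_bounds hx4
  rw [← hn] at hN1 hN2
  have hCB : 0 ≤ C * B ^ 2 := by positivity
  have hM1 : 6000 * B ^ 2 / k ≤ 1 / 100000 := by
    refine le_trans ?_ hM
    gcongr
    linarith
  have hM2 : 2 * (2 * C * B ^ 2 + 80) / k ≤ 1 / 100000 := by
    refine le_trans ?_ hM
    gcongr
    nlinarith
  have hs : 0 < √(k * Real.log k) := Real.sqrt_pos.2 (by positivity)
  have hrisk := noise_risk_le hB hK hk1 hl hlk hσsq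
  rw [← biases_one hK0 k d] at hrisk
  have hinit : ∀ M : ℝ, 0 ≤ M → M ≤ 2000 → M * k * (√(initVariance k d : ℝ) * (1 + k * d) *
      (3 + 2 * σ ^ 2 * (k * d))) ≤ 1 / 100000 := by
    intro M hM0 hM'
    rw [sqrt_initVariance]
    refine (init_error_le hB hk1 hd1 hσ1 hM0).trans (le_trans ?_ hM1)
    gcongr
    linarith
  rcases le_or_gt (64 * K ^ 2 * Real.log (k * d)) (k : ℝ) with hreg | hreg
  · exact expectedRisk_le_of_many_patches hB hK hC hk hd rfl hLbig hreg hM2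
      (hinit 8 (by norm_num) (by norm_num)) hσ hσB hw hN1 hN2 (stepSizes_zero K k d)
      (biases_zero_of_le hK0 hreg) (le_stepSizes_one hreg) hs hrisk
  · refine expectedRisk_le_of_few_patches hB hK hC hk hd hLbig hreg.le
      (hinit 1000 (by norm_num) (by norm_num)) hw hN1 (stepSizes_zero K k d)
      (biases_zero_of_lt hreg) (stepSizes_pos K k d 1).le ?_ hs hrisk
    rw [stepSizes_one_of_lt hreg]
    exact (second_linear_error_le hB hk1 hd1 hσ1).trans hM1

theorem mainTheorem2 :
    ∀ B : ℝ,
    -- variance, step sizes and biases, which may depend on the patch number `k` and dimension `d`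
    ∃ (γ : ℕ → ℕ → ℝ≥0) (η : ℕ → ℕ → Fin 2 → ℝ) (b : ℕ → ℕ → Fin 2 → ℝ≥0),
      (∀ k d, 0 < γ k d ∧ ∀ t, 0 < η k d t) ∧
      (∀ k d : ℕ, (lcnAlgorithm k d (γ k d) (η k d) (b k d)).IsEquivariant (patchGroup k d)) ∧
      ∃ C : ℝ, 0 < C ∧ ∀ A : ℝ, ∃ N₀ : ℕ, ∀ k d : ℕ, N₀ ≤ k → N₀ ≤ d →
        (k : ℝ) ≤ A * Real.exp d →
        ∀ σ : ℝ, 0 < σ → σ ≤ B / √(k : ℝ) →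
        ∀ wstar : EuclideanSpace ℝ (Fin d), ‖wstar‖ = 1 →
        ∀ n : ℕ, n = ⌊max (C * (σ ^ 2 * k * (k + d) * Real.log (k * d)))
            (80 * k * Real.log (k * d))⌋₊ →
          (lcnAlgorithm k d (γ k d) (η k d) (b k d)).expectedRisk (DSD k d wstar σ) n
              ≤ ENNReal.ofReal (1 / 400) ∧
          (lcnAlgorithm k d (γ k d) (η k d) (b k d)).sampleComplexity (DSD k d wstar σ)
              (ENNReal.ofReal (1 / 400)) ≤ n := by
  intro B
  -- Enlarging `B` only weakens the assumption on `σ`, and `B' ≥ 1` lets constants be absorbed into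
  -- powers of `B'`.
  set B' := max B 1 with hB'
  -- Determined by the union bound over the noise of the second batch, which is measured against a
  -- quarter of the first threshold.
  set K := 2 * B' ^ 2 + 20 with hK
  set C := 100000000000000 * K ^ 2 with hC
  have hKpos : 0 < K := by positivity
  refine ⟨initVariance, stepSizes K, biases K,
    fun k d => ⟨initVariance_pos k d, stepSizes_pos K k d⟩,
    fun k d => lcnAlgorithm_isEquivariant k d _ _ _, C, by positivity, fun A => ?_⟩
  obtain ⟨N₀, hN₀, h⟩ := exists_large_enough K (6000 * B' ^ 2 + 2 * (2 * C * B' ^ 2 + 80))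
  refine ⟨N₀, fun k d hk hd _ σ hσ hσB w hw n hn => ?_⟩
  obtain ⟨h1, h2, h3⟩ := h k hk
  have hσB' : σ ≤ B' / √(k : ℝ) := hσB.trans (by gcongr; exact le_max_left _ _)
  have hrisk := expectedRisk_lcnAlgorithm_le (le_max_right B 1) hK hC (hN₀.trans hk)
    (hN₀.trans hd) h1 h2 h3 hσ hσB' hw hn
  exact ⟨hrisk, iInf₂_le n hrisk⟩
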